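/- Let $K$ be a field of characteristic $0$ such that $K_{\mathrm{ab}}$, the maximal subextension of $K/\mathbb{Q}$ that is abelian over $\mathbb{Q}$, has finite degree over $\mathbb{Q}$. Let $\lambda$ be the number of roots of unity contained in $K$, and let $f$ be the conductor of $K_{\mathrm{ab}}/\mathbb{Q}$, that is, the smallest positive integer $f$ such that $K_{\mathrm{ab}}\subseteq\mathbb{Q}(\zeta_f)$, where $\zeta_m$ denotes a primitive $m$-th root of unity (so $f$ is either odd or divisible by $4$). Put $$ f' := \begin{cases} \prod_{p\mid\lambda} p^{\operatorname{ord}_p(f)} & \text{if } 4\mid f,\\[2pt] 4\prod_{p\mid\lambda} p^{\operatorname{ord}_p(f)} & \text{if } f \text{ is odd,}\end{cases} $$ the products being over the primes $p$ dividing $\lambda$. Then the Chevalley--Bass number $\Lambda$ of $K$, that is, the smallest positive integer $\Lambda$ such that $$ (K(\zeta_{\Lambda n})^\times)^{\Lambda n}\cap K^\times\subseteq (K^\times)^n\qquad\text{for every positive integer } n, $$ exists and satisfies $$ \operatorname{lcm}\left(4,\lambda,\frac{f'}{\lambda}\right)\;\Big|\;\Lambda\;\Big|\;f'. $$ -/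

import Mathlib

/-- The maximal abelian subextension `K_ab` of `K/ℚ`: the compositum of all subfields of `K` that
are abelian (Galois with commutative Galois group) over `ℚ`. -/
def maxAbelianSubextension (K : Type*) [Field K] [CharZero K] : IntermediateField ℚ K :=
  sSup {F : IntermediateField ℚ K | IsAbelianGalois ℚ F}

/-- The number of roots of unity contained in `K`, that is, the number of elements of finite order
in `Kˣ`. -/
noncomputable def numRootsOfUnity (K : Type*) [Field K] : ℕ :=
  Nat.card (CommGroup.torsion Kˣ)

/-- `f` is the conductor of `L/ℚ`: the smallest positive integer `f` such that `L ⊆ ℚ(ζ_f)`,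
that is, such that there is a field embedding (necessarily `ℚ`-linear) of `L` into `ℚ(ζ_f)`.
(The place at infinity is not taken into account.) -/
def IsConductor (L : Type*) [Field L] (f : ℕ) : Prop :=
  IsLeast {n : ℕ | 0 < n ∧ Nonempty (L →+* CyclotomicField n ℚ)} f

/-- The property defining the Chevalley-Bass number: for every positive integer `n`, each
element of `Kˣ` which is a `Λn`-th power in `K(ζ_{Λn})` is an `n`-th power in `K`. -/
def HasChevalleyBassProperty (K : Type*) [Field K] (Λ : ℕ) : Prop :=
  ∀ n : ℕ, 0 < n → ∀ x : K, x ≠ 0 →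
    (∃ y : CyclotomicField (Λ * n) K,
      y ^ (Λ * n) = algebraMap K (CyclotomicField (Λ * n) K) x) →
    ∃ z : K, z ^ n = x

/-- `Λ` is the Chevalley-Bass number of `K`: the smallest positive integer with the property
above. -/
def IsChevalleyBassNumber (K : Type*) [Field K] (Λ : ℕ) : Prop :=
  IsLeast {m : ℕ | 0 < m ∧ HasChevalleyBassProperty K m} Λ

/-- The integer `f'` attached to the number of roots of unity `l` and the conductor `f`: the product
of `p ^ ord_p f` over the primes `p ∣ l`, with an extra factor `4` when `f` is odd.
(A conductor is either odd or divisible by `4`.) -/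
noncomputable def fPrime (l f : ℕ) : ℕ :=
  if 4 ∣ f then ∏ p ∈ l.primeFactors, p ^ padicValNat p f
  else 4 * ∏ p ∈ l.primeFactors, p ^ padicValNat p f

/-! Write `μ_n` for the group of `n`-th roots of unity and `ζ_n` for a generator. Everything rests
on the size of the cyclotomic character of `K`. An element of `K` lying in `ℚ(ζ_M)` generates an
abelian field, so it lies in `K_ab ⊆ ℚ(ζ_f)`; hence for every `M` divisible by `f` each unit class
modulo `M` that is `1` modulo `f` is realized by an automorphism over `K`
(`IntermediateField.exists_gal_apply_eq_pow`). That some `f` exists is the Kronecker-Weber theorem,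
which is proved here as well.

Upper bound, one prime at a time. If `p ∤ λ`, some `σ` acts on `μ_{p^k}` by an exponent `c` with `c
- 1` prime to `p`. Since `K(ζ_N)/K` is abelian, this kills the obstruction to extracting a `p^k`-th
root (`exists_pow_eq_of_no_primitiveRoot`). If `p ∣ λ` and `a = ord_p f'`, there is `σ` acting as `1
+ p^a` on `μ_{p^(a+k)}` and trivially on roots of unity of order prime to `p`. If `Y^(p^(a+k)) = x`
and `σ Y = ξ Y`, then `Y^(p^a) / ξ` lies in `K`, and lifting the exponent gives `ξ^(p^k) = 1`, so
its `p^k`-th power is `x` (`exists_pow_eq_of_apply_eq_pow`).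

Lower bound. Admissible integers are closed under gcd, so `Λ` divides each of them, in particular
`f'`. A Kummer generator of a subextension of `K(ζ_q)/K`, for a prime `q ≡ 1` modulo `λ`, forces `λ
∣ Λ`. The identity `(1 + i)^4 = -4` forces `4 ∣ Λ`. If `p ∣ λ` and `p^2 ∣ f`, minimality of `f`
gives `K(ζ_f) = K(ζ_{f/p})` (`cyclotomic_mul_le`), and this unexpected root of unity forces `ord_p f
≤ ord_p λ + ord_p Λ` (`le_add_of_cyclotomic_le`).

Kronecker-Weber reduces to an abelian field of exponent `p^m`. Adjoin `ζ` of order `p^(m+3)` times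
the product of the other ramified primes `l`. Inertia at such `l` is tame, of order at most `l - 1`
(`PrimeOrder.card_inertia_le`); a small subgroup `C` accounts for `p`. These subgroups generate the
Galois group: otherwise Minkowski's theorem leads to an extension of degree `p` unramified outside
`p` and not cyclotomic. For `p = 2` such a field would be `ℚ(√d)` with `d ∈ {-1, ±2}`; for odd `p`
it would give a totally ramified extension of type `(p, p)`, excluded by
`PrimeOrder.false_of_totallyRamified_sq`. So the degree is at most that of `ℚ(ζ)`. -/

/-! ### Orders at a prime of a Dedekind domain -/

namespace PrimeOrder

/-- `x` has order exactly `n` at the ideal `P`. -/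
def HasOrd {O : Type*} [CommRing O] (P : Ideal O) (x : O) (n : ℕ) : Prop :=
  x ∈ P ^ n ∧ x ∉ P ^ (n + 1)

section

variable {O : Type*} [CommRing O] [IsDedekindDomain O] {P : Ideal O} [hPp : P.IsPrime]

/-- Passing to the multiplicative valuation makes additivity of orders immediate. -/
theorem hasOrd_iff_intValuation (hP : P ≠ ⊥) (x : O) (n : ℕ) :
    HasOrd P x n ↔
      (⟨P, hPp, hP⟩ : IsDedekindDomain.HeightOneSpectrum O).intValuation x =
        WithZero.exp (-(n : ℤ)) := by
  set v : IsDedekindDomain.HeightOneSpectrum O := ⟨P, hPp, hP⟩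
  have h1 : x ∈ P ^ n ↔ _ := (v.intValuation_le_pow_iff_mem x n).symm
  have h2 : x ∈ P ^ (n + 1) ↔ _ := (v.intValuation_le_pow_iff_mem x (n + 1)).symm
  rw [HasOrd, h1, h2, not_le]
  constructor
  · rintro ⟨h3, h4⟩
    have hx : v.intValuation x ≠ 0 := fun h => by simp [h] at h4
    rw [← WithZero.exp_log hx] at h3 h4 ⊢
    rw [WithZero.exp_le_exp] at h3
    rw [WithZero.exp_lt_exp] at h4
    congr 1
    push_cast at h4
    omega
  · intro h
    rw [h]
    refine ⟨le_rfl, ?_⟩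
    rw [WithZero.exp_lt_exp]
    push_cast
    omega

theorem HasOrd.mul (hP : P ≠ ⊥) {x y : O} {i j : ℕ} (hx : HasOrd P x i) (hy : HasOrd P y j) :
    HasOrd P (x * y) (i + j) := by
  rw [hasOrd_iff_intValuation hP] at *
  rw [map_mul, hx, hy, ← WithZero.exp_add]
  congr 1
  push_cast
  ring

omit [IsDedekindDomain O] in
theorem hasOrd_one : HasOrd P (1 : O) 0 := by
  refine ⟨by simp, ?_⟩
  rw [zero_add, pow_one]
  exact fun h => hPp.ne_top ((Ideal.eq_top_iff_one _).2 h)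

theorem HasOrd.prod (hP : P ≠ ⊥) {ι : Type*} (s : Finset ι) {f : ι → O} {g : ι → ℕ}
    (h : ∀ i ∈ s, HasOrd P (f i) (g i)) : HasOrd P (∏ i ∈ s, f i) (∑ i ∈ s, g i) := by
  classical
  induction s using Finset.induction_on with
  | empty => simpa using hasOrd_one
  | insert a s ha ih =>
    rw [Finset.prod_insert ha, Finset.sum_insert ha]
    exact (h a (by simp)).mul hP (ih fun i hi => h i (by simp [hi]))

theorem HasOrd.pow (hP : P ≠ ⊥) {x : O} {i : ℕ} (hx : HasOrd P x i) (n : ℕ) :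
    HasOrd P (x ^ n) (n * i) := by
  simpa using HasOrd.prod hP (Finset.range n) (f := fun _ => x) (g := fun _ => i) fun _ _ => hx

omit [IsDedekindDomain O] hPp in
theorem HasOrd.le_of_mem {x : O} {i j : ℕ} (hx : HasOrd P x i) (h : x ∈ P ^ j) : j ≤ i := by
  by_contra! hlt
  exact hx.2 (Ideal.pow_le_pow_right hlt h)

omit [IsDedekindDomain O] hPp in
theorem HasOrd.unique {x : O} {i j : ℕ} (hx : HasOrd P x i) (hy : HasOrd P x j) : i = j :=
  le_antisymm (hy.le_of_mem hx.1) (hx.le_of_mem hy.1)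

theorem exists_hasOrd {x : O} (hx : x ≠ 0) : ∃ n, HasOrd P x n := by
  by_contra! h
  have : ∀ n, x ∈ P ^ n := by
    intro n
    induction n with
    | zero => simp
    | succ n ih =>
      by_contra hn
      exact h n ⟨ih, hn⟩
  have h2 := Ideal.iInf_pow_eq_bot_of_isDomain P hPp.ne_top
  have h3 : x ∈ ⨅ i : ℕ, P ^ i := by simpa using this
  rw [h2] at h3
  exact hx (by simpa using h3)

theorem HasOrd.mem_of_mul_mem (hP : P ≠ ⊥) {x y : O} {i j : ℕ} (hx : HasOrd P x i)
    (h : x * y ∈ P ^ (i + j)) : y ∈ P ^ j := by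
  by_cases hy : y = 0
  · simp [hy]
  obtain ⟨k, hk⟩ := exists_hasOrd (P := P) hy
  have := (hx.mul hP hk).le_of_mem h
  exact Ideal.pow_le_pow_right (by omega) hk.1

/-- A generator of `P ^ i / P ^ (i + 1)`. -/
theorem HasOrd.exists_sub_mul_mem (hP : P ≠ ⊥) {π x : O} {i : ℕ} (hπ : HasOrd P π i)
    (hx : x ∈ P ^ i) : ∃ y, x - y * π ∈ P ^ (i + 1) := by
  obtain ⟨d, e, he, h⟩ := Ideal.exists_mul_add_mem_pow_succ hP π x hπ.1 hπ.2 hx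
  exact ⟨d, by rwa [show x - d * π = e by rw [← h]; ring]⟩

theorem HasOrd.exists_sub_intCast_mul_mem (hP : P ≠ ⊥) (hres : ∀ x : O, ∃ n : ℤ, x - n ∈ P)
    {π x : O} {i : ℕ} (hπ : HasOrd P π i)
    (hx : x ∈ P ^ i) : ∃ n : ℤ, x - n * π ∈ P ^ (i + 1) := by
  obtain ⟨y, hy⟩ := hπ.exists_sub_mul_mem hP hx
  obtain ⟨n, hn⟩ := hres y
  refine ⟨n, ?_⟩
  have : x - n * π = (x - y * π) + (y - n) * π := by ring
  rw [this]
  refine add_mem hy ?_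
  rw [pow_succ']
  exact Ideal.mul_mem_mul hn hπ.1

omit [IsDedekindDomain O] in
theorem intCast_mem_iff {p : ℕ} (hp : p.Prime) (hpP : (p : O) ∈ P) (n : ℤ) :
    (n : O) ∈ P ↔ (p : ℤ) ∣ n := by
  constructor
  · intro h
    by_contra hn
    have hc : IsCoprime (p : ℤ) n := by
      rw [Int.isCoprime_iff_gcd_eq_one]
      exact (Nat.Prime.coprime_iff_not_dvd hp).2 (fun h => hn (Int.natCast_dvd.2 h))
    obtain ⟨a, b, hab⟩ := hc
    apply hPp.ne_top
    rw [Ideal.eq_top_iff_one]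
    have : (1 : O) = ((a * p + b * n : ℤ) : O) := by rw [hab]; simp
    rw [this]
    push_cast
    exact add_mem (P.mul_mem_left _ hpP) (P.mul_mem_left _ h)
  · rintro ⟨k, rfl⟩
    push_cast
    exact P.mul_mem_right _ hpP

end

section Action

variable {O : Type*} [CommRing O] {P : Ideal O} {G : Type*} [Group G] [MulSemiringAction G O]

theorem smul_mem_pow {g : G} (hg : ∀ x ∈ P, g • x ∈ P) {n : ℕ} {x : O} (hx : x ∈ P ^ n) :
    g • x ∈ P ^ n := by
  have h := Ideal.mem_map_of_mem (MulSemiringAction.toRingHom G O g) hx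
  rw [Ideal.map_pow] at h
  refine Ideal.pow_right_mono ?_ n h
  rw [Ideal.map_le_iff_le_comap]
  exact hg

theorem smul_mem_of_mem_inertia {g : G} (hg : ∀ x : O, g • x - x ∈ P) {x : O} (hx : x ∈ P) :
    g • x ∈ P := by
  have := add_mem (hg x) hx
  simpa using this

end Action

/-- If all the elements of order prime to the residue characteristic in a group of automorphisms
acting trivially modulo `P`, the group acts faithfully on `P / P ^ 2`. -/
theorem smul_eq_self_of_tame {O : Type*} [CommRing O] [IsDedekindDomain O] {P : Ideal O}
    [hPp : P.IsPrime] (hP : P ≠ ⊥) {G : Type*} [Group G] [MulSemiringAction G O]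
    {g : G} (hg : ∀ x : O, g • x - x ∈ P) {n : ℕ} (hn : g ^ n = 1) (hnP : (n : O) ∉ P)
    {π : O} (hπ : HasOrd P π 1) (hgπ : g • π - π ∈ P ^ 2) (x : O) : g • x = x := by
  have hgP : ∀ x ∈ P, g • x ∈ P := fun x hx => smul_mem_of_mem_inertia hg hx
  -- the action on `π ^ i` modulo `P ^ (i + 1)`
  have hpow : ∀ i : ℕ, g • π ^ i - π ^ i ∈ P ^ (i + 1) := by
    intro i
    induction i with
    | zero => simp
    | succ i ih =>
      have : g • π ^ (i + 1) - π ^ (i + 1) =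
          (g • π ^ i - π ^ i) * g • π + π ^ i * (g • π - π) := by
        rw [pow_succ, smul_mul']; ring
      rw [this]
      refine add_mem ?_ ?_
      · rw [pow_succ]
        exact Ideal.mul_mem_mul ih (hgP _ (by simpa using hπ.1))
      · rw [show i + 1 + 1 = i + 2 by ring, pow_add]
        exact Ideal.mul_mem_mul (Ideal.pow_mem_pow (by simpa using hπ.1) _) hgπ
  have hgr : ∀ i : ℕ, ∀ y ∈ P ^ i, g • y - y ∈ P ^ (i + 1) := by
    intro i y hy
    have hπi : HasOrd P (π ^ i) i := by simpa using hπ.pow hP i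
    obtain ⟨z, hz⟩ := hπi.exists_sub_mul_mem hP hy
    have : g • y - y = (g • (y - z * π ^ i) - (y - z * π ^ i)) +
        ((g • z - z) * g • π ^ i + z * (g • π ^ i - π ^ i)) := by
      rw [smul_sub, smul_mul']; ring
    rw [this]
    refine add_mem (sub_mem (smul_mem_pow hgP hz) hz) (add_mem ?_ ?_)
    · rw [pow_succ']
      exact Ideal.mul_mem_mul (hg z) (smul_mem_pow hgP hπi.1)
    · exact Ideal.mul_mem_left _ _ (hpow i)
  have key : ∀ i : ℕ, g • x - x ∈ P ^ i := by
    intro i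
    induction i with
    | zero => simp
    | succ i ih =>
      -- Modulo `P ^ (i + 1)` the element `δ` is fixed by `g`, so `g ^ j` moves `x` by `j δ`. At `j
      -- = n` this gives `n δ ≡ 0`, and `n` is invertible modulo `P`.
      set δ := g • x - x with hδ
      have h1 : ∀ j : ℕ, g ^ j • x - x - j * δ ∈ P ^ (i + 1) := by
        intro j
        induction j with
        | zero => simp
        | succ j ihj =>
          have : g ^ (j + 1) • x - x - ((j + 1 : ℕ) : O) * δ =
              g • (g ^ j • x - x - j * δ) + j * (g • δ - δ) := by
            rw [pow_succ', mul_smul, smul_sub, smul_sub, smul_mul',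
              show g • (j : O) = j from map_natCast (MulSemiringAction.toRingHom G O g) j]
            push_cast
            rw [hδ]; ring
          rw [this]
          exact add_mem (smul_mem_pow hgP ihj) (Ideal.mul_mem_left _ _ (hgr i δ ih))
      have h2 := h1 n
      rw [hn, one_smul, sub_self, zero_sub, neg_mem_iff] at h2
      have hn0 : HasOrd P (n : O) 0 := ⟨by simp, by simpa using hnP⟩
      exact hn0.mem_of_mul_mem hP (by simpa using h2)
  have h3 : g • x - x ∈ ⨅ i : ℕ, P ^ i := by simpa using key
  rw [Ideal.iInf_pow_eq_bot_of_isDomain P hPp.ne_top] at h3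
  exact sub_eq_zero.1 (by simpa using h3)

/-- The elements of the residue field fixed by the Frobenius are integers. -/
theorem exists_intCast_sub_mem {O : Type*} [CommRing O] [IsDedekindDomain O] {P : Ideal O}
    [hPp : P.IsPrime] (hP : P ≠ ⊥) {l : ℕ} (hl : l.Prime) (hlP : (l : O) ∈ P) {u : O}
    (hu : u ^ l - u ∈ P) : ∃ n : ℤ, u - n ∈ P := by
  have : Fact l.Prime := ⟨hl⟩
  have : P.IsMaximal := hPp.isMaximal hP
  let _ : Field (O ⧸ P) := Ideal.Quotient.field P
  have : CharP (O ⧸ P) l := by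
    refine (CharP.charP_iff_prime_eq_zero hl).2 ?_
    rw [← map_natCast (Ideal.Quotient.mk P)]
    exact Ideal.Quotient.eq_zero_iff_mem.2 hlP
  have e5 : (Ideal.Quotient.mk P u) ^ l = Ideal.Quotient.mk P u := by
    rw [← map_pow]
    exact Ideal.Quotient.eq.2 hu
  obtain ⟨n, hn⟩ := (mem_bot_iff_intCast l _).1
    ((Subfield.mem_bot_iff_pow_eq_self _ l).2 e5)
  exact ⟨n, Ideal.Quotient.eq.1 (by rw [← hn]; simp)⟩

/-- In an abelian group of automorphisms containing a Frobenius element at `P`, an inertia group of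
order prime to the residue characteristic `l` has at most `l - 1` elements. -/
theorem card_inertia_le {O : Type*} [CommRing O] [IsDedekindDomain O] {P : Ideal O}
    [hPp : P.IsPrime] (hP : P ≠ ⊥) {G : Type*} [CommGroup G] [Finite G] [MulSemiringAction G O]
    [FaithfulSMul G O] {l : ℕ} (hl : l.Prime) (hlP : (l : O) ∈ P)
    (φ : G) (hφ : ∀ x : O, φ • x - x ^ l ∈ P) (I : Subgroup G)
    (hI : ∀ g ∈ I, ∀ x : O, g • x - x ∈ P) (hlI : ∀ g ∈ I, ∃ n : ℕ, g ^ n = 1 ∧ ¬ l ∣ n) :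
    Nat.card I ≤ l - 1 := by
  have : Fact l.Prime := ⟨hl⟩
  obtain ⟨π, hπ1, hπ2⟩ := Ideal.exists_mem_pow_notMem_pow_succ P hP hPp.ne_top 1
  have hπ : HasOrd P π 1 := ⟨hπ1, hπ2⟩
  have hπP : π ∈ P := by simpa using hπ1
  have hφP : ∀ x ∈ P, φ • x ∈ P := fun x hx => by
    have := add_mem (hφ x) (Ideal.pow_mem_of_mem _ hx l hl.pos)
    simpa using this
  have hφP' : ∀ x, φ • x ∈ P → x ∈ P := fun x hx => by
    have := sub_mem hx (hφ x)
    rw [sub_sub_cancel] at this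
    exact hPp.mem_of_pow_mem _ this
  have hφinv : ∀ x ∈ P, φ⁻¹ • x ∈ P := fun x hx => hφP' _ (by simpa using hx)
  have hφπ : HasOrd P (φ • π) 1 := by
    refine ⟨by simpa using hφP π hπP, fun h => hπ2 ?_⟩
    simpa using smul_mem_pow hφinv h
  -- the tame character takes integer values
  have hInt : ∀ g ∈ I, ∃ n : ℤ, g • π - n * π ∈ P ^ 2 := by
    intro g hg
    have hgP : ∀ x ∈ P, g • x ∈ P := fun x hx => smul_mem_of_mem_inertia (hI g hg) hx
    obtain ⟨u, hu⟩ := hπ.exists_sub_mul_mem hP (x := g • π) (by simpa using hgP π hπP)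
    obtain ⟨w, hw⟩ := hπ.exists_sub_mul_mem hP hφπ.1
    have hmm : ∀ {x y : O}, x ∈ P → y ∈ P → x * y ∈ P ^ (1 + 1) := fun hx hy => by
      rw [pow_succ, pow_one]; exact Ideal.mul_mem_mul hx hy
    -- Comparing `φ g π` with `g φ π` shows that the Frobenius fixes the class of `u`; it also sends
    -- it to `u ^ l`, so that class lies in the prime field.
    have e1 : (φ • u - u) * w * π ∈ P ^ (1 + 1) := by
      have hc : φ • (g • π) = g • (φ • π) := by rw [← mul_smul, ← mul_smul, mul_comm]
      have : (φ • u - u) * w * π = g • (φ • π - w * π) - φ • (g • π - u * π)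
          - φ • u * (φ • π - w * π) + w * (g • π - u * π) + (g • w - w) * g • π := by
        rw [smul_sub, smul_sub, hc, smul_mul', smul_mul']; ring
      rw [this]
      refine add_mem (add_mem (sub_mem (sub_mem (smul_mem_pow hgP hw) (smul_mem_pow hφP hu))
        (Ideal.mul_mem_left _ _ hw)) (Ideal.mul_mem_left _ _ hu)) (hmm (hI g hg w) (hgP π hπP))
    have e2 : (φ • u - u) * w ∈ P := by
      rw [mul_comm] at e1
      simpa using hπ.mem_of_mul_mem hP e1
    have hwP : w ∉ P := fun h => hφπ.2 (by
      have := add_mem hw (hmm h hπP)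
      simpa using this)
    have e3 : φ • u - u ∈ P := (hPp.mem_or_mem e2).resolve_right hwP
    have e4 : u ^ l - u ∈ P := by
      have := sub_mem e3 (hφ u)
      rwa [show φ • u - u - (φ • u - u ^ l) = u ^ l - u by ring] at this
    have := exists_intCast_sub_mem hP hl hlP e4
    obtain ⟨n, hn⟩ := this
    refine ⟨n, ?_⟩
    have : g • π - n * π = (g • π - u * π) + (u - n) * π := by ring
    rw [this]
    exact add_mem hu (hmm hn hπP)
  choose! c hc using hInt
  have hc0 : ∀ g ∈ I, (c g : ZMod l) ≠ 0 := by
    intro g hg h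
    rw [ZMod.intCast_zmod_eq_zero_iff_dvd] at h
    rw [← intCast_mem_iff (P := P) hl hlP] at h
    have h1 : g • π ∈ P ^ 2 := by
      have := add_mem (hc g hg) (show (c g : O) * π ∈ P ^ 2 by
        rw [pow_two]; exact Ideal.mul_mem_mul h hπP)
      simpa using this
    have hgP : ∀ x ∈ P, g⁻¹ • x ∈ P :=
      fun x hx => smul_mem_of_mem_inertia (hI _ (inv_mem hg)) hx
    exact hπ2 (by simpa using smul_mem_pow hgP h1)
  let f : I → {a : ZMod l // a ≠ 0} := fun g => ⟨c g, hc0 g g.2⟩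
  have hf : Function.Injective f := by
    rintro ⟨g, hg⟩ ⟨g', hg'⟩ h
    have h1 : (c g : ZMod l) = c g' := congrArg Subtype.val h
    rw [← sub_eq_zero, ← Int.cast_sub, ZMod.intCast_zmod_eq_zero_iff_dvd,
      ← intCast_mem_iff (P := P) hl hlP] at h1
    have h2 : g • π - g' • π ∈ P ^ 2 := by
      have : g • π - g' • π = (g • π - c g * π) - (g' • π - c g' * π) + ((c g - c g' : ℤ) : O) * π := by
        push_cast; ring
      rw [this]
      refine add_mem (sub_mem (hc g hg) (hc g' hg')) ?_
      rw [pow_two]; exact Ideal.mul_mem_mul h1 hπP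
    -- Two elements with the same tame character differ by `t`, which fixes `π` modulo `P ^ 2` and
    -- has order prime to `l`, hence is trivial.
    set t := g'⁻¹ * g with ht
    have htI : t ∈ I := mul_mem (inv_mem hg') hg
    have h3 : t • π - π ∈ P ^ 2 := by
      have hgP : ∀ x ∈ P, g'⁻¹ • x ∈ P :=
        fun x hx => smul_mem_of_mem_inertia (hI _ (inv_mem hg')) hx
      have := smul_mem_pow hgP h2
      rwa [smul_sub, inv_smul_smul, ← mul_smul] at this
    obtain ⟨n, hn, hnl⟩ := hlI t htI
    have hnP : (n : O) ∉ P := by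
      have := intCast_mem_iff (P := P) hl hlP n
      push_cast at this
      rw [this]
      exact_mod_cast hnl
    have h4 := smul_eq_self_of_tame hP (hI t htI) hn hnP hπ h3
    have h5 : t = 1 := FaithfulSMul.eq_of_smul_eq_smul (α := O) fun x => by rw [h4 x, one_smul]
    rw [ht, inv_mul_eq_one] at h5
    exact Subtype.ext h5.symm
  calc Nat.card I ≤ Nat.card {a : ZMod l // a ≠ 0} := Nat.card_le_card_of_injective f hf
    _ = l - 1 := by
      rw [Nat.card_eq_fintype_card, Fintype.card_subtype_compl, ZMod.card]
      simp

end PrimeOrder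

/-! ### No totally ramified abelian extension of type `(p, p)` for odd `p` -/

namespace PrimeOrder

open Polynomial

/-- A combination of `1, π, …, π ^ (p - 1)` with integer coefficients, where `π` has order `p` and
`p` has order `p ^ 2`, of order greater than `p * (p - 1)` has all its coefficients divisible
by `p`. -/
theorem dvd_of_sum_mul_pow_mem {O : Type*} [CommRing O] [IsDedekindDomain O] {P : Ideal O}
    [hPp : P.IsPrime] (hP : P ≠ ⊥) {p : ℕ} (hp : p.Prime) (hpP : HasOrd P (p : O) (p ^ 2))
    {π : O} (hπ : HasOrd P π p) (n : ℕ → ℤ)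
    (h : ∑ i ∈ Finset.range p, (n i : O) * π ^ i ∈ P ^ (p * (p - 1) + 1)) :
    ∀ i < p, (p : ℤ) ∣ n i := by
  have hpP1 : (p : O) ∈ P := Ideal.pow_le_self (by have := hp.pos; positivity) hpP.1
  have hmem : ∀ m : ℤ, (p : ℤ) ∣ m → (m : O) ∈ P ^ (p ^ 2) := by
    rintro m ⟨k, rfl⟩
    push_cast
    exact Ideal.mul_mem_right _ _ hpP.1
  intro i
  induction i using Nat.strong_induction_on with
  | _ i ih =>
    intro hi
    have hpi : HasOrd P (π ^ i) (i * p) := hπ.pow hP i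
    have hle : i * p + 1 ≤ p * (p - 1) + 1 := by
      rw [mul_comm]
      gcongr
      omega
    have hle2 : i * p + 1 ≤ p ^ 2 := by
      have : i * p + p ≤ p ^ 2 := by nlinarith
      have := hp.pos
      omega
    -- The terms before `i` have coefficients divisible by `p`, hence order at least `p ^ 2`; those
    -- after `i` have order at least `(i + 1) * p`. Only the term `i` could have order `i * p`.
    have h1 : (n i : O) * π ^ i ∈ P ^ (i * p + 1) := by
      have h2 := Finset.sum_erase_eq_sub (f := fun i => (n i : O) * π ^ i)
        (Finset.mem_range.2 hi)
      have h3 : (n i : O) * π ^ i = ∑ i ∈ Finset.range p, (n i : O) * π ^ i -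
          ∑ j ∈ (Finset.range p).erase i, (n j : O) * π ^ j := by rw [h2]; ring
      rw [h3]
      refine sub_mem (Ideal.pow_le_pow_right hle h) (sum_mem fun j hj => ?_)
      rw [Finset.mem_erase, Finset.mem_range] at hj
      rcases lt_or_gt_of_ne hj.1 with hji | hji
      · exact Ideal.mul_mem_right _ _ (Ideal.pow_le_pow_right hle2 (hmem _ (ih j hji hj.2)))
      · refine Ideal.mul_mem_left _ _ (Ideal.pow_le_pow_right ?_ (hπ.pow hP j).1)
        have := hp.pos
        nlinarith
    rw [mul_comm (n i : O)] at h1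
    have h4 := hpi.mem_of_mul_mem hP h1
    rw [pow_one] at h4
    exact (intCast_mem_iff hp hpP1 _).1 h4

/-- The iterated product of the first `p` translates under a group element killed by `p`
is fixed. -/
theorem smul_prod_range_pow_smul {O : Type*} [CommRing O] {G : Type*} [Group G]
    [MulSemiringAction G O] {p : ℕ} {g : G} (hg : g ^ p = 1) (x : O) :
    g • ∏ i ∈ Finset.range p, g ^ i • x = ∏ i ∈ Finset.range p, g ^ i • x := by
  rw [Finset.smul_prod']
  rcases p with _ | p
  · simp
  rw [Finset.prod_range_succ, Finset.prod_range_succ', ← mul_smul, ← pow_succ', hg, pow_zero]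
  congr 1
  exact Finset.prod_congr rfl fun i _ => by rw [← mul_smul, ← pow_succ']

/-- In an odd prime `p`, there is no abelian extension of `ℚ` of degree `p ^ 2` and exponent `p`
which is totally ramified at `p`. -/
theorem false_of_totallyRamified_sq {O : Type*} [CommRing O] [IsDedekindDomain O] {P : Ideal O}
    [hPp : P.IsPrime] (hP : P ≠ ⊥) {A : Type*} [CommGroup A] [Finite A] [MulSemiringAction A O]
    {p : ℕ} (hp : p.Prime) (hp2 : p ≠ 2) (hpP : HasOrd P (p : O) (p ^ 2))
    (hinv : ∀ x : O, (∀ g : A, g • x = x) → ∃ n : ℤ, x = n)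
    (hI : ∀ (g : A) (x : O), g • x - x ∈ P)
    (hres : ∀ x : O, ∃ n : ℤ, x - n ∈ P)
    (hcard : Nat.card A = p ^ 2) (hexp : ∀ g : A, g ^ p = 1) : False := by
  have : Fact p.Prime := ⟨hp⟩
  have hp3 : 3 ≤ p := by have := hp.two_le; omega
  have hpP1 : (p : O) ∈ P := Ideal.pow_le_self (by positivity) hpP.1
  have hgP : ∀ (g : A), ∀ x ∈ P, g • x ∈ P := fun g x hx => smul_mem_of_mem_inertia (hI g) hx
  have hgPn : ∀ (g : A) (n : ℕ), ∀ x ∈ P ^ n, g • x ∈ P ^ n :=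
    fun g n x hx => smul_mem_pow (hgP g) hx
  have hInt : ∀ (g : A) (n : ℤ), g • (n : O) = n := fun g n =>
    map_intCast (MulSemiringAction.toRingHom A O g) n
  -- the action is wild
  have hwild : ∀ (i : ℕ) (x : O), HasOrd P x i → ∀ g : A, g • x - x ∈ P ^ (i + 1) := by
    intro i x hx g
    obtain ⟨u, hu⟩ := hx.exists_sub_intCast_mul_mem hP hres (hgPn g i x hx.1)
    -- If `g` acts by `u` on `P ^ i / P ^ (i + 1)`, then `g ^ p = 1` gives `u ^ p ≡ 1`, and `u ≡ 1`
    -- by Fermat.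
    have h1 : ∀ j : ℕ, g ^ j • x - (u ^ j : ℤ) * x ∈ P ^ (i + 1) := by
      intro j
      induction j with
      | zero => simp
      | succ j ih =>
        have : g ^ (j + 1) • x - (u ^ (j + 1) : ℤ) * x =
            g • (g ^ j • x - (u ^ j : ℤ) * x) + (u ^ j : ℤ) * (g • x - u * x) := by
          rw [pow_succ' g, mul_smul, smul_sub, smul_mul', hInt]
          push_cast; ring
        rw [this]
        exact add_mem (hgPn g _ _ ih) (Ideal.mul_mem_left _ _ hu)
    have h2 := h1 p
    rw [hexp, one_smul] at h2
    have h3 : x * ((1 - u ^ p : ℤ) : O) ∈ P ^ (i + 1) := by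
      convert h2 using 1; push_cast; ring
    have h4 := hx.mem_of_mul_mem hP h3
    rw [pow_one, intCast_mem_iff hp hpP1, ← ZMod.intCast_zmod_eq_zero_iff_dvd] at h4
    push_cast at h4
    rw [ZMod.pow_card] at h4
    have h5 : ((u - 1 : ℤ) : O) ∈ P := by
      rw [intCast_mem_iff hp hpP1, ← ZMod.intCast_zmod_eq_zero_iff_dvd]
      push_cast
      linear_combination -h4
    have : g • x - x = (g • x - u * x) + ((u - 1 : ℤ) : O) * x := by push_cast; ring
    rw [this]
    refine add_mem hu ?_
    rw [pow_succ']
    exact Ideal.mul_mem_mul h5 hx.1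
  obtain ⟨ϖ, hϖ1, hϖ2⟩ := Ideal.exists_mem_pow_notMem_pow_succ P hP hPp.ne_top 1
  have hϖ : HasOrd P ϖ 1 := ⟨hϖ1, hϖ2⟩
  -- an element acting trivially modulo `P ^ 3`
  obtain ⟨τ, hτ1, hτ⟩ : ∃ τ : A, τ ≠ 1 ∧ τ • ϖ - ϖ ∈ P ^ 3 := by
    have h1 : ∀ g : A, ∃ c : ℤ, g • ϖ - ϖ - c * ϖ ^ 2 ∈ P ^ 3 := fun g => by
      have hϖ2 : HasOrd P (ϖ ^ 2) 2 := by simpa using hϖ.pow hP 2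
      exact hϖ2.exists_sub_intCast_mul_mem hP hres (hwild 1 ϖ hϖ g)
    choose c hc using h1
    -- Pigeonhole: `p ^ 2` automorphisms, but only `p` values of the second coefficient.
    have h2 : ¬ Function.Injective (fun g => (c g : ZMod p)) := by
      intro h
      have := Nat.card_le_card_of_injective _ h
      rw [hcard, Nat.card_zmod] at this
      nlinarith
    rw [Function.Injective] at h2
    push Not at h2
    obtain ⟨g, g', h3, h4⟩ := h2
    refine ⟨g'⁻¹ * g, fun h => h4 (inv_mul_eq_one.1 h).symm, ?_⟩
    have h5 : g • ϖ - g' • ϖ ∈ P ^ 3 := by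
      rw [← sub_eq_zero, ← Int.cast_sub, ZMod.intCast_zmod_eq_zero_iff_dvd,
        ← intCast_mem_iff (P := P) hp hpP1] at h3
      have : g • ϖ - g' • ϖ = (g • ϖ - ϖ - c g * ϖ ^ 2) - (g' • ϖ - ϖ - c g' * ϖ ^ 2)
          + ((c g - c g' : ℤ) : O) * ϖ ^ 2 := by push_cast; ring
      rw [this]
      refine add_mem (sub_mem (hc g) (hc g')) ?_
      rw [pow_succ']
      exact Ideal.mul_mem_mul h3 (Ideal.pow_mem_pow (by simpa using hϖ1) 2)
    have := hgPn g'⁻¹ _ _ h5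
    rwa [smul_sub, inv_smul_smul, ← mul_smul] at this
  obtain ⟨h, hh⟩ : ∃ h : A, h ∉ Subgroup.zpowers τ := by
    by_contra! hall
    have h1 : Subgroup.zpowers τ = ⊤ := Subgroup.eq_top_iff' _ |>.2 hall
    have h2 : Nat.card (Subgroup.zpowers τ) = p ^ 2 := by rw [h1, Subgroup.card_top, hcard]
    rw [Nat.card_zpowers] at h2
    have h3 := Nat.le_of_dvd hp.pos (orderOf_dvd_of_pow_eq_one (hexp τ))
    nlinarith
  have hfix : ∀ x : O, τ • x = x → h • x = x → ∃ n : ℤ, x = n := by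
    intro x hx1 hx2
    apply hinv
    let S := MulAction.stabilizer A x
    have h1 : Subgroup.zpowers τ < S := by
      refine lt_of_le_of_ne ?_ ?_
      · rw [Subgroup.zpowers_le]; exact hx1
      · rintro h1
        exact hh (by rw [h1]; exact hx2)
    have h2 : S = ⊤ := by
      rw [← Subgroup.card_eq_iff_eq_top]
      have h3 : Nat.card (Subgroup.zpowers τ) = p := by
        rw [Nat.card_zpowers]; exact orderOf_eq_prime (hexp τ) hτ1
      have h4 : Nat.card S ∣ p ^ 2 := hcard ▸ Subgroup.card_subgroup_dvd_card S
      have h5 : p < Nat.card S := h3 ▸ Set.ncard_lt_ncard h1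
      obtain ⟨k, hk, hk2⟩ := (Nat.dvd_prime_pow hp).1 h4
      interval_cases k
      · rw [hk2] at h5; simp at h5; omega
      · rw [hk2] at h5; simp at h5
      · rw [hk2, hcard]
    intro g
    have : g ∈ S := h2 ▸ Subgroup.mem_top g
    exact this
  have hcomm : ∀ (g g' : A) (x : O), g • g' • x = g' • g • x := fun g g' x => by
    rw [← mul_smul, ← mul_smul, mul_comm]
  have hordsmul : ∀ (g : A) {x : O} {i : ℕ}, HasOrd P x i → HasOrd P (g • x) i := by
    intro g x i hx
    refine ⟨hgPn g _ _ hx.1, fun h => hx.2 ?_⟩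
    have := hgPn g⁻¹ _ _ h
    rwa [inv_smul_smul] at this
  -- the elements fixed by `h` have order divisible by `p`
  have hdvd : ∀ (c : O) (j : ℕ), h • c = c → c ∈ P ^ (p * j + 1) → c ∈ P ^ (p * (j + 1)) := by
    intro c j hc hcP
    by_cases hc0 : c = 0
    · simp [hc0]
    obtain ⟨t, ht⟩ := exists_hasOrd (P := P) hc0
    -- The norm of `c` under `τ` is a rational integer, of order both `p * t` and a multiple of `p ^
    -- 2`; hence `p ∣ t`.
    obtain ⟨n, hn⟩ := hfix (∏ i ∈ Finset.range p, τ ^ i • c) (smul_prod_range_pow_smul (hexp τ) c)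
      (by
        rw [Finset.smul_prod']
        exact Finset.prod_congr rfl fun i _ => by rw [hcomm, hc])
    have h1 : HasOrd P (n : O) (p * t) := by
      rw [← hn]
      simpa using HasOrd.prod hP (Finset.range p) (g := fun _ => t)
        fun i _ => hordsmul (τ ^ i) ht
    have hn0 : n ≠ 0 := by
      rintro rfl
      exact h1.2 (by simp)
    have hfm : FiniteMultiplicity (p : ℤ) n :=
      Int.finiteMultiplicity_iff.2 ⟨by simpa using hp.ne_one, hn0⟩
    obtain ⟨m, hnm, hm⟩ := hfm.exists_eq_pow_mul_and_not_dvd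
    set a := multiplicity (p : ℤ) n
    have h2 : HasOrd P (n : O) (a * p ^ 2 + 0) := by
      rw [hnm]
      push_cast
      refine (hpP.pow hP a).mul hP ⟨by simp, ?_⟩
      rw [zero_add, pow_one, intCast_mem_iff hp hpP1]
      exact hm
    have h3 := h1.unique h2
    have h4 : t = p * a := by
      have : p * t = p * (p * a) := by rw [h3]; ring
      exact Nat.eq_of_mul_eq_mul_left hp.pos this
    refine Ideal.pow_le_pow_right ?_ ht.1
    have h5 := ht.le_of_mem hcP
    rw [h4] at h5 ⊢
    exact Nat.mul_le_mul_left _ (Nat.lt_of_mul_lt_mul_left (a := p) (by omega))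
  set π := ∏ i ∈ Finset.range p, h ^ i • ϖ with hπdef
  have hhπ : h • π = π := smul_prod_range_pow_smul (hexp h) ϖ
  have hπ : HasOrd P π p := by
    simpa using HasOrd.prod hP (Finset.range p) (g := fun _ => 1)
      fun i _ => hordsmul (h ^ i) hϖ
  have hhτπ : h • (τ • π - π) = τ • π - π := by rw [smul_sub, hcomm, hhπ]
  have hτπ2 : τ • π - π ∈ P ^ (p * 2) := hdvd _ 1 hhτπ (by simpa using hwild p π hπ τ)
  -- the derivative of the minimal polynomial of `π`
  have hτπ3 : τ • π - π ∉ P ^ (p * 2 + 1) := by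
    intro hcon
    have h3 : τ • π - π ∈ P ^ (p * 3) := hdvd _ 2 hhτπ hcon
    have h4 : ∀ j : ℕ, π - τ ^ j • π ∈ P ^ (p * 3) := by
      intro j
      induction j with
      | zero => simp
      | succ j ih =>
        have : π - τ ^ (j + 1) • π = (π - τ ^ j • π) - τ ^ j • (τ • π - π) := by
          rw [pow_succ, mul_smul, smul_sub]; ring
        rw [this]
        exact sub_mem ih (hgPn _ _ _ h3)
    -- The minimal polynomial of `π` over `ℚ`. Its derivative at `π` is a product of `p - 1`
    -- differences of conjugates, each in `P ^ (p * 3)`, while its top term `p * π ^ (p - 1)` has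
    -- order only `p ^ 2 + p * (p - 1)`.
    let f : O[X] := ∏ i ∈ Finset.range p, (X - C (τ ^ i • π))
    have hcoef : ∀ k, ∃ n : ℤ, f.coeff k = n := by
      intro k
      have hsmul : ∀ g : A, g • f = ∏ i ∈ Finset.range p, (X - C (g • τ ^ i • π)) := fun g => by
        simp only [f, Finset.smul_prod', smul_sub, Polynomial.smul_X, Polynomial.smul_C]
      apply hfix
      · rw [← Polynomial.coeff_smul]
        congr 1
        have := smul_prod_range_pow_smul (hexp τ) (X - C π)
        simpa only [smul_sub, Polynomial.smul_X, Polynomial.smul_C] using this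
      · rw [← Polynomial.coeff_smul, hsmul]
        congr 1
        exact Finset.prod_congr rfl fun i _ => by rw [hcomm, hhπ]
    choose a ha using hcoef
    have hf : f.Monic := monic_prod_X_sub_C _ _
    have hdeg : f.natDegree = p := by simp [f]
    have h5 : (derivative f).eval π ∈ P ^ (p * 3 * (p - 1)) := by
      obtain ⟨q, hq⟩ : ∃ q, p = q + 1 := ⟨p - 1, by omega⟩
      have h6 : f = (∏ i ∈ Finset.range q, (X - C (τ ^ (i + 1) • π))) * (X - C π) := by
        simp only [f]
        conv_lhs => rw [hq, Finset.prod_range_succ', pow_zero, one_smul]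
      rw [h6, derivative_mul]
      simp only [eval_add, eval_mul, eval_sub, eval_X, eval_C, sub_self, mul_zero, zero_add,
        eval_prod]
      rw [hq, Nat.add_sub_cancel, ← hq, pow_mul]
      have := Ideal.prod_mem_prod (s := Finset.range q) (I := fun _ => P ^ (p * 3))
        (x := fun i => π - τ ^ (i + 1) • π) fun i _ => h4 (i + 1)
      simpa using this
    have h6 : (derivative f).eval π =
        ∑ i ∈ Finset.range p, ((a (i + 1) * (i + 1) : ℤ) : O) * π ^ i := by
      rw [eval_eq_sum_range' (n := p) (by
        rw [← hdeg]; exact natDegree_derivative_lt (by rw [hdeg]; exact hp.ne_zero))]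
      refine Finset.sum_congr rfl fun i _ => ?_
      rw [coeff_derivative, ha]
      push_cast; ring
    -- This is where `p ≥ 3` enters.
    have hge : p ^ 2 + (p * (p - 1) + 1) ≤ p * 3 * (p - 1) := by
      obtain ⟨q, rfl⟩ : ∃ q, p = q + 3 := ⟨p - 3, by omega⟩
      simp only [show q + 3 - 1 = q + 2 by omega]
      nlinarith
    rw [h6] at h5
    have h7 := dvd_of_sum_mul_pow_mem hP hp hpP hπ (fun i => a (i + 1) * (i + 1))
      (Ideal.pow_le_pow_right (by omega) h5)
    choose! b hb using h7
    have h8 : ∑ i ∈ Finset.range p, ((a (i + 1) * (i + 1) : ℤ) : O) * π ^ i =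
        (p : O) * ∑ i ∈ Finset.range p, (b i : O) * π ^ i := by
      rw [Finset.mul_sum]
      refine Finset.sum_congr rfl fun i hi => ?_
      rw [hb i (Finset.mem_range.1 hi)]
      push_cast; ring
    rw [h8] at h5
    have h9 := hpP.mem_of_mul_mem hP (Ideal.pow_le_pow_right hge h5)
    -- After division by `p` the top coefficient `b (p - 1)` comes from the leading coefficient `1`
    -- of `f`, so it cannot be divisible by `p`.
    have h10 := dvd_of_sum_mul_pow_mem hP hp hpP hπ b h9 (p - 1) (by omega)
    have h11 := hb (p - 1) (by omega)
    have h12 : (a (p - 1 + 1) : O) = 1 := by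
      rw [← ha, Nat.sub_add_cancel hp.one_le, ← hdeg]
      exact hf
    have h13 : ((p : ℕ) : O) = ((p * b (p - 1) : ℤ) : O) := by
      rw [← h11]
      push_cast [hp.one_le]
      rw [h12]; ring
    have h14 : (p : O) ∈ P ^ (p ^ 2 + 1) := by
      rw [h13]
      push_cast
      rw [pow_succ]
      exact Ideal.mul_mem_mul hpP.1 ((intCast_mem_iff hp hpP1 _).2 h10)
    exact hpP.2 h14
  -- elements fixed by `h` are moved little by `τ`
  have hτb : ∀ b : O, h • b = b → τ • b - b ∈ P ^ (p * 2) := by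
    intro b hb
    obtain ⟨n, hn⟩ := hres b
    have h1 : h • (b - n) = b - n := by rw [smul_sub, hb, hInt]
    have h2 : b - n ∈ P ^ p := by simpa using hdvd _ 0 h1 (by simpa using hn)
    obtain ⟨m, hm⟩ := hπ.exists_sub_intCast_mul_mem hP hres h2
    have h3 : b - n - m * π ∈ P ^ (p * 2) := by
      refine hdvd _ 1 ?_ (by simpa using hm)
      rw [smul_sub, h1, smul_mul', hInt, hhπ]
    have : τ • b - b = (τ • (b - n - m * π) - (b - n - m * π)) + m * (τ • π - π) := by
      rw [smul_sub, smul_sub, smul_mul', hInt, hInt]; ring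
    rw [this]
    exact add_mem (sub_mem (hgPn _ _ _ h3) h3) (Ideal.mul_mem_left _ _ hτπ2)
  -- the minimal polynomial of `ϖ` over the fixed field of `h`
  let g : O[X] := ∏ i ∈ Finset.range p, (X - C (h ^ i • ϖ))
  have hg : ∀ k, h • g.coeff k = g.coeff k := by
    intro k
    rw [← Polynomial.coeff_smul]
    congr 1
    have := smul_prod_range_pow_smul (hexp h) (X - C ϖ)
    simpa only [smul_sub, Polynomial.smul_X, Polynomial.smul_C] using this
  have hdeg : g.natDegree = p := by simp [g]
  have hg0 : g.eval ϖ = 0 := by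
    simp only [g, eval_prod]
    refine Finset.prod_eq_zero (Finset.mem_range.2 hp.pos) ?_
    simp
  -- The factor of `τ` itself lies in `P ^ 3` by the choice of `τ`, and the other `p - 1` factors
  -- lie in `P ^ 2`.
  have h1 : (τ • g).eval ϖ ∈ P ^ (p * 2 + 1) := by
    have : (τ • g).eval ϖ = ∏ i ∈ Finset.range p, (ϖ - (τ * h ^ i) • ϖ) := by
      simp only [g, Finset.smul_prod', smul_sub, Polynomial.smul_X, Polynomial.smul_C, eval_prod,
        eval_sub, eval_X, eval_C, mul_smul]
    rw [this]
    obtain ⟨q, hq⟩ : ∃ q, p = q + 1 := ⟨p - 1, by omega⟩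
    have h6 := Ideal.prod_mem_prod (s := Finset.range q) (I := fun _ => P ^ 2)
      (x := fun i => ϖ - (τ * h ^ (i + 1)) • ϖ)
      fun i _ => by
        rw [← neg_mem_iff, neg_sub]
        exact hwild 1 ϖ hϖ _
    have h7 : ϖ - (τ * h ^ 0) • ϖ ∈ P ^ 3 := by
      rw [← neg_mem_iff, neg_sub]
      simpa using hτ
    rw [hq, Finset.prod_range_succ', show (q + 1) * 2 + 1 = 2 * q + 3 by ring, pow_add, pow_mul]
    exact Ideal.mul_mem_mul (by simpa using h6) h7
  have h2 : (τ • g).eval ϖ = ∑ i ∈ Finset.range (p + 1), (τ • g.coeff i - g.coeff i) * ϖ ^ i := by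
    have e1 : g.eval ϖ = _ := eval_eq_sum_range' (n := p + 1) (by omega) ϖ
    have e2 : (τ • g).eval ϖ = _ := eval_eq_sum_range' (n := p + 1)
      (lt_of_le_of_lt (natDegree_smul_le _ _) (by omega)) ϖ
    rw [hg0] at e1
    rw [e2, ← sub_zero (Finset.sum _ _), e1, ← Finset.sum_sub_distrib]
    exact Finset.sum_congr rfl fun i _ => by rw [Polynomial.coeff_smul, sub_mul]
  rw [h2, Finset.sum_range_succ'] at h1
  -- All terms but the constant one carry a factor `ϖ` besides a coefficient in `P ^ (p * 2)`. What
  -- is left is `τ π - π` up to sign, contradicting `hτπ3`.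
  have h3 : τ • g.coeff 0 - g.coeff 0 ∈ P ^ (p * 2 + 1) := by
    have := sub_mem h1 (sum_mem (S := P ^ (p * 2 + 1)) (t := Finset.range p)
      (f := fun i => (τ • g.coeff (i + 1) - g.coeff (i + 1)) * ϖ ^ (i + 1)) fun i _ => by
        rw [pow_succ P]
        exact Ideal.mul_mem_mul (hτb _ (hg _))
          (Ideal.pow_mem_of_mem _ (by simpa using hϖ1) _ (by omega)))
    simpa using this
  have h4 : g.coeff 0 = (-1) ^ p * π := by
    rw [coeff_zero_eq_eval_zero]
    simp [g, eval_prod, Finset.prod_neg, hπdef]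
  rw [h4, smul_mul', smul_pow', smul_neg, smul_one, ← mul_sub] at h3
  rcases neg_one_pow_eq_or O p with h5 | h5 <;> rw [h5] at h3
  · exact hτπ3 (by simpa using h3)
  · exact hτπ3 (by simpa using neg_mem h3)

end PrimeOrder

/-! ### Inertia groups in number fields -/

namespace PrimeOrder

open NumberField

section

variable {M : Type*} [Field M] [NumberField M]

theorem card_inertia_eq_ramificationIdx (K : Type*) [Field K] [NumberField K] [Algebra K M]
    (G : Type*) [Group G] [Finite G] [MulSemiringAction G M] [IsGaloisGroup G K M]
    (P : Ideal (𝓞 M)) [P.IsMaximal] :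
    Nat.card (P.inertia G) = P.ramificationIdx (𝓞 K) := by
  have hPb : P ≠ ⊥ := Ideal.IsMaximal.ne_bot_of_isIntegral_int P
  have : (P.under (𝓞 K)).IsMaximal := Ideal.IsMaximal.under (𝓞 K) P
  have : Finite (𝓞 K ⧸ P.under (𝓞 K)) :=
    Ring.HasFiniteQuotients.finiteQuotient (Ideal.IsMaximal.ne_bot_of_isIntegral_int _)
  rw [Ideal.card_inertia_eq_ramificationIdxIn (P.under (𝓞 K)) P,
    Ideal.ramificationIdxIn_eq_ramificationIdx (P.under (𝓞 K)) P G]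

theorem card_inertia_eq_ramificationIdx_int
    (G : Type*) [Group G] [Finite G] [MulSemiringAction G M] [IsGaloisGroup G ℚ M]
    (P : Ideal (𝓞 M)) [P.IsMaximal] :
    Nat.card (P.inertia G) = P.ramificationIdx ℤ := by
  have hPb : P ≠ ⊥ := Ideal.IsMaximal.ne_bot_of_isIntegral_int P
  have : (P.under ℤ).IsMaximal := Ideal.IsMaximal.under ℤ P
  have : Finite (ℤ ⧸ P.under ℤ) :=
    Ring.HasFiniteQuotients.finiteQuotient (Ideal.IsMaximal.ne_bot_of_isIntegral_int _)
  rw [Ideal.card_inertia_eq_ramificationIdxIn (P.under ℤ) P,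
    Ideal.ramificationIdxIn_eq_ramificationIdx (P.under ℤ) P G]

/-- A prime is unramified in the fixed field of a group containing its inertia group. -/
theorem ramificationIdx_under_eq_one [IsGalois ℚ M] (X : Subgroup Gal(M/ℚ))
    (P : Ideal (𝓞 M)) [P.IsMaximal] (hX : P.inertia Gal(M/ℚ) ≤ X) :
    (P.under (𝓞 (FixedPoints.intermediateField X : IntermediateField ℚ M))).ramificationIdx ℤ
      = 1 := by
  set E := (FixedPoints.intermediateField X : IntermediateField ℚ M)
  have : IsGaloisGroup X E M := IsGaloisGroup.subgroup Gal(M/ℚ) ℚ M X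
  have h1 := card_inertia_eq_ramificationIdx_int Gal(M/ℚ) P
  have h2 := card_inertia_eq_ramificationIdx E X P
  have h3 : Nat.card (P.inertia X) = Nat.card (P.inertia Gal(M/ℚ)) :=
    Nat.card_congr (Subgroup.subgroupOfEquivOfLe hX).toEquiv
  have h4 := Ideal.ramificationIdx_tower (R := ℤ) (P.under (𝓞 E)) P
  have h5 := Ideal.ramificationIdx_pos P ℤ
  have h6 : P.ramificationIdx (𝓞 E) = P.ramificationIdx ℤ := h2.symm.trans (h3.trans h1)
  rw [h6] at h4
  exact Nat.eq_of_mul_eq_mul_right h5 (by rw [one_mul]; exact h4.symm)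

/-- The inertia groups generate the Galois group of a number field (Minkowski). -/
theorem eq_top_of_forall_inertia_le [IsGalois ℚ M] (X : Subgroup Gal(M/ℚ))
    (hX : ∀ (P : Ideal (𝓞 M)) [P.IsMaximal], P.inertia Gal(M/ℚ) ≤ X) : X = ⊤ := by
  set E := (FixedPoints.intermediateField X : IntermediateField ℚ M) with hE
  have : IsGaloisGroup X E M := IsGaloisGroup.subgroup Gal(M/ℚ) ℚ M X
  have h1 : Module.finrank ℚ E = 1 := by
    by_contra h
    -- By Minkowski a number field other than `ℚ` has a ramified prime, whereas the fixed field of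
    -- `X` is unramified everywhere.
    obtain ⟨p, hpm, hp⟩ := NumberField.exists_not_isUnramifiedAt_int (𝒪 := 𝓞 E) h
    obtain ⟨P, hP, hPp⟩ := Ideal.exists_maximal_ideal_liesOver_of_isIntegral (S := 𝓞 M) p
    apply hp
    have h2 := ramificationIdx_under_eq_one X P (hX P)
    rw [← hE, ← Ideal.over_def P p] at h2
    have : (p.under ℤ).IsMaximal := Ideal.IsMaximal.under ℤ p
    have : Finite (ℤ ⧸ p.under ℤ) :=
      Ring.HasFiniteQuotients.finiteQuotient (Ideal.IsMaximal.ne_bot_of_isIntegral_int _)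
    exact Ideal.ramificationIdx_eq_one_iff.1 h2
  have h3 := IsGaloisGroup.card_eq_finrank X E M
  have h4 := Module.finrank_mul_finrank ℚ E M
  rw [h1, one_mul, ← h3, ← IsGaloisGroup.card_eq_finrank Gal(M/ℚ) ℚ M] at h4
  exact Subgroup.eq_top_of_card_eq _ h4

theorem hasOrd_ramificationIdx (P : Ideal (𝓞 M)) [P.IsMaximal] {p : ℕ} (hp : p.Prime)
    (hpP : (p : 𝓞 M) ∈ P) : HasOrd P (p : 𝓞 M) (P.ramificationIdx ℤ) := by
  have hPb : P ≠ ⊥ := Ideal.IsMaximal.ne_bot_of_isIntegral_int P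
  have hlo : P.LiesOver (Ideal.span {(p : ℤ)}) :=
    (Ideal.liesOver_span_iff Ideal.IsPrime.ne_top' (Nat.prime_iff_prime_int.1 hp)).mpr
      (by simpa using hpP)
  have hmap : (Ideal.span {(p : ℤ)}).map (algebraMap ℤ (𝓞 M)) = Ideal.span {(p : 𝓞 M)} := by
    simp [Ideal.map_span]
  have hne : Ideal.span {(p : 𝓞 M)} ≠ ⊥ := by
    simpa using hp.ne_zero
  have h := Ideal.IsDedekindDomain.ramificationIdx_eq_multiplicity (Ideal.span {(p : ℤ)}) P (by rwa [hmap])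
  rw [hmap] at h
  have hfin : FiniteMultiplicity P (Ideal.span {(p : 𝓞 M)}) :=
    FiniteMultiplicity.of_prime_left (Ideal.prime_of_isPrime hPb inferInstance) hne
  rw [h]
  constructor
  · have := pow_multiplicity_dvd P (Ideal.span {(p : 𝓞 M)})
    rwa [Ideal.dvd_span_singleton] at this
  · intro hc
    rw [← Ideal.dvd_span_singleton] at hc
    exact hfin.not_pow_dvd_of_multiplicity_lt (Nat.lt_succ_self _) hc

/-- Inertia acts trivially on the roots of unity of order prime to the residue characteristic. -/
theorem smul_eq_self_of_pow_eq_one (P : Ideal (𝓞 M)) [P.IsMaximal] {σ : Gal(M/ℚ)}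
    (hσ : σ ∈ P.inertia Gal(M/ℚ)) {m : ℕ} (hm : 0 < m) (hmP : (m : 𝓞 M) ∉ P) {ζ : M}
    (hζ : ζ ^ m = 1) : σ ζ = ζ := by
  have hinj := FaithfulSMul.algebraMap_injective (𝓞 M) M
  obtain ⟨z, rfl⟩ : ∃ z : 𝓞 M, algebraMap (𝓞 M) M z = ζ :=
    ⟨⟨ζ, IsIntegral.of_pow hm (by rw [hζ]; exact isIntegral_one)⟩, rfl⟩
  have hz : z ^ m = 1 := hinj (by rw [map_pow, hζ, map_one])
  by_contra hne
  have hne' : σ • z ≠ z := fun h => hne (congrArg (algebraMap (𝓞 M) M) h)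
  -- The quotient `w = σ z / z` is an `m`-th root of unity congruent to `1` modulo `P`. If `w ≠ 1`,
  -- then `0 = ∑ w ^ i ≡ m` modulo `P`.
  set w := σ • z * z ^ (m - 1) with hw
  have hw1 : w ≠ 1 := fun h => hne' (by
    have : w * z = σ • z := by
      rw [hw, mul_assoc, ← pow_succ, Nat.sub_add_cancel hm, hz, mul_one]
    rw [← this, h, one_mul])
  have hwm : w ^ m = 1 := by
    rw [hw, mul_pow, ← smul_pow', hz, smul_one, one_mul, ← pow_mul, mul_comm, pow_mul, hz, one_pow]
  have hwP : w - 1 ∈ P := by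
    have : w - 1 = (σ • z - z) * z ^ (m - 1) := by
      rw [sub_mul, ← pow_succ', Nat.sub_add_cancel hm, hz]
    rw [this]
    exact P.mul_mem_right _ (hσ z)
  have hsum : ∑ i ∈ Finset.range m, w ^ i = 0 := by
    have := mul_geom_sum w m
    rw [hwm, sub_self] at this
    exact (mul_eq_zero.1 this).resolve_left (sub_ne_zero.2 hw1)
  apply hmP
  have h2 : ∀ i, w ^ i - 1 ∈ P := fun i =>
    Ideal.mem_of_dvd P (by simpa using sub_dvd_pow_sub_pow w 1 i) hwP
  have h3 := sum_mem (S := P) (t := Finset.range m) (f := fun i => w ^ i - 1) fun i _ => h2 i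
  rw [Finset.sum_sub_distrib, hsum] at h3
  simpa using h3

/-- The restriction of an inertia element lies in an inertia group. -/
theorem restrictNormal_mem_inertia (E : Type*) [Field E] [NumberField E] [Algebra E M]
    [IsGalois ℚ E] (P : Ideal (𝓞 M)) {σ : Gal(M/ℚ)}
    (hσ : σ ∈ P.inertia Gal(M/ℚ)) : σ.restrictNormal E ∈ (P.under (𝓞 E)).inertia Gal(E/ℚ) := by
  intro x
  have h : algebraMap (𝓞 E) (𝓞 M) (σ.restrictNormal E • x) = σ • algebraMap (𝓞 E) (𝓞 M) x :=
    FaithfulSMul.algebraMap_injective (𝓞 M) M (AlgEquiv.restrictNormal_commutes σ E (x : E))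
  rw [Submodule.mem_toAddSubgroup, Ideal.mem_comap, map_sub, h]
  exact hσ _

/-- Inertia groups at an unramified prime act trivially. -/
theorem restrictNormal_eq_one (E : Type*) [Field E] [NumberField E] [Algebra E M]
    [IsGalois ℚ E] (P : Ideal (𝓞 M)) [P.IsMaximal] {p : ℕ} (hp : p.Prime) (hpP : (p : 𝓞 M) ∈ P)
    (hpd : ¬ (p : ℤ) ∣ discr E) {σ : Gal(M/ℚ)}
    (hσ : σ ∈ P.inertia Gal(M/ℚ)) : σ.restrictNormal E = 1 := by
  have hmax : (P.under (𝓞 E)).IsMaximal := Ideal.IsMaximal.under (𝓞 E) P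
  have h1 := (not_dvd_discr_iff_forall_mem E (𝓞 E) (Nat.prime_iff_prime_int.1 hp)).1 hpd
    (P.under (𝓞 E)) inferInstance (by
      rw [Ideal.mem_comap]
      simpa using hpP)
  have h2 := Ideal.ramificationIdx_eq_one (P.under (𝓞 E)) ℤ
  rw [← card_inertia_eq_ramificationIdx_int Gal(E/ℚ)] at h2
  rw [Subgroup.card_eq_one] at h2
  have h3 := restrictNormal_mem_inertia E P hσ
  rw [h2] at h3
  simpa using h3

end

end PrimeOrder

/-! ### Finite commutative groups -/

theorem Subgroup.card_sup_le_mul {A : Type*} [CommGroup A] [Finite A] (H K : Subgroup A) :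
    Nat.card (H ⊔ K : Subgroup A) ≤ Nat.card H * Nat.card K := by
  rw [← Nat.card_prod]
  refine Nat.card_le_card_of_surjective
    (fun x : H × K => (⟨x.1 * x.2, Subgroup.mul_mem_sup x.1.2 x.2.2⟩ : (H ⊔ K : Subgroup A))) ?_
  rintro ⟨a, ha⟩
  obtain ⟨y, hy, z, hz, rfl⟩ := Subgroup.mem_sup.1 ha
  exact ⟨(⟨y, hy⟩, ⟨z, hz⟩), rfl⟩

theorem Subgroup.card_finset_sup_le_prod {A : Type*} [CommGroup A] [Finite A] {ι : Type*}
    (s : Finset ι) (H : ι → Subgroup A) (c : ι → ℕ) (h : ∀ i ∈ s, Nat.card (H i) ≤ c i) :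
    Nat.card (s.sup H : Subgroup A) ≤ ∏ i ∈ s, c i := by
  classical
  induction s using Finset.induction_on with
  | empty => simp
  | insert a s ha ih =>
    rw [Finset.sup_insert, Finset.prod_insert ha]
    exact (Subgroup.card_sup_le_mul _ _).trans
      (Nat.mul_le_mul (h a (by simp)) (ih fun i hi => h i (by simp [hi])))

/-- A proper subgroup of a finite commutative group with quotient of `p`-power exponent is contained
in a subgroup of index `p`. -/
theorem Subgroup.exists_index_eq_prime {A : Type*} [CommGroup A] [Finite A] {p : ℕ}
    (hp : p.Prime) {Y : Subgroup A} (hY : Y ≠ ⊤) {m : ℕ} (h : ∀ a : A, a ^ p ^ m ∈ Y) :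
    ∃ X : Subgroup A, Y ≤ X ∧ X.index = p := by
  have : Fact p.Prime := ⟨hp⟩
  have hpg : IsPGroup p (A ⧸ Y) := by
    intro a
    obtain ⟨a, rfl⟩ := QuotientGroup.mk_surjective a
    exact ⟨m, by rw [← QuotientGroup.mk_pow, QuotientGroup.eq_one_iff]; exact h a⟩
  obtain ⟨r, hr⟩ := IsPGroup.iff_card.1 hpg
  have hr0 : r ≠ 0 := by
    rintro rfl
    rw [pow_zero, ← Subgroup.index_eq_card, Subgroup.index_eq_one] at hr
    exact hY hr
  obtain ⟨K, hK⟩ := Sylow.exists_subgroup_card_pow_prime p (G := A ⧸ Y) (n := r - 1)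
    (by rw [hr]; exact pow_dvd_pow p (Nat.sub_le _ _))
  refine ⟨K.comap (QuotientGroup.mk' Y), ?_, ?_⟩
  · intro y hy
    rw [Subgroup.mem_comap]
    have : QuotientGroup.mk' Y y = 1 := (QuotientGroup.eq_one_iff y).2 hy
    rw [this]
    exact one_mem _
  · rw [Subgroup.index_comap_of_surjective _ (QuotientGroup.mk'_surjective Y)]
    have h1 := K.card_mul_index
    rw [hK, hr] at h1
    have h2 : p ^ r = p ^ (r - 1) * p := by
      rw [← pow_succ, Nat.sub_add_cancel (Nat.pos_of_ne_zero hr0)]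
    rw [h2] at h1
    exact Nat.eq_of_mul_eq_mul_left (pow_pos hp.pos _) h1

theorem Subgroup.index_inf_of_index_prime {A : Type*} [CommGroup A] [Finite A] {p : ℕ}
    (hp : p.Prime) {X Y : Subgroup A} (hX : X.index = p) (hY : Y.index = p) (h : X ≠ Y) :
    (X ⊓ Y).index = p ^ 2 := by
  have h1 : X ⊔ Y = ⊤ := by
    have h2 : (X ⊔ Y).index ∣ p := hX ▸ Subgroup.index_dvd_of_le le_sup_left
    rcases (Nat.dvd_prime hp).1 h2 with h3 | h3
    · exact Subgroup.index_eq_one.1 h3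
    · exfalso
      have h4 : ∀ W : Subgroup A, W ≤ X ⊔ Y → W.index = p → W = X ⊔ Y := by
        intro W hW hWp
        apply Subgroup.eq_of_le_of_card_ge hW
        have e1 := W.card_mul_index
        have e2 := (X ⊔ Y).card_mul_index
        rw [hWp] at e1
        rw [h3, ← e1] at e2
        exact (Nat.eq_of_mul_eq_mul_right hp.pos e2).le
      exact h ((h4 X le_sup_left hX).trans (h4 Y le_sup_right hY).symm)
  have h5 : Y.relIndex X = p := by
    have := Subgroup.relIndex_sup_right X Y
    rw [← this, h1, Subgroup.relIndex_top_right, hY]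
  rw [← Subgroup.relIndex_mul_index (inf_le_left : X ⊓ Y ≤ X), hX, inf_comm,
    Subgroup.inf_relIndex_right, h5, pow_two]

/-! ### Action on roots of unity -/

theorem exists_pow_eq_of_primitiveRoot {K M : Type*} [Field K] [Field M] [Algebra K M] {ζ : M}
    {n : ℕ} (hn : 0 < n) (hζ : IsPrimitiveRoot ζ n) (σ : Gal(M/K)) :
    ∃ a : ℕ, a.Coprime n ∧ σ ζ = ζ ^ a := by
  have h := hζ.map_of_injective σ.injective
  have : NeZero n := ⟨hn.ne'⟩
  obtain ⟨a, -, ha, h2⟩ := (hζ.isPrimitiveRoot_iff).1 h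
  exact ⟨a, ha, h2.symm⟩

theorem pow_apply_of_apply_eq_pow {K M : Type*} [Field K] [Field M] [Algebra K M] {ζ : M}
    {σ : Gal(M/K)} {a : ℕ} (h : σ ζ = ζ ^ a) (j : ℕ) : (σ ^ j) ζ = ζ ^ a ^ j := by
  induction j with
  | zero => simp
  | succ j ih =>
    rw [pow_succ', AlgEquiv.mul_apply, ih, map_pow, h, ← pow_mul, ← pow_succ']

theorem apply_eq_self_of_coprime {K M : Type*} [Field K] [Field M] [Algebra K M] {ζ : M}
    {u v : ℕ} (h : u.Coprime v) {σ : Gal(M/K)} (hu : σ (ζ ^ u) = ζ ^ u) (hv : σ (ζ ^ v) = ζ ^ v)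
    (hζ : ζ ≠ 0) : σ ζ = ζ := by
  have h1 : ζ = (ζ ^ u) ^ (u.gcdA v) * (ζ ^ v) ^ (u.gcdB v) := by
    rw [← zpow_natCast, ← zpow_natCast, ← zpow_mul, ← zpow_mul, ← zpow_add₀ hζ,
      ← Nat.gcd_eq_gcd_ab, h]
    simp
  rw [h1, map_mul, map_zpow₀, map_zpow₀, hu, hv]

/-- An automorphism fixing the roots of unity of order prime to `u`, raised to the power `φ u`,
fixes the roots of unity. -/
theorem pow_totient_apply_eq_self {K M : Type*} [Field K] [Field M] [Algebra K M] {ζ : M}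
    {u v : ℕ} (h : u.Coprime v) (huv : 0 < u * v) (hζ : IsPrimitiveRoot ζ (u * v)) {σ : Gal(M/K)}
    (hu : σ (ζ ^ u) = ζ ^ u) : (σ ^ u.totient) ζ = ζ := by
  obtain ⟨a, ha, hσ⟩ := exists_pow_eq_of_primitiveRoot huv hζ σ
  have hζ0 : ζ ≠ 0 := hζ.ne_zero huv.ne'
  have hv0 : 0 < v := Nat.pos_of_mul_pos_left huv
  refine apply_eq_self_of_coprime h ?_ ?_ hζ0
  · have : ∀ j : ℕ, (σ ^ j) (ζ ^ u) = ζ ^ u := by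
      intro j
      induction j with
      | zero => simp
      | succ j ih => rw [pow_succ, AlgEquiv.mul_apply, hu, ih]
    exact this _
  · rw [map_pow, pow_apply_of_apply_eq_pow hσ]
    have h1 : IsPrimitiveRoot (ζ ^ v) u := hζ.pow huv (mul_comm u v)
    rw [← pow_mul, mul_comm, pow_mul]
    have h2 : a ^ u.totient ≡ 1 [MOD u] :=
      Nat.ModEq.pow_totient (Nat.Coprime.coprime_dvd_right ⟨v, rfl⟩ ha)
    conv_rhs => rw [← pow_one (ζ ^ v)]
    have hu0 : 0 < u := Nat.pos_of_mul_pos_right huv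
    rw [(h1.isOfFinOrder hu0.ne').pow_inj_mod, ← h1.eq_orderOf]
    exact h2

/-- Every power prime to `n` of a primitive `n`-th root of unity is a Galois conjugate over `ℚ`. -/
theorem exists_gal_apply_eq_pow {M : Type*} [Field M] [CharZero M] [Normal ℚ M] {ζ : M} {n : ℕ}
    (hn : 0 < n) (hζ : IsPrimitiveRoot ζ n) {a : ℕ} (ha : a.Coprime n) :
    ∃ σ : Gal(M/ℚ), σ ζ = ζ ^ a := by
  have h := minpoly.isIntegrallyClosed_eq_field_fractions' ℚ (hζ.isIntegral hn)
  have h' := minpoly.isIntegrallyClosed_eq_field_fractions' ℚ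
    ((hζ.pow_of_coprime a ha).isIntegral hn)
  rw [← IsPrimitiveRoot.minpoly_eq_pow_coprime hζ ha, ← h] at h'
  refine minpoly.exists_algEquiv_of_root' ((hζ.isIntegral hn).tower_top.isAlgebraic) ?_
  rw [← h']
  exact minpoly.aeval _ _

theorem autToPow_surjective {M : Type*} [Field M] [CharZero M] [Normal ℚ M] {ξ : M} {n : ℕ}
    [NeZero n] (hξ : IsPrimitiveRoot ξ n) : Function.Surjective (hξ.autToPow ℚ) := by
  have hn := NeZero.pos n
  intro u
  obtain ⟨τ, hτ⟩ := exists_gal_apply_eq_pow hn hξ (ZMod.val_coe_unit_coprime u)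
  refine ⟨τ, ?_⟩
  have h := hξ.autToPow_spec ℚ τ
  rw [hτ, (hξ.isOfFinOrder hn.ne').pow_inj_mod, ← hξ.eq_orderOf, Nat.mod_eq_of_lt (ZMod.val_lt _),
    Nat.mod_eq_of_lt (ZMod.val_lt _)] at h
  exact Units.ext (ZMod.val_injective _ h)

theorem autToPow_eq_of_apply_eq_pow {K M : Type*} [Field K] [Field M] [Algebra K M] {ξ : M} {n : ℕ}
    [NeZero n] (hξ : IsPrimitiveRoot ξ n) {τ : Gal(M/K)} {a : ℕ} (h : τ ξ = ξ ^ a) :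
    ((hξ.autToPow K τ : (ZMod n)ˣ) : ZMod n) = a := by
  have hs := hξ.autToPow_spec K τ
  rw [h, (hξ.isOfFinOrder (NeZero.ne n)).pow_inj_mod, ← hξ.eq_orderOf,
    ← ZMod.natCast_eq_natCast_iff', ZMod.natCast_val, ZMod.cast_id] at hs
  exact hs

theorem autToPow_eq_one {K M : Type*} [Field K] [Field M] [Algebra K M] {ξ : M} {n : ℕ}
    [NeZero n] (hξ : IsPrimitiveRoot ξ n) {τ : Gal(M/K)} (h : τ ξ = ξ) :
    hξ.autToPow K τ = 1 := by
  apply Units.ext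
  rw [autToPow_eq_of_apply_eq_pow hξ (a := 1) (by rw [h, pow_one])]
  simp

theorem apply_eq_of_autToPow_eq {K M : Type*} [Field K] [Field M] [Algebra K M] {ξ : M} {n : ℕ}
    [NeZero n] (hξ : IsPrimitiveRoot ξ n) {σ τ : Gal(M/K)}
    (h : hξ.autToPow K σ = hξ.autToPow K τ) : σ ξ = τ ξ := by
  rw [← hξ.autToPow_spec K σ, ← hξ.autToPow_spec K τ, h]

/-- The units modulo a power of `2` are generated by `-1` and `5`. -/
theorem ZMod.exists_units_two_pow (k : ℕ) (u : (ZMod (2 ^ (k + 2)))ˣ) :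
    ∃ (v : (ZMod (2 ^ (k + 2)))ˣ) (i j : ℕ), (v : ZMod (2 ^ (k + 2))) = 5 ∧ v ^ 2 ^ k = 1 ∧
      u = (-1) ^ i * v ^ j := by
  have : NeZero (2 ^ (k + 2)) := ⟨by positivity⟩
  have h5 : Nat.Coprime 5 (2 ^ (k + 2)) := Nat.Coprime.pow_right _ (by norm_num)
  let v := ZMod.unitOfCoprime 5 h5
  have hv : (v : ZMod (2 ^ (k + 2))) = 5 := by simp [v]
  have hord : orderOf v = 2 ^ k := by
    rw [← orderOf_units, hv, ZMod.orderOf_five]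
  have hindex : (Subgroup.zpowers v).index = 2 := by
    have h1 := (Subgroup.zpowers v).card_mul_index
    rw [Nat.card_zpowers, hord, Nat.card_eq_fintype_card, ZMod.card_units_eq_totient,
      Nat.totient_prime_pow Nat.prime_two (by omega)] at h1
    refine Nat.eq_of_mul_eq_mul_left (pow_pos two_pos k) (h1.trans ?_)
    rw [show k + 2 - 1 = k + 1 by omega, pow_succ]
    norm_num
  -- Powers of `5` are `1` modulo `4`, and `-1` is not.
  have hneg : (-1 : (ZMod (2 ^ (k + 2)))ˣ) ∉ Subgroup.zpowers v := by
    intro h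
    have hd : 4 ∣ 2 ^ (k + 2) := ⟨2 ^ k, by ring⟩
    have h1 : Subgroup.zpowers v ≤ (ZMod.unitsMap hd).ker := by
      rw [Subgroup.zpowers_le, MonoidHom.mem_ker]
      ext
      rw [ZMod.unitsMap_val, hv]
      have : ((5 : ZMod (2 ^ (k + 2))).cast : ZMod 4) = ((5 : ℕ) : ZMod 4) := by
        rw [← ZMod.cast_natCast hd 5]; simp
      rw [this]; rfl
    have h2 := h1 h
    rw [MonoidHom.mem_ker] at h2
    have h3 : (ZMod.unitsMap hd (-1) : ZMod 4) = -1 := by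
      rw [ZMod.unitsMap_val]
      push_cast
      exact (map_neg (ZMod.castHom hd (ZMod 4)) 1).trans (by rw [map_one])
    rw [h2] at h3
    exact absurd h3 (by decide)
  have hmem : ∃ i : ℕ, (-1) ^ i * u ∈ Subgroup.zpowers v := by
    by_cases h : u ∈ Subgroup.zpowers v
    · exact ⟨0, by simpa using h⟩
    · refine ⟨1, ?_⟩
      rw [pow_one, Subgroup.mul_mem_iff_of_index_two hindex]
      tauto
  obtain ⟨i, hi⟩ := hmem
  obtain ⟨j, hj⟩ := (mem_powers_iff_mem_zpowers).2 hi
  refine ⟨v, i, j, hv, by rw [← hord, pow_orderOf_eq_one], ?_⟩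
  simp only at hj
  rw [hj, ← mul_assoc, ← pow_add, ← two_mul, pow_mul]
  simp

/-! ### Extensions of degree `p` unramified outside `p`, for odd `p` -/

namespace PrimeOrder

open NumberField

section

variable {M : Type*} [Field M] [NumberField M]

omit [NumberField M] in
theorem under_eq_span (P : Ideal (𝓞 M)) [P.IsMaximal] {p : ℕ} (hp : p.Prime)
    (hpP : (p : 𝓞 M) ∈ P) : P.under ℤ = Ideal.span {(p : ℤ)} :=
  ((Ideal.liesOver_span_iff Ideal.IsPrime.ne_top' (Nat.prime_iff_prime_int.1 hp)).mpr
      (by simpa using hpP)).over.symm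

theorem exists_prime_mem (P : Ideal (𝓞 M)) [P.IsMaximal] : ∃ p : ℕ, p.Prime ∧ (p : 𝓞 M) ∈ P := by
  have hPb : P ≠ ⊥ := Ideal.IsMaximal.ne_bot_of_isIntegral_int P
  have : Finite (𝓞 M ⧸ P) := Ring.HasFiniteQuotients.finiteQuotient hPb
  obtain ⟨p, hp⟩ := CharP.exists (𝓞 M ⧸ P)
  have : IsDomain (𝓞 M ⧸ P) := Ideal.Quotient.isDomain P
  refine ⟨p, (CharP.char_is_prime_or_zero (𝓞 M ⧸ P) p).resolve_right ?_, ?_⟩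
  · rintro rfl
    exact CharP.char_ne_zero_of_finite (𝓞 M ⧸ P) 0 rfl
  · rw [← Ideal.Quotient.eq_zero_iff_mem, map_natCast]
    exact CharP.cast_eq_zero _ p

theorem exists_isMaximal_mem (M : Type*) [Field M] [NumberField M] {p : ℕ} (hp : p.Prime) :
    ∃ P : Ideal (𝓞 M), P.IsMaximal ∧ (p : 𝓞 M) ∈ P := by
  have : (Ideal.span {(p : ℤ)}).IsMaximal :=
    ((Ideal.span_singleton_prime (by exact_mod_cast hp.ne_zero)).2
      (Nat.prime_iff_prime_int.1 hp)).isMaximal (by simpa using hp.ne_zero)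
  obtain ⟨P, hP, hPp⟩ := Ideal.exists_maximal_ideal_liesOver_of_isIntegral (S := 𝓞 M)
    (Ideal.span {(p : ℤ)})
  refine ⟨P, hP, ?_⟩
  have := hPp.over.le (Ideal.mem_span_singleton_self _)
  simpa using this

omit [NumberField M] in
theorem natCast_notMem (P : Ideal (𝓞 M)) [P.IsMaximal] {p : ℕ} (hp : p.Prime)
    (hpP : (p : 𝓞 M) ∈ P) {n : ℕ} (h : ¬ p ∣ n) : (n : 𝓞 M) ∉ P := by
  intro hn
  have := (intCast_mem_iff (P := P) hp hpP n).1 (by simpa using hn)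
  exact h (by exact_mod_cast this)

-- Primes above the same `p` are conjugate, so their inertia groups are conjugate, hence equal in a
-- commutative group. Thus inertia depends on `p` alone.
open scoped Pointwise in
theorem inertia_eq_of_mem [IsAbelianGalois ℚ M] (P Q : Ideal (𝓞 M)) [P.IsMaximal] [Q.IsMaximal]
    {p : ℕ} (hp : p.Prime) (hP : (p : 𝓞 M) ∈ P) (hQ : (p : 𝓞 M) ∈ Q) :
    P.inertia Gal(M/ℚ) = Q.inertia Gal(M/ℚ) := by
  have key : ∀ (P Q : Ideal (𝓞 M)) [P.IsMaximal] [Q.IsMaximal], (p : 𝓞 M) ∈ P → (p : 𝓞 M) ∈ Q →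
      P.inertia Gal(M/ℚ) ≤ Q.inertia Gal(M/ℚ) := by
    intro P Q _ _ hP hQ σ hσ
    obtain ⟨g, hg⟩ := Algebra.IsInvariant.exists_smul_of_under_eq ℤ (𝓞 M) Gal(M/ℚ) P Q
      (by rw [under_eq_span P hp hP, under_eq_span Q hp hQ])
    intro x
    rw [Submodule.mem_toAddSubgroup, hg, Ideal.mem_pointwise_smul_iff_inv_smul_mem, smul_sub,
      ← mul_smul, mul_comm' g⁻¹ σ, mul_smul]
    exact hσ (g⁻¹ • x)
  exact le_antisymm (key P Q hP hQ) (key Q P hQ hP)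

/-- The Frobenius congruence. -/
theorem exists_frobenius [IsGalois ℚ M] (P : Ideal (𝓞 M)) [P.IsMaximal] {p : ℕ} (hp : p.Prime)
    (hpP : (p : 𝓞 M) ∈ P) : ∃ φ : Gal(M/ℚ), ∀ x : 𝓞 M, φ • x - x ^ p ∈ P := by
  have hPb : P ≠ ⊥ := Ideal.IsMaximal.ne_bot_of_isIntegral_int P
  have : Finite (𝓞 M ⧸ P) := Ring.HasFiniteQuotients.finiteQuotient hPb
  obtain ⟨φ, hφ⟩ := IsArithFrobAt.exists_of_isInvariant ℤ Gal(M/ℚ) P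
  refine ⟨φ, fun x => ?_⟩
  have := hφ x
  rw [under_eq_span P hp hpP, Int.card_ideal_quot] at this
  exact this

end

section Index

variable {M : Type*} [Field M] [NumberField M]

open scoped IsMulCommutative in
/-- In odd characteristic, an extension of degree `p` of `ℚ` unramified outside `p` is contained in
a cyclotomic field, in terms of subgroups. -/
theorem mem_of_index_eq_odd_prime [IsAbelianGalois ℚ M] {p : ℕ} (hp : p.Prime) (hp2 : p ≠ 2)
    {X : Subgroup Gal(M/ℚ)} (hXp : X.index = p)
    (hX : ∀ (P : Ideal (𝓞 M)) [P.IsMaximal], (p : 𝓞 M) ∉ P → P.inertia Gal(M/ℚ) ≤ X)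
    {ξ : M} {k : ℕ} (hk : 2 ≤ k) (hξ : IsPrimitiveRoot ξ (p ^ k)) {σ : Gal(M/ℚ)} (hσ : σ ξ = ξ) :
    σ ∈ X := by
  have : NeZero (p ^ k) := ⟨pow_ne_zero _ hp.ne_zero⟩
  have hpk : 0 < p ^ k := pow_pos hp.pos _
  by_contra hσX
  let χ : Gal(M/ℚ) →* (ZMod (p ^ k))ˣ := hξ.autToPow ℚ
  have hχ : Function.Surjective χ := autToPow_surjective hξ
  have hχ1 : ∀ τ : Gal(M/ℚ), τ ξ = ξ → χ τ = 1 := fun τ hτ => autToPow_eq_one hξ hτ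
  -- the subgroup of index `p` attached to the cyclotomic field
  let Y : Subgroup (ZMod (p ^ k))ˣ := (powMonoidHom p).range
  have hY : Y.index = p := by
    have : IsCyclic (ZMod (p ^ k))ˣ := ZMod.isCyclic_units_of_prime_pow p hp hp2 k
    have h1 : Nat.card (ZMod (p ^ k))ˣ = p ^ (k - 1) * (p - 1) := by
      rw [Nat.card_eq_fintype_card, ZMod.card_units_eq_totient, Nat.totient_prime_pow hp (by omega)]
    have h2 : p ∣ Nat.card (ZMod (p ^ k))ˣ := by
      rw [h1]
      exact Dvd.dvd.mul_right (dvd_pow_self p (by omega)) _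
    have h3 := IsCyclic.index_powMonoidHom_range (ZMod (p ^ k))ˣ p
    rw [h3]
    exact Nat.gcd_eq_right h2
  let X₂ := Y.comap χ
  have hX₂ : X₂.index = p := by rw [Subgroup.index_comap_of_surjective _ hχ, hY]
  have hfixX₂ : ∀ τ : Gal(M/ℚ), τ ξ = ξ → τ ∈ X₂ := fun τ hτ => by
    rw [Subgroup.mem_comap, hχ1 τ hτ]; exact one_mem _
  -- If `σ ∉ X`, then `X` differs from `X₂`, the subgroup attached to the degree `p` subfield of the
  -- cyclotomic field; the two fields together have group of type `(p, p)`.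
  have hne : X ≠ X₂ := fun h => hσX (h ▸ hfixX₂ σ hσ)
  have hindex : (X ⊓ X₂).index = p ^ 2 := Subgroup.index_inf_of_index_prime hp hXp hX₂ hne
  set B := X ⊓ X₂ with hB
  have hpowB : ∀ τ : Gal(M/ℚ), τ ^ p ∈ B := by
    intro τ
    refine ⟨?_, ?_⟩
    · have := X.pow_index_mem τ
      rwa [hXp] at this
    · exact Subgroup.mem_comap.2 ⟨χ τ, (map_pow χ τ p).symm⟩
  have hBI : ∀ (P : Ideal (𝓞 M)) [P.IsMaximal], (p : 𝓞 M) ∉ P → P.inertia Gal(M/ℚ) ≤ B := by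
    intro P _ hP
    refine le_inf (hX P hP) fun τ hτ => hfixX₂ τ ?_
    refine smul_eq_self_of_pow_eq_one P hτ hpk ?_ hξ.pow_eq_one
    intro h
    push_cast at h
    exact hP (Ideal.IsPrime.mem_of_pow_mem inferInstance _ h)
  set E := (FixedPoints.intermediateField B : IntermediateField ℚ M) with hE
  have hgE : IsGaloisGroup B E M := IsGaloisGroup.subgroup Gal(M/ℚ) ℚ M B
  have : IsAbelianGalois ℚ E := IsAbelianGalois.tower_bot ℚ E M
  have hcard : Nat.card Gal(E/ℚ) = p ^ 2 := by
    have h1 := IsGaloisGroup.card_eq_finrank B E M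
    have h2 := Module.finrank_mul_finrank ℚ E M
    rw [← h1, ← IsGaloisGroup.card_eq_finrank Gal(M/ℚ) ℚ M, ← B.index_mul_card, hindex] at h2
    rw [IsGaloisGroup.card_eq_finrank Gal(E/ℚ) ℚ E]
    exact Nat.eq_of_mul_eq_mul_right Nat.card_pos h2
  have hexp : ∀ g : Gal(E/ℚ), g ^ p = 1 := by
    intro g
    obtain ⟨τ, rfl⟩ := AlgEquiv.restrictNormalHom_surjective (F := ℚ) (K₁ := E) M g
    rw [← map_pow]
    ext x
    have h1 := AlgEquiv.restrictNormal_commutes (τ ^ p) E x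
    have h2 : (x : M) ∈ E := x.2
    have h3 : (τ ^ p) (x : M) = x := h2 ⟨τ ^ p, hpowB τ⟩
    exact h1.trans h3
  obtain ⟨P, hPm, hpP⟩ := exists_isMaximal_mem E hp
  have hPb : P ≠ ⊥ := Ideal.IsMaximal.ne_bot_of_isIntegral_int P
  -- Away from `p` all inertia groups of `E` are trivial, so by Minkowski the inertia group at `p`
  -- is everything.
  have hPI : P.inertia Gal(E/ℚ) = ⊤ := by
    apply eq_top_of_forall_inertia_le
    intro Q hQ
    by_cases hpQ : (p : 𝓞 E) ∈ Q
    · rw [inertia_eq_of_mem Q P hp hpQ hpP]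
    · obtain ⟨R, hR, hRQ⟩ := Ideal.exists_maximal_ideal_liesOver_of_isIntegral (S := 𝓞 M) Q
      have hpR : (p : 𝓞 M) ∉ R := fun h => hpQ (by
        rw [hRQ.over, Ideal.mem_comap]
        simpa using h)
      have h1 := ramificationIdx_under_eq_one B R (hBI R hpR)
      rw [← hE, ← Ideal.over_def R Q, ← card_inertia_eq_ramificationIdx_int Gal(E/ℚ),
        Subgroup.card_eq_one] at h1
      rw [h1]
      exact bot_le
  have hI : ∀ (g : Gal(E/ℚ)) (x : 𝓞 E), g • x - x ∈ P := fun g => by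
    have : g ∈ P.inertia Gal(E/ℚ) := hPI ▸ Subgroup.mem_top g
    exact this
  refine false_of_totallyRamified_sq (P := P) hPb (A := Gal(E/ℚ)) hp hp2 ?_ ?_ hI ?_ hcard hexp
  · have h1 := hasOrd_ramificationIdx P hp hpP
    rwa [← card_inertia_eq_ramificationIdx_int Gal(E/ℚ), hPI, Subgroup.card_top, hcard] at h1
  · intro x hx
    obtain ⟨n, hn⟩ := Algebra.IsInvariant.isInvariant (A := ℤ) (G := Gal(E/ℚ)) x hx
    exact ⟨n, by rw [← hn]; simp⟩
  · intro x
    -- The Frobenius is itself an inertia element, so `x ^ p ≡ x` and the residue field is the prime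
    -- field.
    obtain ⟨φ, hφ⟩ := exists_frobenius P hp hpP
    refine exists_intCast_sub_mem hPb hp hpP ?_
    have := sub_mem (hI φ x) (hφ x)
    rwa [show φ • x - x - (φ • x - x ^ p) = x ^ p - x by ring] at this

end Index

end PrimeOrder

/-! ### Quadratic fields unramified outside `2` -/

namespace PrimeOrder

open NumberField

variable {M : Type*} [Field M] [NumberField M]

/-- A quadratic field unramified outside `2` is contained in `ℚ(ζ₈)`, in terms of subgroups. -/
theorem mem_of_index_eq_two [IsAbelianGalois ℚ M]
    {X : Subgroup Gal(M/ℚ)} (hX2 : X.index = 2)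
    (hX : ∀ (P : Ideal (𝓞 M)) [P.IsMaximal], (2 : 𝓞 M) ∉ P → P.inertia Gal(M/ℚ) ≤ X)
    {ξ : M} {k : ℕ} (hk : 3 ≤ k) (hξ : IsPrimitiveRoot ξ (2 ^ k)) {σ : Gal(M/ℚ)} (hσ : σ ξ = ξ) :
    σ ∈ X := by
  by_contra hσX
  set E := (FixedPoints.intermediateField X : IntermediateField ℚ M) with hE
  have hgE : IsGaloisGroup X E M := IsGaloisGroup.subgroup Gal(M/ℚ) ℚ M X
  have hmemE : ∀ x : M, x ∈ E ↔ ∀ g ∈ X, g x = x := fun x =>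
    ⟨fun h g hg => h ⟨g, hg⟩, fun h g => h g g.2⟩
  obtain ⟨x, hxE, hx⟩ : ∃ x ∈ E, σ x ≠ x := by
    by_contra! h
    apply hσX
    rw [← IntermediateField.fixingSubgroup_fixedField X, IntermediateField.mem_fixingSubgroup_iff]
    intro x hx
    exact h x ((hmemE x).2 fun g hg => hx ⟨g, hg⟩)
  have hcomm : ∀ (g h : Gal(M/ℚ)) (y : M), g (h y) = h (g y) := fun g h y => by
    rw [← AlgEquiv.mul_apply, mul_comm', AlgEquiv.mul_apply]
  -- Since `σ ^ 2 ∈ X` fixes `x`, the element `α` changes sign under `σ`, and its square is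
  -- rational.
  set α := x - σ x with hα
  have hα0 : α ≠ 0 := sub_ne_zero.2 hx.symm
  have hαE : α ∈ E := by
    rw [hmemE] at hxE ⊢
    intro g hg
    rw [hα, map_sub, hcomm, hxE g hg]
  have hσσ : σ * σ ∈ X := by
    rw [Subgroup.mul_mem_iff_of_index_two hX2]
  have hσα : σ α = -α := by
    rw [hα, map_sub, ← AlgEquiv.mul_apply, (hmemE x).1 hxE _ hσσ]; ring
  obtain ⟨d, hd⟩ : ∃ d : ℚ, α ^ 2 = algebraMap ℚ M d := by
    have h1 : ∀ g : Gal(M/ℚ), g • (α ^ 2) = α ^ 2 := by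
      intro g
      rw [AlgEquiv.smul_def, map_pow]
      by_cases hg : g ∈ X
      · rw [(hmemE α).1 hαE g hg]
      · have h2 : σ⁻¹ * g ∈ X := by
          rw [Subgroup.mul_mem_iff_of_index_two hX2, inv_mem_iff]; tauto
        have h3 : g α = σ ((σ⁻¹ * g) α) := by
          rw [← AlgEquiv.mul_apply, mul_inv_cancel_left]
        rw [h3, (hmemE α).1 hαE _ h2, hσα, neg_sq]
    obtain ⟨d, hd⟩ := Algebra.IsInvariant.isInvariant (A := ℚ) (G := Gal(M/ℚ)) (α ^ 2) h1
    exact ⟨d, hd.symm⟩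
  -- normalize to the square root of a squarefree integer
  obtain ⟨β, a, ε, hβE, hβ, hβσ, ha, hε⟩ : ∃ (β : M) (a : ℕ) (ε : ℤ), β ∈ E ∧
      β ^ 2 = ε * a ∧ σ β ≠ β ∧ Squarefree a ∧ (ε = 1 ∨ ε = -1) := by
    have hden : (d.den : M) ≠ 0 := by exact_mod_cast d.den_nz
    obtain ⟨a, b, hab, ha⟩ := Nat.sq_mul_squarefree (d.num * d.den).natAbs
    have hdnum : (d.num : M) = algebraMap ℚ M d * d.den := by
      have := Rat.mul_den_eq_num d
      rw [← map_natCast (algebraMap ℚ M), ← map_mul, this]; simp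
    have hd0 : d ≠ 0 := by
      rintro rfl
      rw [map_zero] at hd
      exact hα0 (pow_eq_zero_iff two_ne_zero |>.1 hd)
    have hb0 : b ≠ 0 := by
      rintro rfl
      have : (d.num * d.den).natAbs ≠ 0 := by
        simp [hd0]
      apply this
      rw [← hab]; ring
    obtain ⟨ε, hε, hε2⟩ : ∃ ε : ℤ, (ε = 1 ∨ ε = -1) ∧
        d.num * d.den = ε * (d.num * d.den).natAbs := by
      rcases Int.natAbs_eq (d.num * d.den) with h | h
      · exact ⟨1, Or.inl rfl, by rw [one_mul]; exact h⟩
      · exact ⟨-1, Or.inr rfl, by rw [neg_one_mul]; exact h⟩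
    have hbM : (b : M) ≠ 0 := by exact_mod_cast hb0
    refine ⟨α * d.den / b, a, ε, ?_, ?_, ?_, ha, hε⟩
    · exact div_mem (mul_mem hαE (natCast_mem E _)) (natCast_mem E _)
    · have h1 : (d.num * d.den : M) = ε * (b ^ 2 * a) := by
        have := congrArg (Int.cast : ℤ → M) hε2
        rw [← hab] at this
        push_cast at this
        exact this
      rw [div_pow, mul_pow, hd, div_eq_iff (pow_ne_zero 2 hbM)]
      rw [hdnum] at h1
      linear_combination h1
    · rw [map_div₀, map_mul, hσα, map_natCast, map_natCast]
      intro h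
      rw [div_left_inj' hbM, mul_left_inj' hden] at h
      exact hα0 (self_eq_neg.1 h.symm)
  have hεM : ((ε : M)) = 1 ∨ (ε : M) = -1 := by
    rcases hε with rfl | rfl
    · left; simp
    · right; simp
  -- An odd prime `q ∣ a` is unramified in `E`, so `q` has order `1` at a prime above it; but then
  -- the square `ε a` would have order `1`, which is odd.
  have hodd : ∀ q : ℕ, q.Prime → q ∣ a → q = 2 := by
    intro q hq hqa
    by_contra hq2
    obtain ⟨a', rfl⟩ := hqa
    have hqa' : ¬ q ∣ a' := by
      rintro ⟨c, rfl⟩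
      exact hq.one_lt.ne' (Nat.isUnit_iff.1 (ha q ⟨c, by ring⟩))
    obtain ⟨P, hP, hqP⟩ := exists_isMaximal_mem M hq
    have h2P : (2 : 𝓞 M) ∉ P := by
      have := natCast_notMem P hq hqP (n := 2)
        (fun h => hq2 ((Nat.prime_dvd_prime_iff_eq hq Nat.prime_two).1 h))
      exact_mod_cast this
    have h1 := ramificationIdx_under_eq_one X P (hX P h2P)
    rw [← hE] at h1
    have hPE : (P.under (𝓞 E)).IsMaximal := Ideal.IsMaximal.under (𝓞 E) P
    have hqE : (q : 𝓞 E) ∈ P.under (𝓞 E) := by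
      rw [Ideal.mem_comap]
      simpa using hqP
    have hb := Ideal.IsMaximal.ne_bot_of_isIntegral_int (P.under (𝓞 E))
    have h2 := hasOrd_ramificationIdx (P.under (𝓞 E)) hq hqE
    rw [h1] at h2
    let β' : E := ⟨β, hβE⟩
    have hβ' : β' ^ 2 = ((ε * (q * a' : ℕ) : ℤ) : E) := by
      apply Subtype.ext
      push_cast
      push_cast at hβ
      exact hβ
    obtain ⟨z, hz⟩ : ∃ z : 𝓞 E, algebraMap (𝓞 E) E z = β' := by
      refine ⟨⟨β', IsIntegral.of_pow two_pos ?_⟩, rfl⟩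
      rw [hβ']
      exact isIntegral_intCast _
    have hz2 : z ^ 2 = (q : 𝓞 E) * ((ε * a' : ℤ) : 𝓞 E) := by
      apply FaithfulSMul.algebraMap_injective (𝓞 E) E
      rw [map_pow, hz, hβ']
      rw [map_mul, map_natCast, map_intCast]
      push_cast
      ring
    have h3 : HasOrd (P.under (𝓞 E)) (z ^ 2) (1 + 0) := by
      rw [hz2]
      refine h2.mul hb ⟨by simp, ?_⟩
      rw [zero_add, pow_one, intCast_mem_iff hq hqE]
      intro h
      apply hqa'
      rcases hε with rfl | rfl
      · rw [one_mul] at h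
        exact_mod_cast h
      · rw [neg_one_mul, dvd_neg] at h
        exact_mod_cast h
    have hz0 : z ≠ 0 := by
      rintro rfl
      exact h3.2 (by simp)
    obtain ⟨t, ht⟩ := exists_hasOrd (P := P.under (𝓞 E)) hz0
    have h4 := (ht.pow hb 2).unique h3
    omega
  have ha12 : a = 1 ∨ a = 2 := by
    by_cases h1 : a = 1
    · exact Or.inl h1
    · right
      obtain ⟨q, hq, hqa⟩ := Nat.exists_prime_and_dvd h1
      obtain rfl := hodd q hq hqa
      obtain ⟨a', rfl⟩ := hqa
      by_cases h2 : a' = 1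
      · rw [h2]
      · obtain ⟨q, hq, hqa⟩ := Nat.exists_prime_and_dvd h2
        obtain rfl := hodd q hq (hqa.mul_left 2)
        obtain ⟨c, rfl⟩ := hqa
        have := Nat.isUnit_iff.1 (ha 2 ⟨c, by ring⟩)
        omega
  -- the square roots of `-1` and `2`
  obtain ⟨w, hw⟩ : ∃ w, w = ξ ^ 2 ^ (k - 3) := ⟨_, rfl⟩
  have hσw : σ w = w := by rw [hw, map_pow, hσ]
  have hw8 : IsPrimitiveRoot w 8 := by
    rw [hw]
    refine hξ.pow (by positivity) ?_
    rw [show (8 : ℕ) = 2 ^ 3 by norm_num, ← pow_add]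
    congr 1
    omega
  have hw0 : w ≠ 0 := hw8.ne_zero (by norm_num)
  have hw4 : w ^ 4 = -1 := by
    have h1 : (w ^ 4 - 1) * (w ^ 4 + 1) = 0 := by linear_combination hw8.pow_eq_one
    rcases mul_eq_zero.1 h1 with h2 | h2
    · exact absurd (sub_eq_zero.1 h2) (hw8.pow_ne_one_of_pos_of_lt (by norm_num) (by norm_num))
    · linear_combination h2
  -- In terms of a primitive eighth root of unity `w`, the square roots of `-1` and `2` are `w ^ 2`
  -- and `w - w ^ 3`; all are fixed by `σ`.
  obtain ⟨c, hc, hσc⟩ : ∃ c : M, c ^ 2 = β ^ 2 ∧ σ c = c := by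
    rw [hβ]
    rcases ha12 with rfl | rfl <;> rcases hεM with h | h <;> rw [h]
    · exact ⟨1, by simp, by simp⟩
    · exact ⟨w ^ 2, by push_cast; linear_combination hw4, by rw [map_pow, hσw]⟩
    · refine ⟨w - w ^ 3, ?_, by rw [map_sub, map_pow, hσw]⟩
      push_cast
      linear_combination (w ^ 2 - 2) * hw4
    · refine ⟨w ^ 2 * (w - w ^ 3), ?_, by rw [map_mul, map_sub, map_pow, map_pow, hσw]⟩
      push_cast
      linear_combination (w ^ 6 - 2 * w ^ 4 + 2) * hw4
  rcases sq_eq_sq_iff_eq_or_eq_neg.1 hc with h | h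
  · exact hβσ (h ▸ hσc)
  · rw [h, map_neg, neg_inj] at hσc
    exact hβσ hσc

end PrimeOrder

/-! ### The counting argument for Kronecker-Weber -/

namespace PrimeOrder

open NumberField

theorem pow_apply_eq_self {K M : Type*} [Field K] [Field M] [Algebra K M] {σ : Gal(M/K)} {x : M}
    (h : σ x = x) (j : ℕ) : (σ ^ j) x = x := by
  induction j with
  | zero => simp
  | succ j ih => rw [pow_succ, AlgEquiv.mul_apply, h, ih]

/-- The subgroup of elements fixing a given element. -/
def fixingElement {K M : Type*} [Field K] [Field M] [Algebra K M] (x : M) : Subgroup Gal(M/K) :=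
  MulAction.stabilizer Gal(M/K) x

theorem mem_fixingElement {K M : Type*} [Field K] [Field M] [Algebra K M] {x : M} {σ : Gal(M/K)} :
    σ ∈ fixingElement x ↔ σ x = x := Iff.rfl

variable {M : Type*} [Field M] [NumberField M]

/-- A small subgroup surjecting onto the Galois group of the `p ^ k`-th cyclotomic field. -/
theorem exists_card_le_totient [IsAbelianGalois ℚ M] {p : ℕ} (hp : p.Prime) {m s : ℕ}
    (hs : (p ^ (m + 3)).Coprime s) (hs0 : 0 < s) {ζ : M}
    (hζ : IsPrimitiveRoot ζ (p ^ (m + 3) * s))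
    (hexp : ∀ σ : Gal(M/ℚ), σ ζ = ζ → ∀ τ : Gal(M/ℚ), τ ^ p ^ m = σ → σ = 1)
    (hconj : p = 2 → ∃ c : Gal(M/ℚ), c * c = 1 ∧ c ζ = ζ⁻¹)
    (I : Subgroup Gal(M/ℚ)) (hI : ∀ σ ∈ I, σ (ζ ^ p ^ (m + 3)) = ζ ^ p ^ (m + 3))
    (hIξ : ∀ σ : Gal(M/ℚ), ∃ τ ∈ I, τ (ζ ^ s) = σ (ζ ^ s)) :
    ∃ C : Subgroup Gal(M/ℚ), Nat.card C ≤ (p ^ (m + 3)).totient ∧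
      ∀ σ : Gal(M/ℚ), ∃ c ∈ C, c (ζ ^ s) = σ (ζ ^ s) := by
  have hpk : 0 < p ^ (m + 3) := pow_pos hp.pos _
  have : NeZero (p ^ (m + 3)) := ⟨hpk.ne'⟩
  have hζ0 : ζ ≠ 0 := hζ.ne_zero (by positivity)
  have hξ : IsPrimitiveRoot (ζ ^ s) (p ^ (m + 3)) := hζ.pow (by positivity) (mul_comm _ _)
  let χ : Gal(M/ℚ) →* (ZMod (p ^ (m + 3)))ˣ := hξ.autToPow ℚ
  have hχ : Function.Surjective χ := autToPow_surjective hξ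
  have hχeq : ∀ {σ τ : Gal(M/ℚ)}, χ σ = χ τ → σ (ζ ^ s) = τ (ζ ^ s) := fun h =>
    apply_eq_of_autToPow_eq hξ h
  have hχeq' : ∀ {σ τ : Gal(M/ℚ)}, σ (ζ ^ s) = τ (ζ ^ s) → χ σ = χ τ := fun {σ τ} h => by
    have h1 : χ (τ⁻¹ * σ) = 1 := autToPow_eq_one hξ (by
      rw [AlgEquiv.mul_apply, h, ← AlgEquiv.mul_apply, inv_mul_cancel, AlgEquiv.one_apply])
    rw [map_mul, map_inv, inv_mul_eq_one] at h1
    exact h1.symm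
  have hex : ∀ u : (ZMod (p ^ (m + 3)))ˣ, ∃ g ∈ I, χ g = u := fun u => by
    obtain ⟨σ, hσ⟩ := hχ u
    obtain ⟨τ, hτ, h⟩ := hIξ σ
    exact ⟨τ, hτ, (hχeq' h).trans hσ⟩
  -- The order of `g ∈ I` can be read off from its character value, up to exponents divisible by `p
  -- ^ m`: then `g ^ j` fixes `ζ` and is a `p ^ m`-th power.
  have hkill : ∀ g ∈ I, ∀ j : ℕ, p ^ m ∣ j → (χ g) ^ j = 1 → g ^ j = 1 := by
    rintro g hg j ⟨r, rfl⟩ hj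
    refine hexp _ ?_ (g ^ r) (by rw [← pow_mul, mul_comm])
    refine apply_eq_self_of_coprime hs (pow_apply_eq_self (hI g hg) _) ?_ hζ0
    rw [← map_pow, ← map_one χ] at hj
    simpa using hχeq hj
  rcases eq_or_ne p 2 with rfl | hp2
  · obtain ⟨c, hcc, hc⟩ := hconj rfl
    -- Only the unit `5` is wanted here, so the decomposed unit `1` is a dummy. A lift of `5` in `I`
    -- has order at most `2 ^ (m + 1)`. For a lift of `-1`, `hkill` does not give order `2`, so
    -- complex conjugation is used instead.
    obtain ⟨v, -, -, hv, hvk, -⟩ := ZMod.exists_units_two_pow (m + 1) 1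
    obtain ⟨g, hg, hgv⟩ := hex v
    have hg1 : g ^ 2 ^ (m + 1) = 1 := hkill g hg _ (pow_dvd_pow _ (by omega)) (by rw [hgv, hvk])
    have hc1 : χ c = -1 := by
      have h1 : c (ζ ^ s) = (ζ ^ s) ^ (2 ^ (m + 3) - 1) := by
        rw [map_pow, hc, inv_pow]
        refine inv_eq_of_mul_eq_one_left ?_
        rw [← pow_succ, Nat.sub_add_cancel hpk, hξ.pow_eq_one]
      ext
      rw [show ((χ c : (ZMod (2 ^ (m + 3)))ˣ) : ZMod (2 ^ (m + 3))) = _ from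
        autToPow_eq_of_apply_eq_pow hξ h1, Nat.cast_sub hpk, ZMod.natCast_self]
      simp
    refine ⟨Subgroup.zpowers c ⊔ Subgroup.zpowers g, ?_, fun σ => ?_⟩
    · open scoped IsMulCommutative in
      refine (Subgroup.card_sup_le_mul _ _).trans ?_
      rw [Nat.card_zpowers, Nat.card_zpowers, Nat.totient_prime_pow_succ hp]
      have h1 : orderOf c ≤ 2 := orderOf_le_of_pow_eq_one two_pos (by rw [pow_two, hcc])
      have h2 : orderOf g ≤ 2 ^ (m + 1) := orderOf_le_of_pow_eq_one (by positivity) hg1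
      calc orderOf c * orderOf g ≤ 2 * 2 ^ (m + 1) := Nat.mul_le_mul h1 h2
        _ = 2 ^ (m + 2) * (2 - 1) := by ring
    · obtain ⟨v', i, j, hv', -, h⟩ := ZMod.exists_units_two_pow (m + 1) (χ σ)
      obtain rfl : v' = v := Units.ext (hv'.trans hv.symm)
      refine ⟨c ^ i * g ^ j, ?_, hχeq ?_⟩
      · exact mul_mem (Subgroup.mem_sup_left (Subgroup.npow_mem_zpowers c i))
          (Subgroup.mem_sup_right (Subgroup.npow_mem_zpowers g j))
      · rw [map_mul, map_pow, map_pow, hc1, hgv]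
        exact h.symm
  · have : IsCyclic (ZMod (p ^ (m + 3)))ˣ := ZMod.isCyclic_units_of_prime_pow p hp hp2 _
    obtain ⟨γ, hγ⟩ := IsCyclic.exists_generator (α := (ZMod (p ^ (m + 3)))ˣ)
    obtain ⟨g, hg, hgγ⟩ := hex γ
    refine ⟨Subgroup.zpowers g, ?_, fun σ => ?_⟩
    · rw [Nat.card_zpowers]
      -- The unit group is cyclic of order divisible by `p ^ m`, so a lift of a generator is killed
      -- by that order.
      refine orderOf_le_of_pow_eq_one (Nat.totient_pos.2 hpk) (hkill g hg _ ?_ ?_)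
      · rw [Nat.totient_prime_pow_succ hp]
        exact Dvd.dvd.mul_right (pow_dvd_pow _ (by omega)) _
      · rw [← ZMod.card_units_eq_totient, pow_card_eq_one]
    · obtain ⟨j, hj⟩ := mem_powers_iff_mem_zpowers.2 (hγ (χ σ))
      refine ⟨g ^ j, Subgroup.npow_mem_zpowers g j, hχeq ?_⟩
      rw [map_pow, hgγ]
      exact hj

open scoped IsMulCommutative in
/-- The main counting argument in the Kronecker-Weber theorem. -/
theorem card_gal_le_totient [IsAbelianGalois ℚ M] {p : ℕ} (hp : p.Prime) {m : ℕ} {S : Finset ℕ}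
    (hS : ∀ l ∈ S, l.Prime ∧ l ≠ p) {ζ : M}
    (hζ : IsPrimitiveRoot ζ (p ^ (m + 3) * ∏ l ∈ S, l))
    (hconj : p = 2 → ∃ c : Gal(M/ℚ), c * c = 1 ∧ c ζ = ζ⁻¹)
    (E : Type*) [Field E] [NumberField E] [IsGalois ℚ E] [Algebra E M]
    (hE : ∀ τ : Gal(E/ℚ), τ ^ p ^ m = 1)
    (hram : ∀ l : ℕ, l.Prime → l ≠ p → (l : ℤ) ∣ discr E → l ∈ S)
    (hgen : ∀ σ : Gal(M/ℚ), σ.restrictNormal E = 1 → σ ζ = ζ → σ = 1) :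
    Nat.card Gal(M/ℚ) ≤ (p ^ (m + 3) * ∏ l ∈ S, l).totient := by
  set s := ∏ l ∈ S, l with hs
  have hs0 : 0 < s := Finset.prod_pos fun l hl => (hS l hl).1.pos
  have hpk : 0 < p ^ (m + 3) := pow_pos hp.pos _
  have hζ0 : ζ ≠ 0 := hζ.ne_zero (by positivity)
  have hcop : (p ^ (m + 3)).Coprime s := Nat.Coprime.pow_left _ (Nat.Coprime.prod_right fun l hl =>
    (Nat.coprime_primes hp (hS l hl).1).2 (hS l hl).2.symm)
  have hexp : ∀ σ : Gal(M/ℚ), σ ζ = ζ → ∀ τ : Gal(M/ℚ), τ ^ p ^ m = σ → σ = 1 := by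
    rintro σ hσ τ rfl
    refine hgen _ ?_ hσ
    exact (map_pow (AlgEquiv.restrictNormalHom E) τ (p ^ m)).trans (hE _)
  -- the inertia groups
  have hP : ∀ l : ℕ, ∃ P : Ideal (𝓞 M), P.IsMaximal ∧ (l.Prime → (l : 𝓞 M) ∈ P) := fun l => by
    by_cases hl : l.Prime
    · obtain ⟨P, h1, h2⟩ := exists_isMaximal_mem M hl
      exact ⟨P, h1, fun _ => h2⟩
    · obtain ⟨P, h1, h2⟩ := exists_isMaximal_mem M hp
      exact ⟨P, h1, fun h => absurd h hl⟩
  choose P hPmax hPmem using hP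
  let I : ℕ → Subgroup Gal(M/ℚ) := fun l => (P l).inertia Gal(M/ℚ)
  let J : Subgroup Gal(M/ℚ) := S.sup I
  have hinertia : ∀ (Q : Ideal (𝓞 M)) [Q.IsMaximal] (l : ℕ), l.Prime → (l : 𝓞 M) ∈ Q →
      Q.inertia Gal(M/ℚ) = I l := fun Q _ l hl hlQ =>
    have := hPmax l
    inertia_eq_of_mem Q (P l) hl hlQ (hPmem l hl)
  have hfix : ∀ l : ℕ, l.Prime → ∀ u v : ℕ, u * v = p ^ (m + 3) * s → ¬ l ∣ v →
      ∀ σ ∈ I l, σ (ζ ^ u) = ζ ^ u := by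
    intro l hl u v huv hlv σ hσ
    have := hPmax l
    have hv : 0 < v := by
      rcases Nat.eq_zero_or_pos v with rfl | h
      · exact absurd (dvd_zero l) hlv
      · exact h
    refine smul_eq_self_of_pow_eq_one (P l) hσ hv (natCast_notMem _ hl (hPmem l hl) hlv) ?_
    rw [← pow_mul, huv, hζ.pow_eq_one]
  -- For `g` in the inertia group at `l`, the power `g ^ (l - 1)` fixes `ζ`, so `g ^ (p ^ m * (l -
  -- 1)) = 1`. This exponent is prime to `l`: the inertia is tame.
  have hIcard : ∀ l ∈ S, Nat.card (I l) ≤ l - 1 := by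
    intro l hl
    obtain ⟨hlp, hlne⟩ := hS l hl
    have := hPmax l
    obtain ⟨φ, hφ⟩ := exists_frobenius (P l) hlp (hPmem l hlp)
    have : FaithfulSMul Gal(M/ℚ) (𝓞 M) := IsGaloisGroup.faithful (G := Gal(M/ℚ)) ℤ
    refine card_inertia_le (Ideal.IsMaximal.ne_bot_of_isIntegral_int (P l)) hlp (hPmem l hlp) φ hφ
      (I l) (fun g hg x => hg x) fun g hg => ⟨p ^ m * (l - 1), ?_, ?_⟩
    · have h1 : s = l * ∏ x ∈ S.erase l, x := (Finset.mul_prod_erase S (fun x => x) hl).symm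
      have h2 : l.Coprime (p ^ (m + 3) * ∏ x ∈ S.erase l, x) := by
        refine Nat.Coprime.mul_right ?_ (Nat.Coprime.prod_right fun x hx => ?_)
        · exact Nat.Coprime.pow_right _ ((Nat.coprime_primes hlp hp).2 hlne)
        · exact (Nat.coprime_primes hlp (hS x (Finset.mem_of_mem_erase hx)).1).2
            (Finset.ne_of_mem_erase hx).symm
      have h3 : l * (p ^ (m + 3) * ∏ x ∈ S.erase l, x) = p ^ (m + 3) * s := by rw [h1]; ring
      have h4 := hfix l hlp l _ h3 (fun h => by
        have := Nat.Coprime.eq_one_of_dvd h2 h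
        exact hlp.one_lt.ne' this) g hg
      have h5 := pow_totient_apply_eq_self h2 (by rw [h3]; positivity) (by rw [h3]; exact hζ) h4
      rw [Nat.totient_prime hlp] at h5
      refine hexp _ ?_ (g ^ (l - 1)) (by rw [← pow_mul, mul_comm])
      rw [mul_comm, pow_mul]
      exact pow_apply_eq_self h5 _
    · intro h
      rcases hlp.dvd_mul.1 h with h | h
      · exact hlne ((Nat.prime_dvd_prime_iff_eq hlp hp).1 (hlp.dvd_of_dvd_pow h))
      · have := Nat.le_of_dvd (by have := hlp.two_le; omega) h
        have := hlp.pos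
        omega
  have hJcard : Nat.card J ≤ s.totient := by
    refine (Subgroup.card_finset_sup_le_prod S I (fun l => l - 1) hIcard).trans_eq ?_
    clear_value s
    subst hs
    clear * - hS
    induction S using Finset.induction_on with
    | empty => simp
    | insert a S ha ih =>
      rw [Finset.prod_insert ha, Finset.prod_insert ha, Nat.totient_mul,
        Nat.totient_prime (hS a (by simp)).1, ih fun l hl => hS l (by simp [hl])]
      exact Nat.Coprime.prod_right fun l hl => (Nat.coprime_primes (hS a (by simp)).1
        (hS l (by simp [hl])).1).2 (by rintro rfl; exact ha hl)
  have hJξ : ∀ σ ∈ J, σ (ζ ^ s) = ζ ^ s := by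
    have : J ≤ fixingElement (ζ ^ s) := Finset.sup_le fun l hl σ hσ => by
      rw [mem_fixingElement]
      refine hfix l (hS l hl).1 s (p ^ (m + 3)) (mul_comm _ _) (fun h => ?_) σ hσ
      exact (hS l hl).2 ((Nat.prime_dvd_prime_iff_eq (hS l hl).1 hp).1
        ((hS l hl).1.dvd_of_dvd_pow h))
    exact fun σ hσ => mem_fixingElement.1 (this hσ)
  have hIp : ∀ σ ∈ I p, σ (ζ ^ p ^ (m + 3)) = ζ ^ p ^ (m + 3) := fun σ hσ =>
    hfix p hp _ s rfl (fun h => by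
      have h1 : p ∣ p ^ (m + 3) := dvd_pow_self p (by omega)
      exact hp.one_lt.ne' (Nat.Coprime.eq_one_of_dvd (hcop.coprime_dvd_left h1) h)) σ hσ
  -- A prime outside `S` and different from `p` is unramified in `E` and prime to the order of `ζ`,
  -- so its inertia acts trivially on generators of `M`.
  have hnotp : ∀ (Q : Ideal (𝓞 M)) [Q.IsMaximal], (p : 𝓞 M) ∉ Q → Q.inertia Gal(M/ℚ) ≤ J := by
    intro Q hQ hpQ
    obtain ⟨l, hl, hlQ⟩ := exists_prime_mem Q
    have hlp : l ≠ p := by rintro rfl; exact hpQ hlQ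
    by_cases hlS : l ∈ S
    · rw [hinertia Q l hl hlQ]
      exact Finset.le_sup hlS
    · intro σ hσ
      have h1 := restrictNormal_eq_one E Q hl hlQ (fun h => hlS (hram l hl hlp h)) hσ
      have h2 : σ (ζ ^ 1) = ζ ^ 1 := by
        rw [hinertia Q l hl hlQ] at hσ
        refine hfix l hl 1 (p ^ (m + 3) * s) (one_mul _) (fun h => ?_) σ hσ
        rcases hl.dvd_mul.1 h with h | h
        · exact hlp ((Nat.prime_dvd_prime_iff_eq hl hp).1 (hl.dvd_of_dvd_pow h))
        · obtain ⟨q, hq, hlq⟩ := (Nat.Prime.prime hl).exists_mem_finset_dvd h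
          rw [(Nat.prime_dvd_prime_iff_eq hl (hS q hq).1).1 hlq] at hlS
          exact hlS hq
      rw [pow_one] at h2
      rw [hgen σ h1 h2]
      exact one_mem _
  have htop : J ⊔ I p = ⊤ := eq_top_of_forall_inertia_le _ fun Q hQ => by
    by_cases hpQ : (p : 𝓞 M) ∈ Q
    · rw [hinertia Q p hp hpQ]
      exact le_sup_right
    · exact (hnotp Q hpQ).trans le_sup_left
  have hdec : ∀ σ : Gal(M/ℚ), ∃ j ∈ J, ∃ i ∈ I p, j * i = σ := fun σ =>
    Subgroup.mem_sup.1 (htop ▸ Subgroup.mem_top σ)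
  obtain ⟨C, hCcard, hC⟩ := exists_card_le_totient hp hcop hs0 hζ hexp hconj (I p) hIp (fun σ => by
    obtain ⟨j, hj, i, hi, rfl⟩ := hdec σ
    refine ⟨i, hi, ?_⟩
    rw [mul_comm, AlgEquiv.mul_apply, hJξ j hj])
  -- Write `σ = c * j * i` with `i` in the inertia group at `p` and fixing `ζ`; then `i ^ p ^ m =
  -- 1`.
  have hpow : ∀ σ : Gal(M/ℚ), σ ^ p ^ m ∈ J ⊔ C := by
    intro σ
    obtain ⟨c, hc, hcσ⟩ := hC σ
    obtain ⟨j, hj, i, hi, hji⟩ := hdec (c⁻¹ * σ)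
    have h1 : i (ζ ^ s) = ζ ^ s := by
      have h2 : (j * i) (ζ ^ s) = ζ ^ s := by
        rw [hji, AlgEquiv.mul_apply, ← hcσ, ← AlgEquiv.mul_apply, inv_mul_cancel,
          AlgEquiv.one_apply]
      rwa [mul_comm, AlgEquiv.mul_apply, hJξ j hj] at h2
    have h3 : i ζ = ζ := apply_eq_self_of_coprime hcop (hIp i hi) h1 hζ0
    have h4 : i ^ p ^ m = 1 := hexp _ (pow_apply_eq_self h3 _) i rfl
    have h5 : σ = c * (j * i) := by rw [hji, mul_inv_cancel_left]
    rw [h5, mul_pow, mul_pow, h4, mul_one]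
    exact mul_mem (Subgroup.mem_sup_right (pow_mem hc _)) (Subgroup.mem_sup_left (pow_mem hj _))
  have hξ : IsPrimitiveRoot (ζ ^ s) (p ^ (m + 3)) := hζ.pow (by positivity) (mul_comm _ _)
  -- Otherwise a subgroup `X` of index `p` contains `J` and `C`. Its field is unramified outside
  -- `p`, hence `X` contains the stabilizer of `ζ ^ s`; as `C` realizes every action on `ζ ^ s`,
  -- this gives `X = ⊤`.
  have hJC : J ⊔ C = ⊤ := by
    by_contra hne
    obtain ⟨X, hX, hXp⟩ := Subgroup.exists_index_eq_prime hp hne hpow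
    have hXI : ∀ (Q : Ideal (𝓞 M)) [Q.IsMaximal], (p : 𝓞 M) ∉ Q → Q.inertia Gal(M/ℚ) ≤ X :=
      fun Q hQ hpQ => (hnotp Q hpQ).trans (le_sup_left.trans hX)
    have hZ : ∀ σ : Gal(M/ℚ), σ (ζ ^ s) = ζ ^ s → σ ∈ X := by
      intro σ hσ
      rcases eq_or_ne p 2 with rfl | hp2
      · exact mem_of_index_eq_two hXp (fun Q hQ hQ2 => hXI Q (by exact_mod_cast hQ2)) (by omega)
          hξ hσ
      · exact mem_of_index_eq_odd_prime hp hp2 hXp hXI (by omega) hξ hσ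
    have : X = ⊤ := by
      refine (Subgroup.eq_top_iff' X).2 fun σ => ?_
      obtain ⟨c, hc, hcσ⟩ := hC σ
      have h1 : c⁻¹ * σ ∈ X := hZ _ (by
        rw [AlgEquiv.mul_apply, ← hcσ, ← AlgEquiv.mul_apply, inv_mul_cancel, AlgEquiv.one_apply])
      have := mul_mem (hX (Subgroup.mem_sup_right hc)) h1
      rwa [mul_inv_cancel_left] at this
    rw [this, Subgroup.index_top] at hXp
    exact hp.one_lt.ne hXp
  calc Nat.card Gal(M/ℚ) = Nat.card (J ⊔ C : Subgroup Gal(M/ℚ)) := by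
        rw [hJC, Subgroup.card_top]
    _ ≤ Nat.card J * Nat.card C := Subgroup.card_sup_le_mul J C
    _ ≤ s.totient * (p ^ (m + 3)).totient := Nat.mul_le_mul hJcard hCcard
    _ = (p ^ (m + 3) * s).totient := by rw [Nat.totient_mul hcop, mul_comm]

end PrimeOrder

/-! ### Composita of abelian extensions and splitting by exponent -/

theorem IntermediateField.eq_one_of_le_adjoin {F Ω : Type*} [Field F] [Field Ω] [Algebra F Ω]
    {N : IntermediateField F Ω} (σ : Gal(N/F)) (s : Set Ω) (hN : N ≤ adjoin F s)
    (h : ∀ y ∈ s, ∃ x : N, σ x = x ∧ (x : Ω) = y) : σ = 1 := by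
  let T : IntermediateField F Ω := (fixedField (Subgroup.zpowers σ)).map N.val
  have hT : adjoin F s ≤ T := adjoin_le_iff.2 fun y hy => by
    obtain ⟨x, hx, rfl⟩ := h y hy
    refine (mem_map _).2 ⟨x, ?_, rfl⟩
    rw [mem_fixedField_iff]
    intro f hf
    have : Subgroup.zpowers σ ≤ MulAction.stabilizer Gal(N/F) x := by
      rw [Subgroup.zpowers_le]; exact hx
    exact this hf
  ext x
  obtain ⟨y, hy, hyx⟩ := (mem_map _).1 (hT (hN x.2))
  obtain rfl : y = x := Subtype.ext hyx
  rw [(mem_fixedField_iff _ _).1 hy σ (Subgroup.mem_zpowers σ), AlgEquiv.one_apply]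

/-- A commutator restricts to the identity on each abelian member of the family, and these members
generate the compositum. -/
theorem IntermediateField.isAbelianGalois_sSup {F Ω : Type*} [Field F] [Field Ω] [Algebra F Ω]
    (S : Set (IntermediateField F Ω)) (hS : ∀ E ∈ S, IsAbelianGalois F E) :
    IsAbelianGalois F (sSup S : IntermediateField F Ω) := by
  have h1 : ∀ i : S, Normal F (i : IntermediateField F Ω) := fun i =>
    have := hS i i.2
    inferInstance
  have h2 : ∀ i : S, Algebra.IsSeparable F (i : IntermediateField F Ω) := fun i =>
    have := hS i i.2
    inferInstance
  have h3 : Normal F (sSup S : IntermediateField F Ω) := by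
    rw [sSup_eq_iSup']; infer_instance
  have h4 : Algebra.IsSeparable F (sSup S : IntermediateField F Ω) := by
    rw [sSup_eq_iSup']; infer_instance
  have : IsGalois F (sSup S : IntermediateField F Ω) := ⟨⟩
  refine { is_comm.comm := fun σ τ => ?_ }
  rw [← mul_inv_eq_one]
  refine eq_one_of_le_adjoin _ _ (sSup_def S).le ?_
  rintro y ⟨_, ⟨E, hE, rfl⟩, hy⟩
  refine ⟨⟨y, le_sSup hE hy⟩, ?_, rfl⟩
  have := hS E hE
  let _ : Algebra E (sSup S : IntermediateField F Ω) := (inclusion (le_sSup hE)).toAlgebra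
  have : IsScalarTower F E (sSup S : IntermediateField F Ω) :=
    IsScalarTower.of_algebraMap_eq fun x => rfl
  let R : Gal((sSup S : IntermediateField F Ω)/F) →* Gal(E/F) := AlgEquiv.restrictNormalHom E
  have hR : R (σ * τ * (τ * σ)⁻¹) = 1 := by
    rw [map_mul, map_inv, mul_inv_eq_one, map_mul, map_mul, mul_comm']
  have h5 := AlgEquiv.restrictNormal_commutes (σ * τ * (τ * σ)⁻¹) E ⟨y, hy⟩
  have h6 : (σ * τ * (τ * σ)⁻¹).restrictNormal E = 1 := hR
  rw [h6] at h5
  exact h5.symm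

theorem IntermediateField.isAbelianGalois_sup {F Ω : Type*} [Field F] [Field Ω] [Algebra F Ω]
    (E₁ E₂ : IntermediateField F Ω) [IsAbelianGalois F E₁] [IsAbelianGalois F E₂] :
    IsAbelianGalois F (E₁ ⊔ E₂ : IntermediateField F Ω) := by
  rw [← sSup_pair]
  exact isAbelianGalois_sSup _ (by rintro E (rfl | rfl) <;> infer_instance)

theorem IsPrimitiveRoot.isCyclotomicExtension_adjoin_simple (K : Type*) {L : Type*} [Field K]
    [Field L] [Algebra K L] {n : ℕ} [NeZero n] {ζ : L} (hζ : IsPrimitiveRoot ζ n) :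
    IsCyclotomicExtension {n} K (IntermediateField.adjoin K {ζ}) := by
  change IsCyclotomicExtension {n} K (IntermediateField.adjoin K {ζ}).toSubalgebra
  rw [IntermediateField.adjoin_simple_toSubalgebra_of_isAlgebraic
    (hζ.isIntegral (NeZero.pos n)).tower_top.isAlgebraic]
  exact hζ.adjoin_isCyclotomicExtension K

theorem IsPrimitiveRoot.nonempty_adjoin_simple_ringHom (K : Type*) {L : Type*} [Field K]
    [CharZero K] [Field L] [Algebra K L] {n : ℕ} [NeZero n] {ζ : L} (hζ : IsPrimitiveRoot ζ n) :
    Nonempty (IntermediateField.adjoin K {ζ} →+* CyclotomicField n K) := by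
  have : NeZero (n : K) := ⟨Nat.cast_ne_zero.2 (NeZero.ne n)⟩
  have := hζ.isCyclotomicExtension_adjoin_simple K
  exact ⟨(IsCyclotomicExtension.algEquiv {n} K (IntermediateField.adjoin K {ζ})
    (CyclotomicField n K)).toRingEquiv.toRingHom⟩

open scoped IsMulCommutative in
theorem IntermediateField.exists_fixedField_pow (F E : Type*) [Field F] [Field E] [Algebra F E]
    [FiniteDimensional F E] [IsAbelianGalois F E] (c : ℕ) :
    ∃ F' : IntermediateField F E, (∀ τ : Gal(F'/F), τ ^ c = 1) ∧
      ∀ σ ∈ F'.fixingSubgroup, ∃ τ : Gal(E/F), τ ^ c = σ := by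
  let H : Subgroup Gal(E/F) := (powMonoidHom c).range
  refine ⟨fixedField H, fun τ => ?_, fun σ hσ => ?_⟩
  · obtain ⟨σ, rfl⟩ := AlgEquiv.restrictNormalHom_surjective (F := F) (E := E)
      (K₁ := fixedField H) τ
    rw [← map_pow]
    ext x
    have h1 := AlgEquiv.restrictNormal_commutes (σ ^ c) (fixedField H) x
    rw [AlgEquiv.one_apply]
    refine h1.trans ?_
    exact (mem_fixedField_iff _ _).1 x.2 _ ⟨σ, rfl⟩
  · rw [fixingSubgroup_fixedField] at hσ
    exact hσ

/-- The two fields are fixed by the `a`-th and by the `b`-th powers. An element that is both has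
order dividing `b` and `a`, so only the identity fixes the compositum. -/
theorem IntermediateField.exists_sup_eq_top_of_exponent_mul (F E : Type*) [Field F] [Field E]
    [Algebra F E] [FiniteDimensional F E] [IsAbelianGalois F E] {a b : ℕ} (hab : a.Coprime b)
    (hE : ∀ τ : Gal(E/F), τ ^ (a * b) = 1) :
    ∃ F₁ F₂ : IntermediateField F E, (∀ τ : Gal(F₁/F), τ ^ a = 1) ∧
      (∀ τ : Gal(F₂/F), τ ^ b = 1) ∧ F₁ ⊔ F₂ = ⊤ := by
  obtain ⟨F₁, h1, h1'⟩ := exists_fixedField_pow F E a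
  obtain ⟨F₂, h2, h2'⟩ := exists_fixedField_pow F E b
  refine ⟨F₁, F₂, h1, h2, ?_⟩
  rw [← IsGalois.fixedField_fixingSubgroup (F₁ ⊔ F₂), fixingSubgroup_sup]
  convert fixedField_bot
  rw [eq_bot_iff]
  rintro σ ⟨hσ1, hσ2⟩
  obtain ⟨τ, rfl⟩ := h1' σ hσ1
  obtain ⟨ρ, hρ⟩ := h2' _ hσ2
  have e1 : orderOf (τ ^ a) ∣ b := orderOf_dvd_of_pow_eq_one (by rw [← pow_mul, hE])
  have e2 : orderOf (τ ^ a) ∣ a :=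
    orderOf_dvd_of_pow_eq_one (by rw [← hρ, ← pow_mul, mul_comm, hE])
  exact orderOf_eq_one_iff.1 (Nat.eq_one_of_dvd_coprimes hab e2 e1)

/-! ### The Kronecker-Weber theorem -/

namespace KroneckerWeber

open IntermediateField

/-- A form with arbitrary `ℚ`-algebra instances, as they arise for intermediate fields; such
structures are unique, so the previous bound transfers. -/
theorem card_gal_le_totient {M : Type*} [Field M] [CharZero M] [Algebra ℚ M]
    [FiniteDimensional ℚ M] [IsAbelianGalois ℚ M] {p : ℕ} (hp : p.Prime) {m : ℕ} {S : Finset ℕ}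
    (hS : ∀ l ∈ S, l.Prime ∧ l ≠ p) {ζ : M}
    (hζ : IsPrimitiveRoot ζ (p ^ (m + 3) * ∏ l ∈ S, l))
    (hconj : p = 2 → ∃ c : Gal(M/ℚ), c * c = 1 ∧ c ζ = ζ⁻¹)
    (E : Type*) [Field E] [NumberField E] [Algebra ℚ E] [IsGalois ℚ E] [Algebra E M]
    [IsScalarTower ℚ E M] (hE : ∀ τ : Gal(E/ℚ), τ ^ p ^ m = 1)
    (hram : ∀ l : ℕ, l.Prime → l ≠ p → (l : ℤ) ∣ NumberField.discr E → l ∈ S)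
    (hgen : ∀ σ : Gal(M/ℚ), σ.restrictNormal E = 1 → σ ζ = ζ → σ = 1) :
    Nat.card Gal(M/ℚ) ≤ (p ^ (m + 3) * ∏ l ∈ S, l).totient := by
  obtain rfl : ‹Algebra ℚ M› = DivisionRing.toRatAlgebra := Subsingleton.elim _ _
  obtain rfl : ‹Algebra ℚ E› = DivisionRing.toRatAlgebra := Subsingleton.elim _ _
  have : NumberField M := ⟨⟩
  exact PrimeOrder.card_gal_le_totient hp hS hζ hconj E hE hram hgen

/-- The conductor found is `p ^ (m + 3)` times the product of the ramified primes other than `p`.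
Working inside `ℂ` provides the complex conjugation needed for `p = 2`. -/
theorem exists_fieldRange_le_of_prime_pow {p : ℕ} (hp : p.Prime) (m : ℕ) (E : Type*) [Field E]
    [CharZero E] [Algebra ℚ E] [FiniteDimensional ℚ E] [IsAbelianGalois ℚ E] (hE : ∀ τ : Gal(E/ℚ), τ ^ p ^ m = 1) (f : E →ₐ[ℚ] ℂ) :
    ∃ n : ℕ, 0 < n ∧ ∀ ζ : ℂ, IsPrimitiveRoot ζ n → f.fieldRange ≤ ℚ⟮ζ⟯ := by
  classical
  have : NumberField E := by
    obtain rfl : ‹Algebra ℚ E› = DivisionRing.toRatAlgebra := Subsingleton.elim _ _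
    exact ⟨⟩
  let S : Finset ℕ := (NumberField.discr E).natAbs.primeFactors.erase p
  have hS : ∀ l ∈ S, l.Prime ∧ l ≠ p := fun l hl =>
    ⟨Nat.prime_of_mem_primeFactors (Finset.mem_of_mem_erase hl), Finset.ne_of_mem_erase hl⟩
  have hn : 0 < p ^ (m + 3) * ∏ l ∈ S, l :=
    Nat.mul_pos (pow_pos hp.pos _) (Finset.prod_pos fun l hl => (hS l hl).1.pos)
  generalize hnn : p ^ (m + 3) * ∏ l ∈ S, l = n at hn
  refine ⟨n, hn, fun ζ hζ => ?_⟩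
  have : NeZero n := ⟨hn.ne'⟩
  let _ : Algebra ℚ ℚ⟮ζ⟯ := ℚ⟮ζ⟯.algebra'
  have hcyc : IsCyclotomicExtension {n} ℚ ℚ⟮ζ⟯ := hζ.isCyclotomicExtension_adjoin_simple ℚ
  have : IsAbelianGalois ℚ ℚ⟮ζ⟯ := IsCyclotomicExtension.isAbelianGalois {n} ℚ _
  have : FiniteDimensional ℚ ℚ⟮ζ⟯ := IsCyclotomicExtension.finiteDimensional {n} ℚ _
  let _ : Algebra ℚ f.fieldRange := f.fieldRange.algebra'
  have : IsAbelianGalois ℚ f.fieldRange :=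
    .of_algHom (AlgHom.equivFieldRange f).symm.toAlgHom
  have : FiniteDimensional ℚ f.fieldRange :=
    (AlgHom.equivFieldRange f).toLinearEquiv.finiteDimensional
  let M : IntermediateField ℚ ℂ := f.fieldRange ⊔ ℚ⟮ζ⟯
  let _ : Algebra ℚ M := M.algebra'
  have : IsAbelianGalois ℚ M := isAbelianGalois_sup _ _
  have : FiniteDimensional ℚ M := finiteDimensional_sup _ _
  have hfM : ∀ x, f x ∈ M := fun x => (le_sup_left : f.fieldRange ≤ M) ⟨x, rfl⟩
  have hζM : ζ ∈ M := (le_sup_right : ℚ⟮ζ⟯ ≤ M) (mem_adjoin_simple_self ℚ ζ)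
  let _ : Algebra E M := (f.toRingHom.codRestrict M.toSubfield hfM).toAlgebra
  have : IsScalarTower ℚ E M := IsScalarTower.of_algebraMap_eq fun x => Subtype.ext (f.commutes x).symm
  have hz : IsPrimitiveRoot (⟨ζ, hζM⟩ : M) n :=
    IsPrimitiveRoot.of_map_of_injective (f := M.val) hζ M.val.injective
  have hcard : Nat.card Gal(M/ℚ) ≤ n.totient := by
    rw [← hnn] at hz ⊢
    refine card_gal_le_totient hp hS hz (fun _ => ?_) E hE (fun l hl hlp hld => ?_)
      fun σ hσ hσζ => ?_
    · let R : Gal(ℂ/ℚ) →* Gal(M/ℚ) := AlgEquiv.restrictNormalHom M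
      let c : Gal(ℂ/ℚ) := Complex.conjAe.restrictScalars ℚ
      refine ⟨R c, ?_, ?_⟩
      · rw [← map_mul, ← map_one R]
        congr 1
        ext x
        exact Complex.conj_conj x
      · apply M.val.injective
        have h1 : ((R c ⟨ζ, hζM⟩ : M) : ℂ) = c ζ := AlgEquiv.restrictNormal_commutes c M ⟨ζ, hζM⟩
        have h2 : c ζ = ζ⁻¹ := (Complex.inv_eq_conj (hζ.norm'_eq_one hn.ne')).symm
        exact h1.trans h2
    · refine Finset.mem_erase.2 ⟨hlp, Nat.mem_primeFactors.2 ⟨hl, ?_, ?_⟩⟩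
      · exact Int.natCast_dvd.1 hld
      · exact Int.natAbs_ne_zero.2 (NumberField.discr_ne_zero E)
    · refine eq_one_of_le_adjoin σ (Set.range f ∪ {ζ}) (sup_le ?_ ?_) ?_
      · rintro _ ⟨x, rfl⟩
        exact subset_adjoin _ _ (Or.inl ⟨x, rfl⟩)
      · exact adjoin.mono _ _ _ (by simp)
      · rintro y (⟨x, rfl⟩ | rfl)
        · refine ⟨algebraMap E M x, ?_, rfl⟩
          have h1 := AlgEquiv.restrictNormal_commutes σ E x
          rw [hσ] at h1
          exact h1.symm
        · exact ⟨_, hσζ, rfl⟩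
  -- The compositum contains `ℚ(ζ)` and has at most its degree, so the two coincide.
  rw [IsGalois.card_aut_eq_finrank, 
    ← IsCyclotomicExtension.finrank ℚ⟮ζ⟯ (Polynomial.cyclotomic.irreducible_rat hn)] at hcard
  rw [eq_of_le_of_finrank_le (le_sup_right : ℚ⟮ζ⟯ ≤ M) hcard]
  exact le_sup_left

/-- Induction over coprime factorizations of the exponent: the field is a compositum of two fields
of coprime exponents, contained in `ℚ(ζ_{n₁})` and `ℚ(ζ_{n₂})`, hence in `ℚ(ζ_{n₁ n₂})`. -/
theorem exists_fieldRange_le_of_exponent (d : ℕ) : 0 < d → ∀ (E : Type*) [Field E]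
    [CharZero E] [Algebra ℚ E] [FiniteDimensional ℚ E] [IsAbelianGalois ℚ E], (∀ τ : Gal(E/ℚ), τ ^ d = 1) → ∀ f : E →ₐ[ℚ] ℂ,
    ∃ n : ℕ, 0 < n ∧ ∀ ζ : ℂ, IsPrimitiveRoot ζ n → f.fieldRange ≤ ℚ⟮ζ⟯ := by
  induction d using Nat.recOnPosPrimePosCoprime with
  | zero => exact fun h => absurd h (lt_irrefl 0)
  | prime_pow p m hp _ => exact fun _ E _ _ _ _ _ hE f => exists_fieldRange_le_of_prime_pow hp m E hE f
  | one =>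
    intro _ E _ _ _ _ _ hE f
    exact exists_fieldRange_le_of_prime_pow Nat.prime_two 0 E (by simpa using hE) f
  | coprime a b ha hb hab iha ihb =>
    intro _ E _ _ _ _ _ hE f
    obtain ⟨F₁, F₂, h1, h2, hsup⟩ := exists_sup_eq_top_of_exponent_mul ℚ E hab hE
    let _ : Algebra ℚ F₁ := F₁.algebra'
    let _ : Algebra ℚ F₂ := F₂.algebra'
    obtain ⟨n₁, hn₁, hF₁⟩ := iha (by omega) F₁ h1 (f.comp F₁.val)
    obtain ⟨n₂, hn₂, hF₂⟩ := ihb (by omega) F₂ h2 (f.comp F₂.val)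
    refine ⟨n₁ * n₂, Nat.mul_pos hn₁ hn₂, fun ζ hζ => ?_⟩
    have hpow : ∀ j : ℕ, ℚ⟮ζ ^ j⟯ ≤ ℚ⟮ζ⟯ := fun j =>
      adjoin_simple_le_iff.2 (pow_mem (mem_adjoin_simple_self ℚ ζ) j)
    have e1 := (hF₁ _ (hζ.pow (Nat.mul_pos hn₁ hn₂) (mul_comm n₁ n₂))).trans (hpow n₂)
    have e2 := (hF₂ _ (hζ.pow (Nat.mul_pos hn₁ hn₂) rfl)).trans (hpow n₁)
    rw [AlgHom.fieldRange_eq_map, ← hsup, IntermediateField.map_sup]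
    refine sup_le ?_ ?_
    · rwa [← AlgHom.map_fieldRange, fieldRange_val] at e1
    · rwa [← AlgHom.map_fieldRange, fieldRange_val] at e2

/-- The **Kronecker-Weber theorem**. -/
theorem exists_nonempty_ringHom_cyclotomicField (E : Type*) [Field E] [NumberField E]
    [IsAbelianGalois ℚ E] : ∃ n : ℕ, 0 < n ∧ Nonempty (E →+* CyclotomicField n ℚ) := by
  obtain ⟨n, hn, h⟩ := exists_fieldRange_le_of_exponent (Nat.card Gal(E/ℚ)) Nat.card_pos E
    (fun τ => pow_card_eq_one') (IsAlgClosed.lift (R := ℚ) (S := E) (M := ℂ))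
  have : NeZero n := ⟨hn.ne'⟩
  have hζ := Complex.isPrimitiveRoot_exp n hn.ne'
  obtain ⟨e⟩ := hζ.nonempty_adjoin_simple_ringHom ℚ
  exact ⟨n, hn, ⟨e.comp ((inclusion (h _ hζ)).toRingHom.comp
    (IsAlgClosed.lift (R := ℚ) (S := E) (M := ℂ)).rangeRestrict.toRingHom)⟩⟩

end KroneckerWeber

/-! ### Cyclotomic subfields and the cyclotomic character of `K` -/

/-- The subfield of `Ω` generated over `k` by the `n`-th roots of unity. -/
def IntermediateField.cyclotomic (k Ω : Type*) [Field k] [Field Ω] [Algebra k Ω] (n : ℕ) :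
    IntermediateField k Ω :=
  adjoin k {b : Ω | b ^ n = 1}

namespace IntermediateField

section

variable (k : Type*) {Ω : Type*} [Field k] [Field Ω] [Algebra k Ω]

theorem mem_cyclotomic {n : ℕ} {b : Ω} (hb : b ^ n = 1) : b ∈ cyclotomic k Ω n :=
  subset_adjoin _ _ hb

variable (Ω) in
theorem cyclotomic_mono {m n : ℕ} (h : m ∣ n) : cyclotomic k Ω m ≤ cyclotomic k Ω n :=
  adjoin.mono _ _ _ fun b (hb : b ^ m = 1) => by
    obtain ⟨c, rfl⟩ := h
    rw [Set.mem_ofPred_eq, pow_mul, hb, one_pow]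

theorem cyclotomic_eq_adjoin {n : ℕ} [NeZero n] {ζ : Ω} (hζ : IsPrimitiveRoot ζ n) :
    cyclotomic k Ω n = adjoin k {ζ} := by
  refine le_antisymm (adjoin_le_iff.2 fun b hb => ?_) (adjoin_simple_le_iff.2 ?_)
  · obtain ⟨i, -, rfl⟩ := hζ.eq_pow_of_pow_eq_one hb
    exact pow_mem (mem_adjoin_simple_self k ζ) i
  · exact mem_cyclotomic k hζ.pow_eq_one

theorem cyclotomic_le_of_mem {n : ℕ} [NeZero n] {ζ : Ω} (hζ : IsPrimitiveRoot ζ n)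
    {F : IntermediateField k Ω} (h : ζ ∈ F) : cyclotomic k Ω n ≤ F := by
  rw [cyclotomic_eq_adjoin k hζ]
  exact adjoin_simple_le_iff.2 h

theorem exists_isPrimitiveRoot (Ω : Type*) [Field Ω] [CharZero Ω] [IsAlgClosed Ω] (n : ℕ)
    [NeZero n] : ∃ ζ : Ω, IsPrimitiveRoot ζ n := by
  have : NeZero (n : Ω) := ⟨Nat.cast_ne_zero.2 (NeZero.ne n)⟩
  exact HasEnoughRootsOfUnity.exists_primitiveRoot Ω n

variable [CharZero Ω] [IsAlgClosed Ω]

variable (Ω) in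
theorem isCyclotomicExtension_cyclotomic (n : ℕ) [NeZero n] :
    IsCyclotomicExtension {n} k (cyclotomic k Ω n) := by
  obtain ⟨ζ, hζ⟩ := exists_isPrimitiveRoot Ω n
  rw [cyclotomic_eq_adjoin k hζ]
  exact hζ.isCyclotomicExtension_adjoin_simple k

variable (Ω) in
theorem nonempty_algEquiv_cyclotomic [CharZero k] (n : ℕ) [NeZero n] :
    Nonempty (CyclotomicField n k ≃ₐ[k] cyclotomic k Ω n) := by
  have : NeZero (n : k) := ⟨Nat.cast_ne_zero.2 (NeZero.ne n)⟩
  have := isCyclotomicExtension_cyclotomic k Ω n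
  exact ⟨IsCyclotomicExtension.algEquiv {n} k _ _⟩

theorem exists_pow_eq_algebraMap_iff [CharZero k] {n : ℕ} [NeZero n] (m : ℕ) (x : k) :
    (∃ y : CyclotomicField n k, y ^ m = algebraMap k _ x) ↔
      ∃ y ∈ cyclotomic k Ω n, y ^ m = algebraMap k Ω x := by
  obtain ⟨e⟩ := nonempty_algEquiv_cyclotomic k Ω n
  constructor
  · rintro ⟨y, hy⟩
    refine ⟨e y, (e y).2, ?_⟩
    rw [← SubmonoidClass.coe_pow, ← map_pow, hy, e.commutes]
    rfl
  · rintro ⟨y, hy, h⟩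
    refine ⟨e.symm ⟨y, hy⟩, ?_⟩
    rw [← map_pow, ← e.symm.commutes]
    congr 1
    exact Subtype.ext h

theorem exists_forall_apply_eq_pow (n : ℕ) [NeZero n] (σ : Gal(Ω/k)) :
    ∃ c : ℕ, c.Coprime n ∧ ∀ b : Ω, b ^ n = 1 → σ b = b ^ c := by
  obtain ⟨ζ, hζ⟩ := exists_isPrimitiveRoot Ω n
  obtain ⟨c, hc, hσ⟩ := exists_pow_eq_of_primitiveRoot (NeZero.pos n) hζ σ
  refine ⟨c, hc, fun b hb => ?_⟩
  obtain ⟨i, -, rfl⟩ := hζ.eq_pow_of_pow_eq_one hb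
  rw [map_pow, hσ, ← pow_mul, ← pow_mul, mul_comm]

omit [CharZero Ω] [IsAlgClosed Ω] in
theorem apply_eq_apply_of_mem_cyclotomic {n : ℕ} {σ τ : Gal(Ω/k)}
    (h : ∀ b : Ω, b ^ n = 1 → σ b = τ b) {y : Ω} (hy : y ∈ cyclotomic k Ω n) : σ y = τ y := by
  have : (σ : Ω →ₐ[k] Ω).comp (cyclotomic k Ω n).val =
      (τ : Ω →ₐ[k] Ω).comp (cyclotomic k Ω n).val :=
    algHom_ext_of_eq_adjoin k (hS := rfl) fun x hx => h x hx
  exact DFunLike.congr_fun this ⟨y, hy⟩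

theorem apply_apply_comm_of_mem_cyclotomic {n : ℕ} [NeZero n] (σ τ : Gal(Ω/k)) {y : Ω}
    (hy : y ∈ cyclotomic k Ω n) : σ (τ y) = τ (σ y) := by
  obtain ⟨c, -, hc⟩ := exists_forall_apply_eq_pow k (Ω := Ω) n σ
  obtain ⟨d, -, hd⟩ := exists_forall_apply_eq_pow k (Ω := Ω) n τ
  have h : ∀ b : Ω, b ^ n = 1 → (σ * τ) b = (τ * σ) b := fun b hb => by
    rw [AlgEquiv.mul_apply, AlgEquiv.mul_apply, hc b hb, hd b hb, map_pow, map_pow, hc b hb,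
      hd b hb, ← pow_mul, ← pow_mul, mul_comm]
  exact apply_eq_apply_of_mem_cyclotomic k h hy

end

section

variable {k K Ω : Type*} [Field k] [Field K] [Field Ω] [Algebra k K] [Algebra K Ω] [Algebra k Ω]
  [IsScalarTower k K Ω] [CharZero K] [CharZero Ω] [IsAlgClosed Ω]

/-- The intersection of `K` with `k(ζ_n)` is a subextension of an abelian extension, so it is
abelian and lies in `L`. -/
theorem mem_of_algebraMap_mem_cyclotomic {L : IntermediateField k K}
    (hL : ∀ E : IntermediateField k K, IsAbelianGalois k E → E ≤ L) {n : ℕ} [NeZero n] {x : K}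
    (hx : algebraMap K Ω x ∈ cyclotomic k Ω n) : x ∈ L := by
  have := isCyclotomicExtension_cyclotomic k Ω n
  have : IsAbelianGalois k (cyclotomic k Ω n) := IsCyclotomicExtension.isAbelianGalois {n} k _
  let i : K →ₐ[k] Ω := IsScalarTower.toAlgHom k K Ω
  let E : IntermediateField k K := (cyclotomic k Ω n).comap i
  have hE : IsAbelianGalois k E := .of_algHom (M := cyclotomic k Ω n)
    { toFun := fun y => ⟨i (y : K), y.2⟩
      map_one' := Subtype.ext (map_one i)
      map_mul' := fun a b => Subtype.ext (map_mul i (a : K) b)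
      map_zero' := Subtype.ext (map_zero i)
      map_add' := fun a b => Subtype.ext (map_add i (a : K) b)
      commutes' := fun r => Subtype.ext (i.commutes r) }
  exact hL E hE hx

open Polynomial in
omit [CharZero K] [CharZero Ω] [IsAlgClosed Ω] [Algebra k K] [IsScalarTower k K Ω] in
theorem aeval_algHom_eq_zero {F : IntermediateField k Ω} (φ : F →ₐ[k] Ω) (z : F) {p : K[X]}
    (hF : ∀ i, algebraMap K Ω (p.coeff i) ∈ F) (hφ : ∀ i, φ ⟨_, hF i⟩ = algebraMap K Ω (p.coeff i))
    (hz : aeval (z : Ω) p = 0) : aeval (φ z) p = 0 := by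
  have h1 : (∑ i ∈ Finset.range (p.natDegree + 1), ⟨_, hF i⟩ * z ^ i : F) = 0 := by
    apply F.val.injective
    rw [map_sum, map_zero, ← hz, aeval_eq_sum_range]
    refine Finset.sum_congr rfl fun i _ => ?_
    rw [Algebra.smul_def, map_mul, map_pow]
    rfl
  rw [aeval_eq_sum_range, ← map_zero φ, ← h1, map_sum]
  refine Finset.sum_congr rfl fun i _ => ?_
  rw [Algebra.smul_def, map_mul, map_pow, hφ]

-- The conjugates of `ζ` over `K` are roots of `X ^ M - 1`, and the coefficients are polynomials in
-- them.
open Polynomial in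
omit [CharZero K] [CharZero Ω] [Algebra k K] [IsScalarTower k K Ω] in
theorem coeff_minpoly_mem_cyclotomic {M : ℕ} [NeZero M] {ζ : Ω} (hζ : IsPrimitiveRoot ζ M) (i : ℕ) :
    algebraMap K Ω ((minpoly K ζ).coeff i) ∈ cyclotomic k Ω M := by
  have hζK : IsIntegral K ζ := (hζ.isIntegral (NeZero.pos M)).tower_top
  have hmonic := (minpoly.monic hζK).map (algebraMap K Ω)
  have h : (minpoly K ζ).map (algebraMap K Ω) ∈
      lifts (algebraMap (cyclotomic k Ω M) Ω) := by
    refine (IsAlgClosed.splits _).mem_lift_of_roots_mem_range hmonic _ fun a ha => ?_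
    have h1 : minpoly K ζ ∣ X ^ M - 1 := minpoly.dvd K ζ (by simp [hζ.pow_eq_one])
    have h3 : IsRoot _ a := (mem_roots hmonic.ne_zero).1 ha
    have h4 := h3.dvd (Polynomial.map_dvd (algebraMap K Ω) h1)
    exact ⟨⟨a, mem_cyclotomic k (by simpa [sub_eq_zero] using h4)⟩, rfl⟩
  obtain ⟨y, hy⟩ := (lifts_iff_coeff_lifts _).1 h i
  rw [← coeff_map, ← hy]
  exact y.2

-- Irreducibility of the cyclotomic polynomial gives `φ : ζ ↦ ζ ^ c` over `k`, and `φ` fixes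
-- `k(ζ_f)` because `c ≡ 1` modulo `f`. The minimal polynomial of `ζ` over `K` has coefficients in
-- `K ∩ k(ζ_M) ⊆ L ⊆ k(ζ_f)`, so `ζ ^ c` is another root of it.
open Polynomial in
theorem exists_gal_apply_eq_pow {L : IntermediateField k K}
    (hL : ∀ E : IntermediateField k K, IsAbelianGalois k E → E ≤ L) [Normal K Ω] {f M c : ℕ}
    [NeZero M] (hirr : Irreducible (Polynomial.cyclotomic M k))
    (hLf : ∀ x ∈ L, algebraMap K Ω x ∈ cyclotomic k Ω f) (hfM : f ∣ M) (hc : c ≡ 1 [MOD f])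
    (hcM : c.Coprime M) : ∃ σ : Gal(Ω/K), ∀ b : Ω, b ^ M = 1 → σ b = b ^ c := by
  obtain ⟨ζ, hζ⟩ := exists_isPrimitiveRoot Ω M
  have hM : 0 < M := NeZero.pos M
  have hζi : IsIntegral k ζ := (hζ.isIntegral hM).tower_top
  have hζK : IsIntegral K ζ := hζi.tower_top
  have hmin : minpoly k ζ = Polynomial.cyclotomic M k := by
    refine (minpoly.eq_of_irreducible_of_monic hirr ?_ (cyclotomic.monic M k)).symm
    rw [aeval_def, eval₂_eq_eval_map, map_cyclotomic]
    exact hζ.isRoot_cyclotomic hM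
  have hroot : ζ ^ c ∈ (minpoly k ζ).aroots Ω := by
    rw [hmin, mem_aroots]
    refine ⟨cyclotomic_ne_zero M k, ?_⟩
    rw [aeval_def, eval₂_eq_eval_map, map_cyclotomic]
    exact (hζ.pow_of_coprime c hcM).isRoot_cyclotomic hM
  obtain ⟨φ, hφ⟩ : ∃ φ : adjoin k {ζ} →ₐ[k] Ω, φ (AdjoinSimple.gen k ζ) = ζ ^ c :=
    ⟨(algHomAdjoinIntegralEquiv k hζi).symm ⟨_, hroot⟩,
      algHomAdjoinIntegralEquiv_symm_apply_gen k hζi _⟩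
  have hle : cyclotomic k Ω f ≤ adjoin k {ζ} := by
    rw [← cyclotomic_eq_adjoin k hζ]
    exact cyclotomic_mono k Ω hfM
  have hfix : ∀ (y : Ω) (hy : y ∈ cyclotomic k Ω f), φ ⟨y, hle hy⟩ = y := by
    have : φ.comp (inclusion hle) = (cyclotomic k Ω f).val := by
      refine algHom_ext_of_eq_adjoin k (hS := rfl) fun b hb => ?_
      have hb' : b ^ M = 1 := by
        obtain ⟨d, rfl⟩ := hfM
        rw [pow_mul, show b ^ f = 1 from hb, one_pow]
      obtain ⟨i, -, rfl⟩ := hζ.eq_pow_of_pow_eq_one hb'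
      have h1 : inclusion hle ⟨ζ ^ i, mem_cyclotomic k hb⟩ = AdjoinSimple.gen k ζ ^ i :=
        Subtype.ext rfl
      refine (congrArg φ h1).trans ?_
      rw [map_pow, hφ, ← pow_mul, mul_comm, pow_mul]
      change (ζ ^ i) ^ c = ζ ^ i
      have h2 : (ζ ^ i) ^ c = (ζ ^ i) ^ 1 := pow_eq_pow_of_modEq hc hb
      rw [h2, pow_one]
    exact fun y hy => DFunLike.congr_fun this ⟨y, hy⟩
  have hconj : aeval (ζ ^ c) (minpoly K ζ) = 0 := by
    rw [← hφ]
    have hcoeff := fun i => coeff_minpoly_mem_cyclotomic (k := k) (K := K) hζ i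
    refine aeval_algHom_eq_zero φ (AdjoinSimple.gen k ζ)
      (fun i => hle (hLf _ (mem_of_algebraMap_mem_cyclotomic hL (hcoeff i))))
      (fun i => hfix _ (hLf _ (mem_of_algebraMap_mem_cyclotomic hL (hcoeff i)))) ?_
    exact minpoly.aeval K ζ
  obtain ⟨σ, hσ⟩ := (isConjRoot_iff_exists_algEquiv.1
    (isConjRoot_of_aeval_eq_zero hζK hconj).symm)
  refine ⟨σ, fun b hb => ?_⟩
  obtain ⟨i, -, rfl⟩ := hζ.eq_pow_of_pow_eq_one hb
  rw [map_pow, hσ, ← pow_mul, ← pow_mul, mul_comm]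

end

end IntermediateField

/-! ### Lowering the conductor -/

theorem Nat.pow_one_add_mul_modEq {p m : ℕ} (hpm : p ∣ m) (j i : ℕ) :
    (1 + m * j) ^ i ≡ 1 + m * (i * j) [MOD m * p] := by
  induction i with
  | zero => simp [Nat.ModEq.refl]
  | succ i ih =>
    rw [pow_succ]
    refine (ih.mul_right _).trans ?_
    obtain ⟨d, rfl⟩ := hpm
    have h : (1 + p * d * (i * j)) * (1 + p * d * j) =
        1 + p * d * ((i + 1) * j) + p * d * p * (d * (i * j * j)) := by ring
    rw [h]
    simp [Nat.ModEq]

/-- When `p ∣ m`, the classes `1 + m j` modulo `m p` form a group isomorphic to the integers modulo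
`p`, so any nontrivial class generates it. -/
theorem Nat.exists_pow_one_add_mul_modEq {p m j : ℕ} (hp : p.Prime) (hpm : p ∣ m) (hj : ¬ p ∣ j)
    (j' : ℕ) : ∃ i : ℕ, (1 + m * j) ^ i ≡ 1 + m * j' [MOD m * p] := by
  have : Fact p.Prime := ⟨hp⟩
  have hj0 : (j : ZMod p) ≠ 0 := fun h => hj ((ZMod.natCast_eq_zero_iff _ _).1 h)
  refine ⟨((j' / j : ZMod p)).val, (Nat.pow_one_add_mul_modEq hpm j _).trans ?_⟩
  refine Nat.ModEq.add_left 1 (Nat.ModEq.mul_left' m ?_)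
  rw [← ZMod.natCast_eq_natCast_iff]
  push_cast
  rw [ZMod.natCast_zmod_val, div_mul_cancel₀ _ hj0]

theorem IsPrimitiveRoot.modEq_of_pow_eq {F : Type*} [Field F] {ζ : F} {n : ℕ}
    (hζ : IsPrimitiveRoot ζ n) (hn : n ≠ 0) {a b : ℕ} (h : ζ ^ a = ζ ^ b) : a ≡ b [MOD n] := by
  wlog hab : a ≤ b generalizing a b
  · exact (this h.symm (le_of_not_ge hab)).symm
  rw [Nat.modEq_iff_dvd' hab]
  apply hζ.dvd_of_pow_eq_one
  refine mul_left_cancel₀ (pow_ne_zero a (hζ.ne_zero hn)) ?_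
  rw [← pow_add, Nat.add_sub_cancel' hab, ← h, mul_one]

namespace IntermediateField

variable {k K Ω : Type*} [Field k] [Field K] [Field Ω] [Algebra k K] [Algebra K Ω] [Algebra k Ω]
  [IsScalarTower k K Ω] [CharZero K] [CharZero Ω] [IsAlgClosed Ω]

-- By normality the image of `L` in `Ω` does not depend on the embedding, so an abstract embedding
-- is the same as an inclusion.
omit [CharZero K] in
theorem nonempty_algHom_cyclotomicField_iff [CharZero k] (L : IntermediateField k K) [Normal k L]
    (n : ℕ) [NeZero n] : Nonempty (L →ₐ[k] CyclotomicField n k) ↔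
      ∀ x ∈ L, algebraMap K Ω x ∈ cyclotomic k Ω n := by
  obtain ⟨e⟩ := nonempty_algEquiv_cyclotomic k Ω n
  let i : L →ₐ[k] Ω := (IsScalarTower.toAlgHom k K Ω).comp L.val
  constructor
  · rintro ⟨g⟩ x hx
    let h : L →ₐ[k] Ω := (cyclotomic k Ω n).val.comp ((e : _ →ₐ[k] _).comp g)
    obtain ⟨y, hy⟩ : i ⟨x, hx⟩ ∈ (h : L →+* Ω).range := by
      have hInt : IsIntegral k (⟨x, hx⟩ : L) := Normal.isIntegral ‹_› _
      refine (Normal.splits ‹Normal k L› ⟨x, hx⟩).mem_range_of_isRoot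
        (Polynomial.map_ne_zero (minpoly.ne_zero hInt)) ?_
      rw [Polynomial.map_map, h.comp_algebraMap, Polynomial.IsRoot, Polynomial.eval_map_algebraMap,
        Polynomial.aeval_algHom_apply, minpoly.aeval, map_zero]
    change i ⟨x, hx⟩ ∈ _
    rw [← hy]
    exact (e (g y)).2
  · intro h
    refine ⟨(e.symm : _ →ₐ[k] _).comp
      { toFun := fun y => ⟨i y, h y y.2⟩
        map_one' := Subtype.ext (map_one i)
        map_mul' := fun a b => Subtype.ext (map_mul i a b)
        map_zero' := Subtype.ext (map_zero i)
        map_add' := fun a b => Subtype.ext (map_add i a b)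
        commutes' := fun r => Subtype.ext (i.commutes r) }⟩

omit [CharZero K] [CharZero Ω] [IsAlgClosed Ω] in
theorem exists_apply_ne_of_notMem [IsGalois K Ω] {F : IntermediateField K Ω} {x : Ω} (hx : x ∉ F) :
    ∃ τ : Gal(Ω/K), (∀ y ∈ F, τ y = y) ∧ τ x ≠ x := by
  by_contra! h
  apply hx
  rw [← InfiniteGalois.fixedField_fixingSubgroup F, mem_fixedField_iff]
  exact fun τ hτ => h τ ((mem_fixingSubgroup_iff _ _).1 hτ)

omit [CharZero K] in
/-- If `L ≤ K` is contained in `k(ζ_{mp})` but not in `k(ζ_m)`, where `p ∣ m`, then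
`K(ζ_{mp}) = K(ζ_m)`. -/
theorem cyclotomic_mul_le [IsGalois K Ω] {L : IntermediateField k K} {p m : ℕ} (hp : p.Prime)
    (hpm : p ∣ m) (hm : 0 < m) (hL : ∀ x ∈ L, algebraMap K Ω x ∈ cyclotomic k Ω (m * p))
    (hL' : ¬ ∀ x ∈ L, algebraMap K Ω x ∈ cyclotomic k Ω m) :
    cyclotomic K Ω (m * p) ≤ cyclotomic K Ω m := by
  have : NeZero (m * p) := ⟨Nat.mul_ne_zero hm.ne' hp.ne_zero⟩
  obtain ⟨ζ, hζ⟩ := exists_isPrimitiveRoot Ω (m * p)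
  refine cyclotomic_le_of_mem K hζ ?_
  by_contra hζm
  -- If `ζ ∉ K(ζ_m)`, such a `τ` acts on `ζ` by `1 + m j` with `p ∤ j`. Its powers restrict to all
  -- of `Gal(k(ζ_{mp})/k(ζ_m))`, and since they fix `L`, the field `L` would lie in `k(ζ_m)`.
  obtain ⟨τ, hτ, hτζ⟩ := exists_apply_ne_of_notMem hζm
  have hζp : IsPrimitiveRoot (ζ ^ p) m := hζ.pow (NeZero.pos _) (mul_comm _ _)
  have key : ∀ c : ℕ, c.Coprime (m * p) → (ζ ^ p) ^ c = ζ ^ p → ∃ j, c = 1 + m * j := by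
    intro c hc h
    have h1 : 1 ≡ c [MOD m] := hζp.modEq_of_pow_eq hm.ne' (by rw [h, pow_one])
    have h2 : 1 ≤ c := by
      rcases Nat.eq_zero_or_pos c with rfl | h
      · have h3 := Nat.le_of_dvd one_pos (((Nat.coprime_zero_left _).1 hc) ▸ dvd_mul_left p m)
        exact absurd h3 (not_le.2 hp.one_lt)
      · exact h
    obtain ⟨j, hj⟩ := (Nat.modEq_iff_dvd' h2).1 h1
    exact ⟨j, by omega⟩
  obtain ⟨c, hc, hτc⟩ := exists_forall_apply_eq_pow K (m * p) τ
  obtain ⟨j, rfl⟩ := key c hc (by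
    rw [← pow_mul, mul_comm, pow_mul, ← hτc ζ hζ.pow_eq_one, ← map_pow]
    exact hτ _ (mem_cyclotomic K hζp.pow_eq_one))
  have hj : ¬ p ∣ j := by
    rintro ⟨d, rfl⟩
    apply hτζ
    rw [hτc ζ hζ.pow_eq_one, pow_add, ← mul_assoc, pow_mul _ (m * p), hζ.pow_eq_one, one_pow,
      mul_one, pow_one]
  apply hL'
  intro x hx
  have := isCyclotomicExtension_cyclotomic k Ω (m * p)
  have : IsGalois k (cyclotomic k Ω (m * p)) := IsCyclotomicExtension.isGalois {m * p} k _
  have : FiniteDimensional k (cyclotomic k Ω (m * p)) :=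
    IsCyclotomicExtension.finiteDimensional {m * p} k _
  have hle : cyclotomic k Ω m ≤ cyclotomic k Ω (m * p) := cyclotomic_mono k Ω (dvd_mul_right m p)
  rw [← mem_restrict hle ⟨_, hL x hx⟩, ← IsGalois.fixedField_fixingSubgroup (restrict hle),
    mem_fixedField_iff]
  intro ρ hρ
  rw [mem_fixingSubgroup_iff] at hρ
  let z : cyclotomic k Ω (m * p) := ⟨ζ, mem_cyclotomic k hζ.pow_eq_one⟩
  have hz : IsPrimitiveRoot z (m * p) :=
    IsPrimitiveRoot.of_map_of_injective (f := (cyclotomic k Ω (m * p)).val) hζ (RingHom.injective _)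
  obtain ⟨d, hd, hρd⟩ := exists_pow_eq_of_primitiveRoot (NeZero.pos _) hz ρ
  obtain ⟨j', rfl⟩ := key d hd (by
    have h1 : z ^ p ∈ restrict hle := (mem_restrict hle _).2 (mem_cyclotomic k hζp.pow_eq_one)
    have h2 := hρ _ h1
    rw [map_pow, hρd, ← pow_mul, mul_comm d p, pow_mul] at h2
    exact congrArg Subtype.val h2)
  obtain ⟨i, hi⟩ := Nat.exists_pow_one_add_mul_modEq hp hpm hj j'
  have hτi : (τ ^ i) ζ = ζ ^ (1 + m * j') := by
    rw [pow_apply_of_apply_eq_pow (hτc ζ hζ.pow_eq_one) i]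
    exact pow_eq_pow_of_modEq hi hζ.pow_eq_one
  have heq : (cyclotomic k Ω (m * p)).val.comp (ρ : _ →ₐ[k] _) =
      (((τ ^ i : Gal(Ω/K)) : Ω →ₐ[K] Ω).restrictScalars k).comp (cyclotomic k Ω (m * p)).val := by
    refine algHom_ext_of_eq_adjoin k (hS := cyclotomic_eq_adjoin k hζ) fun b hb => ?_
    obtain rfl : b = ζ := hb
    have h1 := congrArg Subtype.val hρd
    exact h1.trans hτi.symm
  apply Subtype.ext
  have h1 := DFunLike.congr_fun heq ⟨_, hL x hx⟩
  exact h1.trans ((τ ^ i).commutes x)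

end IntermediateField

/-! ### Formal properties of the Chevalley-Bass number; counting roots of unity -/

theorem exists_pow_mul_eq_of_coprime {K : Type*} [Field K] {x u v : K} (hx : x ≠ 0) {a b : ℕ}
    (hab : a.Coprime b) (hu : u ^ a = x) (hv : v ^ b = x) : ∃ w : K, w ^ (a * b) = x := by
  refine ⟨v ^ a.gcdA b * u ^ a.gcdB b, ?_⟩
  have h := Nat.gcd_eq_gcd_ab a b
  rw [hab.gcd_eq_one, Nat.cast_one] at h
  have h1 : (v ^ a.gcdA b) ^ (a * b) = x ^ ((a : ℤ) * a.gcdA b) := by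
    rw [← hv, ← zpow_natCast, ← zpow_natCast, ← zpow_mul, ← zpow_mul]
    congr 1
    push_cast
    ring
  have h2 : (u ^ a.gcdB b) ^ (a * b) = x ^ ((b : ℤ) * a.gcdB b) := by
    rw [← hu, ← zpow_natCast, ← zpow_natCast, ← zpow_mul, ← zpow_mul]
    congr 1
    push_cast
    ring
  rw [mul_pow, h1, h2, ← zpow_add₀ hx, ← h, zpow_one]

theorem exists_pow_eq_of_forall_prime_pow {K : Type*} [Field K] {x : K} (hx : x ≠ 0) {n : ℕ}
    (hn : n ≠ 0) (h : ∀ p : ℕ, p.Prime → ∃ z : K, z ^ p ^ n.factorization p = x) :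
    ∃ z : K, z ^ n = x := by
  induction n using Nat.recOnPosPrimePosCoprime with
  | zero => exact absurd rfl hn
  | prime_pow p k hp _ => simpa [hp.factorization_self] using h p hp
  | one => exact ⟨x, pow_one x⟩
  | coprime a b ha hb hab iha ihb =>
    have key : ∀ c d : ℕ, c.Coprime d → (∀ p : ℕ, p.Prime →
        ∃ z : K, z ^ p ^ (c * d).factorization p = x) →
        ∀ p : ℕ, p.Prime → ∃ z : K, z ^ p ^ c.factorization p = x := by
      intro c d hcd hh p hp
      obtain ⟨z, hz⟩ := hh p hp
      rw [Nat.factorization_mul_of_coprime hcd, Finsupp.add_apply, pow_add, mul_comm, pow_mul] at hz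
      exact ⟨_, hz⟩
    obtain ⟨u, hu⟩ := iha (by omega) (key a b hab h)
    obtain ⟨v, hv⟩ := ihb (by omega) (key b a hab.symm (by rwa [mul_comm]))
    exact exists_pow_mul_eq_of_coprime hx hab hu hv

/-- With `a = g d` and `b = g e`, where `g` is the gcd, a `g n`-th root `y` of `x` is also an `a
n`-th root of `x ^ d` and a `b n`-th root of `x ^ e`. So both are `n`-th powers, and Bézout for `d`,
`e` gives `x`. -/
theorem HasChevalleyBassProperty.gcd {K : Type*} [Field K] [CharZero K] {a b : ℕ} (ha0 : 0 < a)
    (hb0 : 0 < b) (ha : HasChevalleyBassProperty K a) (hb : HasChevalleyBassProperty K b) :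
    HasChevalleyBassProperty K (a.gcd b) := by
  have hg : 0 < a.gcd b := Nat.gcd_pos_of_pos_left b ha0
  intro n hn x hx hy
  have : NeZero (a.gcd b * n) := ⟨(Nat.mul_pos hg hn).ne'⟩
  rw [IntermediateField.exists_pow_eq_algebraMap_iff K (Ω := AlgebraicClosure K)] at hy
  obtain ⟨y, hyc, hy⟩ := hy
  have key : ∀ c d : ℕ, 0 < c → HasChevalleyBassProperty K c → c = a.gcd b * d →
      ∃ z : K, z ^ n = x ^ d := by
    rintro c d hc h rfl
    have : NeZero (a.gcd b * d * n) := ⟨(Nat.mul_pos hc hn).ne'⟩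
    have hdvd : a.gcd b * d * n = a.gcd b * n * d := by ring
    refine h n hn _ (pow_ne_zero d hx)
      ((IntermediateField.exists_pow_eq_algebraMap_iff K (Ω := AlgebraicClosure K) _ _).2
        ⟨y, IntermediateField.cyclotomic_mono K _ (Dvd.intro d hdvd.symm) hyc, ?_⟩)
    rw [hdvd, pow_mul, hy, map_pow]
  obtain ⟨d, hd⟩ := Nat.gcd_dvd_left a b
  obtain ⟨e, he⟩ := Nat.gcd_dvd_right a b
  have hde : d.Coprime e := by
    have h := Nat.coprime_div_gcd_div_gcd hg
    rwa [Nat.div_eq_of_eq_mul_right hg hd, Nat.div_eq_of_eq_mul_right hg he] at h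
  obtain ⟨u, hu⟩ := key a d ha0 ha hd
  obtain ⟨v, hv⟩ := key b e hb0 hb he
  have h := Nat.gcd_eq_gcd_ab d e
  rw [hde.gcd_eq_one, Nat.cast_one] at h
  refine ⟨u ^ d.gcdA e * v ^ d.gcdB e, ?_⟩
  rw [mul_pow, ← zpow_natCast, ← zpow_natCast, zpow_comm, zpow_comm v, zpow_natCast, zpow_natCast,
    hu, hv, ← zpow_natCast, ← zpow_natCast, ← zpow_mul, ← zpow_mul, ← zpow_add₀ hx, ← h, zpow_one]

theorem IsChevalleyBassNumber.dvd {K : Type*} [Field K] [CharZero K] {a b : ℕ}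
    (ha : IsChevalleyBassNumber K a) (hb0 : 0 < b) (hb : HasChevalleyBassProperty K b) : a ∣ b := by
  have h := ha.2 ⟨Nat.gcd_pos_of_pos_left b ha.1.1, HasChevalleyBassProperty.gcd ha.1.1 hb0 ha.1.2 hb⟩
  have h1 := Nat.gcd_le_left b ha.1.1
  rw [le_antisymm h h1]
  exact Nat.gcd_dvd_right a b

theorem exists_isChevalleyBassNumber {K : Type*} [Field K] {a : ℕ} (ha : 0 < a)
    (h : HasChevalleyBassProperty K a) : ∃ b, IsChevalleyBassNumber K b := by
  classical
  have hex : ∃ m, 0 < m ∧ HasChevalleyBassProperty K m := ⟨a, ha, h⟩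
  exact ⟨Nat.find hex, Nat.find_spec hex, fun m hm => Nat.find_min' hex hm⟩

/-- If the orders of the roots of unity are bounded, the order of the group of roots of unity is the
largest one. -/
theorem numRootsOfUnity_pos_and_dvd_iff {K : Type*} [Field K] {N : ℕ} (hN : 0 < N)
    (h : ∀ (n : ℕ) (ζ : K), 0 < n → IsPrimitiveRoot ζ n → n ∣ N) :
    0 < numRootsOfUnity K ∧
      ∀ n : ℕ, 0 < n → ((∃ ζ : K, IsPrimitiveRoot ζ n) ↔ n ∣ numRootsOfUnity K) := by
  have : NeZero N := ⟨hN.ne'⟩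
  have hle : CommGroup.torsion Kˣ ≤ rootsOfUnity N K := by
    intro x hx
    have h1 : 0 < orderOf x := orderOf_pos_iff.2 hx
    have h2 : IsPrimitiveRoot (x : K) (orderOf x) :=
      (IsPrimitiveRoot.coe_units_iff).2 (IsPrimitiveRoot.orderOf x)
    exact orderOf_dvd_iff_pow_eq_one.1 (h _ _ h1 h2)
  have : Finite (CommGroup.torsion Kˣ) := Finite.of_injective _ (Subgroup.inclusion_injective hle)
  have hpos : 0 < numRootsOfUnity K := Nat.card_pos
  refine ⟨hpos, fun n hn => ⟨?_, ?_⟩⟩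
  · rintro ⟨ζ, hζ⟩
    have hu : IsPrimitiveRoot (hζ.isUnit hn.ne').unit n :=
      IsPrimitiveRoot.coe_units_iff.1 (by rwa [IsUnit.unit_spec])
    have h1 : (hζ.isUnit hn.ne').unit ∈ CommGroup.torsion Kˣ := by
      rw [CommGroup.mem_torsion, isOfFinOrder_iff_pow_eq_one]
      exact ⟨n, hn, hu.pow_eq_one⟩
    have h2 := orderOf_dvd_natCard (⟨_, h1⟩ : CommGroup.torsion Kˣ)
    rwa [Subgroup.orderOf_mk, ← hu.eq_orderOf] at h2
  · rintro ⟨d, hd⟩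
    obtain ⟨g, hg⟩ := IsCyclic.exists_generator (α := CommGroup.torsion Kˣ)
    have h1 : orderOf g = numRootsOfUnity K := orderOf_eq_card_of_forall_mem_zpowers hg
    have h2 : IsPrimitiveRoot ((g : Kˣ) : K) (numRootsOfUnity K) := by
      rw [IsPrimitiveRoot.coe_units_iff, ← h1, ← Subgroup.orderOf_coe]
      exact IsPrimitiveRoot.orderOf _
    exact ⟨_, h2.pow hpos (by rw [hd, mul_comm])⟩

/-! ### Lower bounds for the Chevalley-Bass number -/

open IntermediateField

theorem HasChevalleyBassProperty.exists_pow_eq {K Ω : Type*} [Field K] [CharZero K] [Field Ω]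
    [CharZero Ω] [Algebra K Ω] [IsAlgClosed Ω] {Λ n : ℕ} (h : HasChevalleyBassProperty K Λ)
    (hΛ : 0 < Λ) (hn : 0 < n) {x : K} (hx : x ≠ 0) {y : Ω} (hy : y ∈ cyclotomic K Ω (Λ * n))
    (hyx : y ^ (Λ * n) = algebraMap K Ω x) : ∃ z : K, z ^ n = x := by
  have : NeZero (Λ * n) := ⟨(Nat.mul_pos hΛ hn).ne'⟩
  exact h n hn x hx ((exists_pow_eq_algebraMap_iff K (Ω := Ω) _ _).2 ⟨y, hy, hyx⟩)

/-- The image of the cyclotomic character of `K` contains all residue classes which are congruent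
to `1` modulo `f`. -/
def CyclotomicCharacterContains (K Ω : Type*) [Field K] [Field Ω] [Algebra K Ω] (f : ℕ) : Prop :=
  ∀ M c : ℕ, 0 < M → f ∣ M → c ≡ 1 [MOD f] → c.Coprime M →
    ∃ σ : Gal(Ω/K), ∀ b : Ω, b ^ M = 1 → σ b = b ^ c

section

variable {K Ω : Type*} [Field K] [CharZero K] [Field Ω] [CharZero Ω] [Algebra K Ω] [IsAlgClosed Ω]

-- The order of `σ` on `K(ζ_q)` is a multiple of `N`, and by independence of automorphisms its
-- minimal polynomial as a linear map is `X ^ ord - 1`; so `ω` is an eigenvalue.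
omit [CharZero K] in
theorem exists_ne_zero_apply_eq_smul {q N : ℕ} (hq : q.Prime) {σ : Gal(Ω/K)} {c : ℕ}
    (hσ : ∀ b : Ω, b ^ q = 1 → σ b = b ^ c) (hc : ∀ j : ℕ, c ^ j ≡ 1 [MOD q] → N ∣ j) {ω : K}
    (hω : ω ^ N = 1) : ∃ t ∈ cyclotomic K Ω q, t ≠ 0 ∧ σ t = algebraMap K Ω ω * t := by
  have : NeZero q := ⟨hq.ne_zero⟩
  obtain ⟨ζ, hζ⟩ := exists_isPrimitiveRoot Ω q
  have := isCyclotomicExtension_cyclotomic K Ω q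
  have : IsGalois K (cyclotomic K Ω q) := IsCyclotomicExtension.isGalois {q} K _
  have : FiniteDimensional K (cyclotomic K Ω q) := IsCyclotomicExtension.finiteDimensional {q} K _
  let ρ : Gal(cyclotomic K Ω q/K) := σ.restrictNormal (cyclotomic K Ω q)
  have hρ : ∀ y : cyclotomic K Ω q, ((ρ y : cyclotomic K Ω q) : Ω) = σ y :=
    fun y => AlgEquiv.restrictNormal_commutes σ (cyclotomic K Ω q) y
  have hρpow : ∀ (j : ℕ) (y : cyclotomic K Ω q), (((ρ ^ j) y : cyclotomic K Ω q) : Ω) =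
      (σ ^ j) y := by
    intro j
    induction j with
    | zero => simp
    | succ j ih => intro y; rw [pow_succ, pow_succ, AlgEquiv.mul_apply, AlgEquiv.mul_apply, ih, hρ]
  have hN : N ∣ orderOf ρ := by
    apply hc
    have h1 := hρpow (orderOf ρ) ⟨ζ, mem_cyclotomic K hζ.pow_eq_one⟩
    rw [pow_orderOf_eq_one, AlgEquiv.one_apply,
      pow_apply_of_apply_eq_pow (hσ ζ hζ.pow_eq_one)] at h1
    exact hζ.modEq_of_pow_eq hq.ne_zero (h1.symm.trans (pow_one ζ).symm)
  have hev : Module.End.HasEigenvalue (ρ.toLinearMap : Module.End K (cyclotomic K Ω q)) ω := by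
    apply Module.End.hasEigenvalue_of_isRoot
    have h1 : ω ^ orderOf ρ = 1 := by
      obtain ⟨d, hd⟩ := hN
      rw [hd, pow_mul, hω, one_pow]
    simp [minpoly_algEquiv_toLinearMap ρ (isOfFinOrder_of_finite ρ), h1]
  obtain ⟨t, ht⟩ := hev.exists_hasEigenvector
  refine ⟨t, t.2, fun h => ht.2 (Subtype.ext h), ?_⟩
  rw [← hρ, ← Algebra.smul_def]
  exact congrArg Subtype.val ht.apply_eq_smul

/-- For a prime `q ≡ 1` modulo `l` not dividing `f`, the group of `K(ζ_q)/K` is cyclic of order `q -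
1`, and `ω` is the eigenvalue of a Kummer generator `t` with `t ^ l = s ∈ K`. The property applied
to a power of `s` compares `t ^ Λ` with an element of `K` up to a root of unity, and the action of
`σ` then shows `ω ^ (Λ q) = 1`. -/
theorem HasChevalleyBassProperty.dvd_of_isPrimitiveRoot [IsGalois K Ω] {f : ℕ} (hf : 0 < f)
    (hK : CyclotomicCharacterContains K Ω f) {Λ : ℕ} (hΛ : 0 < Λ)
    (h : HasChevalleyBassProperty K Λ) {l : ℕ} (hl : 0 < l) {ω : K} (hω : IsPrimitiveRoot ω l) :
    l ∣ Λ := by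
  obtain ⟨q, hq, hqf, hql⟩ := Nat.exists_prime_gt_modEq_one f hl.ne'
  have : Fact q.Prime := ⟨hq⟩
  have : NeZero q := ⟨hq.ne_zero⟩
  have hfq : f.Coprime q := (Nat.coprime_of_lt_prime hf.ne' hqf hq).symm
  obtain ⟨γ, hγ⟩ := IsCyclic.exists_generator (α := (ZMod q)ˣ)
  obtain ⟨c, hcf, hcq⟩ := Nat.chineseRemainder hfq 1 (γ : ZMod q).val
  have hcγ : (c : ZMod q) = γ := by
    rw [(ZMod.natCast_eq_natCast_iff _ _ _).2 hcq, ZMod.natCast_zmod_val]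
  have hcM : c.Coprime (f * q) := by
    refine Nat.Coprime.mul_right ?_ ?_
    · exact hcf.gcd_eq.trans (Nat.gcd_one_left f)
    · exact (ZMod.isUnit_iff_coprime c q).1 (hcγ ▸ γ.isUnit)
  obtain ⟨σ, hσ⟩ := hK (f * q) c (Nat.mul_pos hf hq.pos) (dvd_mul_right f q) hcf hcM
  have hσq : ∀ b : Ω, b ^ q = 1 → σ b = b ^ c := fun b hb =>
    hσ b (by rw [mul_comm, pow_mul, hb, one_pow])
  obtain ⟨t, htq, ht0, ht⟩ := exists_ne_zero_apply_eq_smul hq hσq (N := l) (fun j hj => by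
    have h1 : γ ^ j = 1 := by
      ext
      rw [Units.val_pow_eq_pow_val, ← hcγ]
      have := (ZMod.natCast_eq_natCast_iff _ _ _).2 hj
      push_cast at this
      exact this
    have h2 := orderOf_dvd_of_pow_eq_one h1
    rw [orderOf_eq_card_of_forall_mem_zpowers hγ, Nat.card_eq_fintype_card,
      ZMod.card_units_eq_totient, Nat.totient_prime hq] at h2
    exact ((Nat.modEq_iff_dvd' hq.one_lt.le).1 hql.symm).trans h2) hω.pow_eq_one
  have hωl : (algebraMap K Ω ω) ^ l = 1 := by rw [← map_pow, hω.pow_eq_one, map_one]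
  have hpow : ∀ i : ℕ, (σ ^ i) t = algebraMap K Ω ω ^ i * t := by
    intro i
    induction i with
    | zero => simp
    | succ i ih => rw [pow_succ', AlgEquiv.mul_apply, ih, map_mul, map_pow, σ.commutes, ht]; ring
  obtain ⟨s, hs⟩ : t ^ l ∈ Set.range (algebraMap K Ω) := by
    rw [InfiniteGalois.mem_range_algebraMap_iff_fixed]
    intro τ
    obtain ⟨d, hd, hτ⟩ := exists_forall_apply_eq_pow K q τ
    obtain ⟨i, hi⟩ := mem_powers_iff_mem_zpowers.2 (hγ (ZMod.unitOfCoprime d hd))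
    have hdi : c ^ i ≡ d [MOD q] := by
      rw [← ZMod.natCast_eq_natCast_iff, ← ZMod.coe_unitOfCoprime d hd, ← hi]
      push_cast
      rw [hcγ]
    have h1 : τ t = (σ ^ i) t := by
      refine apply_eq_apply_of_mem_cyclotomic K (fun b hb => ?_) htq
      rw [hτ b hb, pow_apply_of_apply_eq_pow (hσq b hb)]
      exact (pow_eq_pow_of_modEq hdi hb).symm
    rw [map_pow, h1, hpow, mul_pow, ← pow_mul, mul_comm i, pow_mul, hωl, one_pow, one_mul]
  have hs0 : s ≠ 0 := by
    rintro rfl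
    rw [map_zero] at hs
    exact ht0 (pow_eq_zero_iff hl.ne' |>.1 hs.symm)
  -- Here `n = l * q`, because `t` lies in the field of `q`-th roots of unity, and `t ^ (Λ * (l *
  -- q)) = s ^ (Λ * q)`.
  obtain ⟨z, hz⟩ := h.exists_pow_eq (Ω := Ω) hΛ (Nat.mul_pos hl hq.pos) (pow_ne_zero (Λ * q) hs0)
    (cyclotomic_mono K Ω (Dvd.intro_left (Λ * l) (mul_assoc Λ l q)) htq)
    (by rw [map_pow, hs, ← pow_mul]; congr 1; ring)
  have hz0 : z ≠ 0 := by
    rintro rfl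
    rw [zero_pow (Nat.mul_pos hl hq.pos).ne'] at hz
    exact pow_ne_zero _ hs0 hz.symm
  have hz0' : algebraMap K Ω z ≠ 0 := by simpa using hz0
  obtain ⟨ε, hε⟩ : ∃ ε, ε * algebraMap K Ω z = t ^ Λ := ⟨t ^ Λ / algebraMap K Ω z, by field_simp⟩
  have hε1 : ε ^ (l * q) = 1 := by
    have h1 : (ε * algebraMap K Ω z) ^ (l * q) = algebraMap K Ω z ^ (l * q) := by
      rw [hε, ← map_pow, hz, map_pow, hs]
      ring
    rw [mul_pow] at h1
    exact mul_right_cancel₀ (pow_ne_zero _ hz0') (h1.trans (one_mul _).symm)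
  have hε0 : ε ≠ 0 := fun h0 => by
    rw [h0, zero_pow (Nat.mul_pos hl hq.pos).ne'] at hε1
    exact zero_ne_one hε1
  have hσε : σ ε = algebraMap K Ω ω ^ Λ * ε := by
    have h1 := congrArg σ hε
    rw [map_mul, map_pow, ht, σ.commutes, mul_pow, ← hε, ← mul_assoc] at h1
    exact mul_right_cancel₀ hz0' h1
  -- `ε ^ q` is an `l`-th root of unity, hence a power of `ω`, which lies in `K`.
  have hεq : σ (ε ^ q) = ε ^ q := by
    have h1 : IsPrimitiveRoot (algebraMap K Ω ω) l := hω.map_of_injective (algebraMap K Ω).injective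
    have : NeZero l := ⟨hl.ne'⟩
    obtain ⟨i, -, hi⟩ := h1.eq_pow_of_pow_eq_one
      (show (ε ^ q) ^ l = 1 by rw [← pow_mul, mul_comm, hε1])
    rw [← hi, ← map_pow, σ.commutes]
  have h1 : (ω ^ Λ) ^ q = 1 := by
    apply (algebraMap K Ω).injective
    rw [map_pow, map_pow, map_one]
    rw [map_pow, hσε, mul_pow] at hεq
    exact mul_right_cancel₀ (pow_ne_zero q hε0) (hεq.trans (one_mul _).symm)
  have h2 : l ∣ Λ * q := hω.dvd_of_pow_eq_one _ (by rw [pow_mul, h1])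
  refine Nat.Coprime.dvd_of_dvd_mul_right ?_ h2
  have := hql.gcd_eq
  rw [Nat.gcd_one_left] at this
  exact Nat.Coprime.symm this

/-- If `Λ = 2 (2 w + 1)`, then `(-4) ^ (2 w + 1)` is the `2 Λ`-th power of `1 + i`, so it is a
square in `K`. Then `-1` is a square in `K`, and `h4` applies. -/
theorem HasChevalleyBassProperty.four_dvd {Λ : ℕ} (hΛ : 0 < Λ) (h : HasChevalleyBassProperty K Λ)
    (h2 : 2 ∣ Λ) (h4 : ∀ i : K, i ^ 2 = -1 → 4 ∣ Λ) : 4 ∣ Λ := by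
  by_contra hn
  obtain ⟨u, rfl⟩ := h2
  obtain ⟨w, rfl⟩ : Odd u := by
    rw [← Nat.not_even_iff_odd]
    rintro ⟨v, rfl⟩
    exact hn ⟨v, by ring⟩
  obtain ⟨I, hI⟩ : ∃ I : AlgebraicClosure K, I ^ 2 = -1 := IsAlgClosed.exists_pow_nat_eq _ two_pos
  have hI4 : (1 + I) ^ 4 = -4 := by linear_combination (I ^ 2 + 4 * I + 5) * hI
  obtain ⟨z, hz⟩ := h.exists_pow_eq (Ω := AlgebraicClosure K) hΛ two_pos
    (x := (-4) ^ (2 * w + 1)) (pow_ne_zero _ (by norm_num)) (y := 1 + I)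
    (add_mem (one_mem _) (mem_cyclotomic K (by
      rw [show 2 * (2 * w + 1) * 2 = 2 * (2 * (2 * w + 1)) by ring, pow_mul, hI, pow_mul]
      norm_num)))
    (by
      rw [show 2 * (2 * w + 1) * 2 = 4 * (2 * w + 1) by ring, pow_mul, hI4, map_pow, map_neg,
        map_ofNat])
  refine hn (h4 (z / (2 * (-4) ^ w)) ?_)
  have h0 : ((-4 : K) ^ w) ≠ 0 := pow_ne_zero _ (by norm_num)
  rw [div_pow, hz, div_eq_iff (pow_ne_zero 2 (mul_ne_zero two_ne_zero h0))]
  ring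

/-- Here `f` is the part of the conductor prime to `p`, and `η` of order `p ^ (e + 1)` already lies
in `K(ζ_{p^e f})`. Its `p ^ e (Λ₀ f)`-th power has order `p`, hence is in `K`; extracting the root
promised by the property gives a root of unity of order `p ^ (e - a + 1)` in `K`. -/
theorem HasChevalleyBassProperty.le_add_of_cyclotomic_le {Λ : ℕ} (hΛ : 0 < Λ)
    (h : HasChevalleyBassProperty K Λ) {p e f s : ℕ} (hp : p.Prime) (hf : 0 < f)
    (hpf : ¬ p ∣ f)     (hcyc : cyclotomic K Ω (p ^ (e + 1) * f) ≤ cyclotomic K Ω (p ^ e * f))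
    {ω : K} (hω : IsPrimitiveRoot ω p)
    (hs : ∀ (j : ℕ) (ζ : K), IsPrimitiveRoot ζ (p ^ j) → j ≤ s) :
    e + 1 ≤ s + Λ.factorization p := by
  by_contra! hlt
  set a := Λ.factorization p with ha
  obtain ⟨Λ₀, hΛ₀, hΛeq⟩ : ∃ Λ₀, ¬ p ∣ Λ₀ ∧ Λ = p ^ a * Λ₀ :=
    ⟨_, Nat.not_dvd_ordCompl hp hΛ.ne', (Nat.ordProj_mul_ordCompl_eq_self Λ p).symm⟩
  have : Fact p.Prime := ⟨hp⟩
  have hpe : 0 < p ^ (e + 1) := pow_pos hp.pos _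
  have : NeZero (p ^ (e + 1)) := ⟨hpe.ne'⟩
  obtain ⟨η, hη⟩ := exists_isPrimitiveRoot Ω (p ^ (e + 1))
  have hΛn : Λ * (p ^ (e - a) * f) = p ^ e * (Λ₀ * f) := by
    rw [hΛeq, show p ^ e = p ^ a * p ^ (e - a) by rw [← pow_add]; congr 1; omega]
    ring
  have hη1 : IsPrimitiveRoot (η ^ p ^ e) p := hη.pow hpe (pow_succ p e)
  have hη2 : IsPrimitiveRoot ((η ^ p ^ e) ^ (Λ₀ * f)) p := by
    refine hη1.pow_of_coprime _ ?_
    rw [Nat.coprime_comm, hp.coprime_iff_not_dvd]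
    exact fun h => (hp.dvd_mul.1 h).elim hΛ₀ hpf
  obtain ⟨i, -, hi⟩ := (hω.map_of_injective (algebraMap K Ω).injective).eq_pow_of_pow_eq_one
    hη2.pow_eq_one
  rw [← map_pow] at hi
  have hx : IsPrimitiveRoot (ω ^ i) p :=
    IsPrimitiveRoot.of_map_of_injective (f := algebraMap K Ω) (by rwa [hi])
      (algebraMap K Ω).injective
  obtain ⟨z, hz⟩ := h.exists_pow_eq (Ω := Ω) hΛ (n := p ^ (e - a) * f)
    (Nat.mul_pos (pow_pos hp.pos _) hf) (hx.ne_zero hp.ne_zero) (y := η)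
    (by
      refine cyclotomic_mono K Ω ?_ (hcyc (mem_cyclotomic K ?_))
      · rw [hΛn]
        exact Nat.mul_dvd_mul_left _ (dvd_mul_left _ _)
      · rw [pow_mul, hη.pow_eq_one, one_pow])
    (by rw [hΛn, hi, pow_mul])
  have hz1 : orderOf (z ^ f) = p ^ (e - a + 1) := by
    have h1 : (z ^ f) ^ p ^ (e - a) = ω ^ i := by rw [← hz, ← pow_mul, mul_comm]
    refine orderOf_eq_prime_pow ?_ ?_
    · rw [h1]
      exact hx.ne_one hp.one_lt
    · rw [pow_succ, pow_mul, h1, hx.pow_eq_one]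
  have h1 := hs (e - a + 1) (z ^ f) (hz1 ▸ IsPrimitiveRoot.orderOf (z ^ f))
  omega

end

/-! ### The upper bound for the Chevalley-Bass number -/

open IntermediateField

/-- The sum is `(c ^ p ^ k - 1) / (c - 1)`, of `p`-adic valuation exactly `k` by lifting the
exponent. For `p = 2` the condition `a ≥ 2` makes `c ≡ 1` modulo `4`, so that `c + 1` has valuation
`1`. -/
theorem Nat.orderOf_dvd_of_geom_sum {p a k c : ℕ} (hp : p.Prime) (ha : 1 ≤ a)
    (ha2 : p = 2 → 2 ≤ a) (hk : k ≠ 0) (hc : c ≡ 1 + p ^ a [MOD p ^ (a + k)]) {n : ℕ}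
    (hn : n ∣ p ^ (a + k)) (hn' : n ∣ ∑ i ∈ Finset.range (p ^ k), c ^ i) : n ∣ p ^ k := by
  have : Fact p.Prime := ⟨hp⟩
  have hpk : p ^ k ≠ 0 := pow_ne_zero _ hp.ne_zero
  have hc1 : c ≡ 1 [MOD p ^ a] := by
    refine (hc.of_dvd (pow_dvd_pow p (Nat.le_add_right a k))).trans ?_
    simp [Nat.ModEq]
  have hc2 : ¬ c ≡ 1 [MOD p ^ (a + 1)] := by
    intro h
    have h1 : 1 + p ^ a ≡ 1 + 0 [MOD p ^ (a + 1)] :=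
      (hc.of_dvd (pow_dvd_pow p (by omega))).symm.trans h
    have h2 := (Nat.modEq_zero_iff_dvd).1 (Nat.ModEq.add_left_cancel' 1 h1)
    have := (Nat.pow_dvd_pow_iff_le_right hp.one_lt).1 h2
    omega
  have hpc : ¬ p ∣ c := by
    intro h
    have h1 := (hc1.of_dvd (dvd_pow_self p (by omega : a ≠ 0))).symm.trans
      ((Nat.modEq_zero_iff_dvd).2 h)
    exact hp.one_lt.ne' (Nat.dvd_one.1 ((Nat.modEq_zero_iff_dvd).1 h1))
  have hclt : 1 < c := by
    rcases Nat.lt_trichotomy c 1 with h | h | h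
    · exact absurd (by rw [Nat.lt_one_iff.1 h]; exact dvd_zero p) hpc
    · exact absurd (by rw [h]) hc2
    · exact h
  have hva : padicValNat p (c - 1) = a := by
    have h1 : p ^ a ∣ c - 1 := (Nat.modEq_iff_dvd' hclt.le).1 hc1.symm
    have h2 : ¬ p ^ (a + 1) ∣ c - 1 := fun h => hc2 ((Nat.modEq_iff_dvd' hclt.le).2 h).symm
    rw [padicValNat_dvd_iff_le (by omega)] at h1 h2
    omega
  have hpc1 : p ∣ c - 1 := (dvd_pow_self p (by omega)).trans
    ((Nat.modEq_iff_dvd' hclt.le).1 hc1.symm)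
  have hlte : padicValNat p (c ^ p ^ k - 1) = a + k := by
    rcases hp.eq_two_or_odd' with rfl | hodd
    · have h1 := padicValNat.pow_two_sub_pow hclt hpc1 hpc hpk
        ((Nat.even_pow.2 ⟨even_two, hk⟩))
      rw [one_pow, hva, padicValNat.prime_pow] at h1
      have h2 : padicValNat 2 (c + 1) = 1 := by
        have h3 : c ≡ 1 [MOD 4] := hc1.of_dvd (pow_dvd_pow 2 (ha2 rfl))
        have h4 : 2 ^ 1 ∣ c + 1 := by unfold Nat.ModEq at h3; omega
        have h5 : ¬ 2 ^ 2 ∣ c + 1 := by unfold Nat.ModEq at h3; omega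
        rw [padicValNat_dvd_iff_le (by omega)] at h4 h5
        omega
      omega
    · have h1 := padicValNat.pow_sub_pow hodd hclt hpc1 hpc hpk
      rwa [one_pow, hva, padicValNat.prime_pow] at h1
  have hgeom : (∑ i ∈ Finset.range (p ^ k), c ^ i) * (c - 1) = c ^ p ^ k - 1 := by
    have h := Nat.geomSum_eq hclt (p ^ k)
    rw [h]
    exact Nat.div_mul_cancel (by simpa using Nat.sub_dvd_pow_sub_pow c 1 (p ^ k))
  have hS0 : ∑ i ∈ Finset.range (p ^ k), c ^ i ≠ 0 := by
    intro h
    rw [h, zero_mul] at hgeom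
    have := Nat.one_lt_pow hpk hclt
    omega
  have hvS : padicValNat p (∑ i ∈ Finset.range (p ^ k), c ^ i) = k := by
    have h := padicValNat.mul hS0 (by omega : c - 1 ≠ 0) (p := p)
    rw [hgeom, hlte, hva] at h
    omega
  obtain ⟨j, -, rfl⟩ := (Nat.dvd_prime_pow hp).1 hn
  rw [padicValNat_dvd_iff_le hS0, hvS] at hn'
  exact pow_dvd_pow p hn'

theorem Nat.pow_prime_pow_modEq_one {p a k c : ℕ} (ha : 1 ≤ a)
    (hc : c ≡ 1 [MOD p ^ a]) : c ^ p ^ k ≡ 1 [MOD p ^ (a + k)] := by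
  induction k with
  | zero => simpa using hc
  | succ k ih =>
    have h1 := Nat.modEq_iff_dvd.1 ih.symm
    rw [pow_succ, pow_mul, ← add_assoc]
    refine (Nat.modEq_iff_dvd.2 ?_).symm
    push_cast at h1 ⊢
    set d : ℤ := (c : ℤ) ^ p ^ k
    have h2 : (p : ℤ) ∣ ∑ i ∈ Finset.range p, d ^ i := by
      have h3 : (p : ℤ) ∣ ∑ i ∈ Finset.range p, (d ^ i - 1) := Finset.dvd_sum fun i _ =>
        ((dvd_pow_self (p : ℤ) (by omega)).trans h1).trans (by
          simpa using sub_dvd_pow_sub_pow d 1 i)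
      rw [Finset.sum_sub_distrib] at h3
      simpa using h3
    rw [← geom_sum_mul, pow_succ, mul_comm]
    exact mul_dvd_mul h2 h1

section

variable {K Ω : Type*} [Field K] [CharZero K] [Field Ω] [CharZero Ω] [Algebra K Ω] [IsAlgClosed Ω]
  [IsGalois K Ω]

-- Some `σ` moves `ζ_p`, so on `μ_{p^k}` it acts as `b ↦ b ^ (m + 1)` with `p ∤ m`, and `b ↦ b ^ m`
-- is bijective there. Hence `Y` can be changed by a root of unity to be fixed by `σ`; as `σ`
-- commutes with every `τ` on `K(ζ_N)`, the modified `Y` is fixed by all `τ`.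
omit [CharZero K] in
theorem exists_pow_eq_of_no_primitiveRoot {p : ℕ} (hp : p.Prime)
    (hno : ¬ ∃ ω : K, IsPrimitiveRoot ω p) {N : ℕ} (hN : 0 < N) {Y : Ω}
    (hY : Y ∈ cyclotomic K Ω N) {x : K} (hx : x ≠ 0) {k : ℕ}
    (hYx : Y ^ p ^ k = algebraMap K Ω x) (hpN : p ^ k ∣ N) : ∃ z : K, z ^ p ^ k = x := by
  rcases Nat.eq_zero_or_pos k with rfl | hk
  · exact ⟨x, by simp⟩
  have : NeZero N := ⟨hN.ne'⟩
  have hpk : 0 < p ^ k := pow_pos hp.pos k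
  have : NeZero (p ^ k) := ⟨hpk.ne'⟩
  have : NeZero p := ⟨hp.ne_zero⟩
  have hx' : algebraMap K Ω x ≠ 0 := by simpa using hx
  have hY0 : Y ≠ 0 := by
    rintro rfl
    rw [zero_pow hpk.ne'] at hYx
    exact hx' hYx.symm
  obtain ⟨ζ, hζ⟩ := exists_isPrimitiveRoot Ω p
  obtain ⟨σ, hσ⟩ : ∃ σ : Gal(Ω/K), σ ζ ≠ ζ := by
    by_contra! h
    obtain ⟨ω, rfl⟩ := (InfiniteGalois.mem_range_algebraMap_iff_fixed ζ).2 h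
    exact hno ⟨ω, IsPrimitiveRoot.of_map_of_injective hζ (algebraMap K Ω).injective⟩
  obtain ⟨c, hc, hσc⟩ := exists_forall_apply_eq_pow K (p ^ k) σ
  have hppk : p ∣ p ^ k := dvd_pow_self p hk.ne'
  have hζpk : ζ ^ p ^ k = 1 := by
    obtain ⟨d, hd⟩ := hppk
    rw [hd, pow_mul, hζ.pow_eq_one, one_pow]
  obtain ⟨m, rfl⟩ : ∃ m, c = m + 1 := by
    refine Nat.exists_eq_succ_of_ne_zero ?_
    rintro rfl
    have h1 := Nat.le_of_dvd one_pos ((Nat.coprime_zero_left _).1 hc ▸ hppk)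
    exact absurd h1 (not_le.2 hp.one_lt)
  have hm : ¬ p ∣ m := by
    rintro ⟨d, rfl⟩
    apply hσ
    rw [hσc ζ hζpk, pow_succ, pow_mul, hζ.pow_eq_one, one_pow, one_mul]
  have hcop : ∀ b : Ω, b ^ p ^ k = 1 → m.Coprime (orderOf b) := fun b hb =>
    Nat.Coprime.coprime_dvd_right (orderOf_dvd_of_pow_eq_one hb)
      (Nat.Coprime.pow_right k ((Nat.coprime_comm.1 ((hp.coprime_iff_not_dvd).2 hm))))
  have hroot : ∀ (τ : Gal(Ω/K)) (y : Ω), y ^ p ^ k = algebraMap K Ω x → (τ y / y) ^ p ^ k = 1 := by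
    intro τ y hy
    rw [div_pow, ← map_pow, hy, τ.commutes, div_self hx']
  have hξ := hroot σ Y hYx
  set ξ := σ Y / Y with hξdef
  have hσY : σ Y = ξ * Y := by rw [hξdef, div_mul_cancel₀ _ hY0]
  have hξ0 : ξ ≠ 0 := fun h => by
    rw [h, zero_pow hpk.ne'] at hξ
    exact zero_ne_one hξ
  have hξi : ξ⁻¹ ^ p ^ k = 1 := by rw [inv_pow, hξ, inv_one]
  -- Solves `B ^ m = ξ⁻¹` inside `μ_{p^k}`, which is exactly what makes `Y * B` fixed by `σ`.
  obtain ⟨j, hj⟩ := exists_pow_eq_self_of_coprime (hcop _ hξi)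
  have hB : (ξ⁻¹ ^ j) ^ p ^ k = 1 := by rw [← pow_mul, mul_comm, pow_mul, hξi, one_pow]
  have hBm : (ξ⁻¹ ^ j) ^ m = ξ⁻¹ := by rw [← pow_mul, mul_comm, pow_mul, hj]
  set B := ξ⁻¹ ^ j with hBdef
  have hz : (Y * B) ^ p ^ k = algebraMap K Ω x := by rw [mul_pow, hYx, hB, mul_one]
  have hzN : Y * B ∈ cyclotomic K Ω N :=
    mul_mem hY (cyclotomic_mono K Ω hpN (mem_cyclotomic K hB))
  have hσz : σ (Y * B) = Y * B := by
    rw [map_mul, hσY, hσc B hB, pow_succ, hBm]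
    field_simp
  have hz0 : Y * B ≠ 0 := by
    intro h
    rw [h, zero_pow hpk.ne'] at hz
    exact hx' hz.symm
  obtain ⟨z, hzz⟩ : Y * B ∈ Set.range (algebraMap K Ω) := by
    rw [InfiniteGalois.mem_range_algebraMap_iff_fixed]
    intro τ
    have hε := hroot τ _ hz
    set ε := τ (Y * B) / (Y * B) with hεdef
    have hτz : τ (Y * B) = ε * (Y * B) := by rw [hεdef, div_mul_cancel₀ _ hz0]
    have hε0 : ε ≠ 0 := fun h => by
      rw [h, zero_pow hpk.ne'] at hε
      exact zero_ne_one hε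
    have h1 := apply_apply_comm_of_mem_cyclotomic K σ τ hzN
    rw [hσz, hτz, map_mul, hσz, hσc ε hε] at h1
    have h2 := mul_right_cancel₀ hz0 h1
    rw [pow_succ] at h2
    have h3 : ε ^ m = 1 := mul_right_cancel₀ hε0 (h2.trans (one_mul ε).symm)
    have h4 : orderOf ε = 1 :=
      Nat.eq_one_of_dvd_coprimes (hcop ε hε) (orderOf_dvd_of_pow_eq_one h3) dvd_rfl
    rw [hτz, orderOf_eq_one_iff.1 h4, one_mul]
  refine ⟨z, (algebraMap K Ω).injective ?_⟩
  rw [map_pow, hzz, hz]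

-- Commutation of `σ` with `τ` on `K(ζ_N)`, where `τ Y = ε Y`, gives `τ ξ = ε ^ (c - 1) ξ = ε ^ (p ^
-- a) ξ`. So `Y ^ p ^ a` and `ξ` transform alike and their quotient lies in `K`.
omit [CharZero K] in
theorem exists_pow_eq_of_apply_eq_pow {p a k : ℕ} (hp : p.Prime) (ha : 1 ≤ a)
    (ha2 : p = 2 → 2 ≤ a) {N c : ℕ} (hN : 0 < N) (hpN : p ^ (a + k) ∣ N)
    (hc : c ≡ 1 + p ^ a [MOD p ^ (a + k)]) (hcN : c ^ p ^ k ≡ 1 [MOD N]) {σ : Gal(Ω/K)}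
    (hσ : ∀ b : Ω, b ^ N = 1 → σ b = b ^ c) {Y : Ω} (hY : Y ∈ cyclotomic K Ω N) {x : K}
    (hx : x ≠ 0) (hYx : Y ^ p ^ (a + k) = algebraMap K Ω x) : ∃ z : K, z ^ p ^ k = x := by
  rcases Nat.eq_zero_or_pos k with rfl | hk
  · exact ⟨x, by simp⟩
  have : NeZero N := ⟨hN.ne'⟩
  have hpak : 0 < p ^ (a + k) := pow_pos hp.pos _
  have hx' : algebraMap K Ω x ≠ 0 := by simpa using hx
  have hY0 : Y ≠ 0 := by
    rintro rfl
    rw [zero_pow hpak.ne'] at hYx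
    exact hx' hYx.symm
  have hσp : ∀ b : Ω, b ^ p ^ (a + k) = 1 → σ b = b ^ c := fun b hb => hσ b (by
    obtain ⟨d, hd⟩ := hpN
    rw [hd, pow_mul, hb, one_pow])
  have hroot : ∀ τ : Gal(Ω/K), (τ Y / Y) ^ p ^ (a + k) = 1 ∧ τ Y / Y ≠ 0 ∧
      τ Y = τ Y / Y * Y := by
    intro τ
    refine ⟨?_, div_ne_zero (by simpa using hY0) hY0, (div_mul_cancel₀ _ hY0).symm⟩
    rw [div_pow, ← map_pow, hYx, τ.commutes, div_self hx']
  obtain ⟨hξ, hξ0, hσY⟩ := hroot σ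
  set ξ := σ Y / Y
  have hpow : ∀ j : ℕ, (σ ^ j) Y = ξ ^ (∑ i ∈ Finset.range j, c ^ i) * Y := by
    intro j
    induction j with
    | zero => simp
    | succ j ih =>
      rw [pow_succ', AlgEquiv.mul_apply, ih, map_mul, map_pow, hσp ξ hξ, hσY, geom_sum_succ,
        pow_succ, pow_mul, mul_assoc]
  -- `σ ^ p ^ k` acts trivially on `μ_N`, hence on `Y`, so the geometric sum kills `ξ`.
  have hξk : ξ ^ p ^ k = 1 := by
    apply orderOf_dvd_iff_pow_eq_one.1
    refine Nat.orderOf_dvd_of_geom_sum hp ha ha2 hk.ne' hc (orderOf_dvd_of_pow_eq_one hξ)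
      (orderOf_dvd_of_pow_eq_one ?_)
    have h1 : (σ ^ p ^ k) Y = (1 : Gal(Ω/K)) Y := by
      refine apply_eq_apply_of_mem_cyclotomic K (fun b hb => ?_) hY
      rw [pow_apply_of_apply_eq_pow (hσ b hb), AlgEquiv.one_apply]
      exact (pow_eq_pow_of_modEq hcN hb).trans (pow_one b)
    rw [hpow, AlgEquiv.one_apply] at h1
    exact mul_right_cancel₀ hY0 (h1.trans (one_mul Y).symm)
  obtain ⟨z, hz⟩ : Y ^ p ^ a / ξ ∈ Set.range (algebraMap K Ω) := by
    rw [InfiniteGalois.mem_range_algebraMap_iff_fixed]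
    intro τ
    obtain ⟨hε, hε0, hτY⟩ := hroot τ
    set ε := τ Y / Y
    have hεc : ε ^ c = ε ^ (1 + p ^ a) := pow_eq_pow_of_modEq hc hε
    have h1 := apply_apply_comm_of_mem_cyclotomic K σ τ hY
    rw [hσY, hτY, map_mul, map_mul, hσp ε hε, hσY, hτY, hεc, pow_add, pow_one] at h1
    have h2 : τ ξ = ε ^ p ^ a * ξ := by
      have h3 : ε * Y ≠ 0 := mul_ne_zero hε0 hY0
      refine mul_right_cancel₀ h3 (h1.symm.trans ?_)
      ring
    rw [map_div₀, map_pow, hτY, h2, mul_pow, mul_div_mul_left _ _ (pow_ne_zero _ hε0)]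
  refine ⟨z, (algebraMap K Ω).injective ?_⟩
  rw [map_pow, hz, div_pow, hξk, div_one, ← pow_mul, ← pow_add, hYx]

/-- The upper bound for the Chevalley-Bass number. -/
theorem CyclotomicCharacterContains.hasChevalleyBassProperty {f F : ℕ} (hf : 0 < f)
    (hK : CyclotomicCharacterContains K Ω f) (hF : 0 < F)
    (hpF : ∀ p : ℕ, p.Prime → (∃ ω : K, IsPrimitiveRoot ω p) →
      f.factorization p ≤ F.factorization p ∧ 1 ≤ F.factorization p ∧
        (p = 2 → 2 ≤ F.factorization p)) : HasChevalleyBassProperty K F := by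
  intro n hn x hx hy
  have hFn : 0 < F * n := Nat.mul_pos hF hn
  have : NeZero (F * n) := ⟨hFn.ne'⟩
  rw [exists_pow_eq_algebraMap_iff K (Ω := Ω)] at hy
  obtain ⟨y, hyF, hyx⟩ := hy
  refine exists_pow_eq_of_forall_prime_pow hx hn.ne' fun p hp => ?_
  by_cases hω : ∃ ω : K, IsPrimitiveRoot ω p
  · obtain ⟨h1, h2, h3⟩ := hpF p hp hω
    set a := F.factorization p with ha
    set k := n.factorization p with hk
    have hfac : (F * n).factorization p = a + k := by
      rw [Nat.factorization_mul hF.ne' hn.ne', Finsupp.add_apply]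
    -- The level is enlarged to a multiple of `f`; since `ord_p f ≤ a`, its `p`-part remains `p ^ (a
    -- + k)`.
    have hM : 0 < (F * n).lcm f := Nat.lcm_pos hFn hf
    have hMfac : ((F * n).lcm f).factorization p = a + k := by
      rw [Nat.factorization_lcm hFn.ne' hf.ne', Finsupp.sup_apply, hfac]
      exact sup_eq_left.2 (by omega)
    set M := (F * n).lcm f with hMdef
    set M' := M / p ^ (a + k) with hM'
    have hMM' : p ^ (a + k) * M' = M := by
      rw [hM', ← hMfac]; exact Nat.ordProj_mul_ordCompl_eq_self M p
    have hpM' : p.Coprime M' := by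
      rw [hM', ← hMfac]; exact Nat.coprime_ordCompl hp hM.ne'
    -- This `c` is `1` modulo `p ^ a` and modulo the prime-to-`p` part `M'`, hence modulo `f`, so
    -- the character of `K` takes this value.
    obtain ⟨c, hc, hc'⟩ := Nat.chineseRemainder (Nat.Coprime.pow_left (a + k) hpM') (1 + p ^ a) 1
    have hca : c ≡ 1 [MOD p ^ a] := by
      refine (hc.of_dvd (pow_dvd_pow p (Nat.le_add_right a k))).trans ?_
      simp [Nat.ModEq]
    have hfdvd : f ∣ p ^ a * M' := by
      rw [← Nat.ordProj_mul_ordCompl_eq_self f p]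
      refine Nat.mul_dvd_mul (pow_dvd_pow p h1) ?_
      rw [hM', ← hMfac]
      exact Nat.ordCompl_dvd_ordCompl_of_dvd (Nat.dvd_lcm_right _ _) p
    have hcf : c ≡ 1 [MOD f] := ((Nat.modEq_and_modEq_iff_modEq_mul
      (Nat.Coprime.pow_left a hpM')).1 ⟨hca, hc'⟩).of_dvd hfdvd
    have hcM : c.Coprime M := by
      rw [← hMM']
      refine Nat.Coprime.mul_right (Nat.Coprime.pow_right _ ?_) (hc'.gcd_eq.trans
        (Nat.gcd_one_left _))
      exact (hca.of_dvd (dvd_pow_self p (by omega))).gcd_eq.trans (Nat.gcd_one_left _)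
    obtain ⟨σ, hσ⟩ := hK M c hM (Nat.dvd_lcm_right _ _) hcf hcM
    have hcN : c ^ p ^ k ≡ 1 [MOD M] := by
      rw [← hMM']
      refine (Nat.modEq_and_modEq_iff_modEq_mul (Nat.Coprime.pow_left _ hpM')).1
        ⟨Nat.pow_prime_pow_modEq_one h2 hca, ?_⟩
      simpa using hc'.pow (p ^ k)
    have hdvd : p ^ (a + k) ∣ F * n := hfac ▸ Nat.ordProj_dvd (F * n) p
    obtain ⟨d, hd⟩ := hdvd
    refine exists_pow_eq_of_apply_eq_pow hp h2 h3 hM (Dvd.intro M' hMM') hc hcN hσ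
      (Y := y ^ d) (pow_mem (cyclotomic_mono K Ω (Nat.dvd_lcm_left _ _) hyF) d) hx ?_
    rw [← pow_mul, mul_comm d, ← hd, hyx]
  · have hdvd : p ^ n.factorization p ∣ F * n := (Nat.ordProj_dvd n p).mul_left F
    obtain ⟨d, hd⟩ := hdvd
    refine exists_pow_eq_of_no_primitiveRoot hp hω hFn (Y := y ^ d) (pow_mem hyF d) hx ?_
      (Dvd.intro d hd.symm)
    rw [← pow_mul, mul_comm d, ← hd, hyx]

end

/-! ### Assembling the bounds -/

open IntermediateField

/-- For odd `u`, a `2 u`-th root of unity is a `u`-th root of unity up to sign. -/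
theorem IntermediateField.cyclotomic_two_mul_le (k : Type*) {Ω : Type*} [Field k] [Field Ω]
    [Algebra k Ω] {u : ℕ} (hu : Odd u) : cyclotomic k Ω (2 * u) ≤ cyclotomic k Ω u := by
  refine adjoin_le_iff.2 fun b hb => ?_
  have hb' : (b ^ u) ^ 2 = 1 := by rw [← pow_mul, mul_comm]; exact hb
  rcases sq_eq_sq_iff_eq_or_eq_neg.1 (hb'.trans (one_pow 2).symm) with h | h
  · exact mem_cyclotomic k h
  · rw [← neg_neg b]
    exact neg_mem (mem_cyclotomic k (by rw [hu.neg_pow, h, neg_neg]))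

theorem fPrime_factorization {l f : ℕ} {p : ℕ} (hp : p.Prime) :
    (∏ q ∈ l.primeFactors, q ^ padicValNat q f).factorization p =
      if p ∈ l.primeFactors then f.factorization p else 0 := by
  have h1 : ∀ q ∈ l.primeFactors, q ^ padicValNat q f ≠ 0 := fun q hq =>
    pow_ne_zero _ (Nat.prime_of_mem_primeFactors hq).ne_zero
  rw [Nat.factorization_prod h1, Finsupp.finsetSum_apply, Nat.factorization_def f hp]
  rw [← Finset.sum_ite_eq' l.primeFactors p (fun q => padicValNat q f)]
  refine Finset.sum_congr rfl fun q hq => ?_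
  rw [(Nat.prime_of_mem_primeFactors hq).factorization_pow, Finsupp.single_apply]

section

variable {k K Ω : Type*} [Field k] [Field K] [CharZero K] [Field Ω] [CharZero Ω]
  [Algebra k K] [Algebra K Ω] [Algebra k Ω] [IsScalarTower k K Ω] [IsAlgClosed Ω] [IsGalois K Ω]

/-- All divisibilities are checked prime by prime. The key one is `F ∣ l * Λ`, equivalent to `F / l
∣ Λ` once `l ∣ F` is known. -/
theorem exists_isChevalleyBassNumber_and_dvd {L : IntermediateField k K}
    (hL : ∀ E : IntermediateField k K, IsAbelianGalois k E → E ≤ L)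
    (hirr : ∀ n : ℕ, 0 < n → Irreducible (Polynomial.cyclotomic n k)) {f : ℕ} (hf : 0 < f)
    (hLf : ∀ x ∈ L, algebraMap K Ω x ∈ cyclotomic k Ω f)
    (hmin : ∀ n : ℕ, 0 < n → (∀ x ∈ L, algebraMap K Ω x ∈ cyclotomic k Ω n) → f ≤ n)
    (hroots : ∀ (n : ℕ) (ζ : K), 0 < n → IsPrimitiveRoot ζ n → n ∣ 2 * f) :
    ∃ Λ : ℕ, IsChevalleyBassNumber K Λ ∧
      Nat.lcm 4 (Nat.lcm (numRootsOfUnity K)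
        (fPrime (numRootsOfUnity K) f / numRootsOfUnity K)) ∣ Λ ∧
      Λ ∣ fPrime (numRootsOfUnity K) f := by
  have hf0 := hf.ne'
  have hK : CyclotomicCharacterContains K Ω f := fun M c hM hfM hc hcM =>
    have : NeZero M := ⟨hM.ne'⟩
    exists_gal_apply_eq_pow hL (hirr M hM) hLf hfM hc hcM
  obtain ⟨hl0, hl⟩ := numRootsOfUnity_pos_and_dvd_iff (K := K) (Nat.mul_pos two_pos hf) hroots
  set l := numRootsOfUnity K
  have h2l : 2 ∣ l := (hl 2 two_pos).1 ⟨-1, IsPrimitiveRoot.neg_one 0 (by norm_num)⟩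
  -- the conductor is odd or divisible by `4`
  have hpar : 2 ∣ f → 4 ∣ f := by
    rintro ⟨u, rfl⟩
    by_contra h
    have hu : Odd u := by
      rw [← Nat.not_even_iff_odd]
      rintro ⟨v, rfl⟩
      exact h ⟨v, by ring⟩
    have h1 := hmin u (by omega) fun x hx => cyclotomic_two_mul_le k hu (hLf x hx)
    omega
  -- The orders of roots of unity in `K` divide `2 f`. If `4 ∣ f`, then `1 + f` is prime to `2 f`,
  -- so some `σ` acts by `1 + f`; it fixes roots of unity in `K`, so their orders divide `f`.
  have hrootf : 4 ∣ f → ∀ n : ℕ, 0 < n → n ∣ l → n ∣ f := by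
    intro h4 n hn hnl
    obtain ⟨ζ, hζ⟩ := (hl n hn).2 hnl
    have hcop : (1 + f).Coprime (2 * f) := by
      refine Nat.Coprime.mul_right ?_ (by simp)
      rw [Nat.coprime_comm, Nat.prime_two.coprime_iff_not_dvd]
      omega
    obtain ⟨σ, hσ⟩ := hK (2 * f) (1 + f) (by omega) (dvd_mul_left f 2) (by simp [Nat.ModEq]) hcop
    have hζΩ := hζ.map_of_injective (algebraMap K Ω).injective
    obtain ⟨d, hd⟩ := hroots n ζ hn hζ
    have h1 := hσ (algebraMap K Ω ζ) (by rw [hd, pow_mul, hζΩ.pow_eq_one, one_pow])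
    rw [σ.commutes, pow_add, pow_one] at h1
    refine hζΩ.dvd_of_pow_eq_one f ?_
    exact (mul_left_cancel₀ (hζΩ.ne_zero hn.ne') ((mul_one _).trans h1)).symm
  -- the factorization of `f'`
  obtain ⟨F, hF⟩ : ∃ F, F = fPrime l f := ⟨_, rfl⟩
  have hprod0 : ∏ p ∈ l.primeFactors, p ^ padicValNat p f ≠ 0 := Finset.prod_ne_zero_iff.2
    fun q hq => pow_ne_zero _ (Nat.prime_of_mem_primeFactors hq).ne_zero
  have hF0 : F ≠ 0 := by
    rw [hF, fPrime]
    split_ifs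
    · exact hprod0
    · exact mul_ne_zero (by norm_num) hprod0
  have hmem : ∀ p : ℕ, p.Prime → (p ∈ l.primeFactors ↔ p ∣ l) := fun p hp =>
    ⟨Nat.dvd_of_mem_primeFactors, fun h => Nat.mem_primeFactors.2 ⟨hp, h, hl0.ne'⟩⟩
  have hFdvd : ∀ p : ℕ, p.Prime → p ∣ l → (4 ∣ f ∨ p ≠ 2) →
      F.factorization p = f.factorization p := by
    intro p hp hpl h
    rw [hF, fPrime]
    split_ifs with h4
    · rw [fPrime_factorization hp, if_pos ((hmem p hp).2 hpl)]
    · rw [Nat.factorization_mul (by norm_num) hprod0, Finsupp.add_apply, fPrime_factorization hp,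
        if_pos ((hmem p hp).2 hpl), Nat.factorization_eq_zero_of_not_dvd, zero_add]
      intro h5
      have := (Nat.prime_dvd_prime_iff_eq hp Nat.prime_two).1
        (hp.dvd_of_dvd_pow (show p ∣ 2 ^ 2 from h5))
      tauto
  have hF2 : ¬ 4 ∣ f → F.factorization 2 = 2 := by
    intro h4
    have h2f : ¬ 2 ∣ f := fun h => h4 (hpar h)
    rw [hF, fPrime, if_neg h4, Nat.factorization_mul (by norm_num) hprod0, Finsupp.add_apply,
      fPrime_factorization Nat.prime_two, if_pos ((hmem 2 Nat.prime_two).2 h2l),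
      Nat.factorization_eq_zero_of_not_dvd h2f, show (4 : ℕ) = 2 ^ 2 by norm_num,
      Nat.prime_two.factorization_pow, Finsupp.single_eq_same]
  have hFnot : ∀ p : ℕ, p.Prime → ¬ p ∣ l → F.factorization p = 0 := by
    intro p hp hpl
    have hp2 : p ≠ 2 := by rintro rfl; exact hpl h2l
    rw [hF, fPrime]
    split_ifs with h4
    · rw [fPrime_factorization hp, if_neg fun h => hpl ((hmem p hp).1 h)]
    · rw [Nat.factorization_mul (by norm_num) hprod0, Finsupp.add_apply, fPrime_factorization hp,
        if_neg fun h => hpl ((hmem p hp).1 h), Nat.factorization_eq_zero_of_not_dvd]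
      intro h5
      exact hp2 ((Nat.prime_dvd_prime_iff_eq hp Nat.prime_two).1
        (hp.dvd_of_dvd_pow (show p ∣ 2 ^ 2 from h5)))
  have hf2 : 4 ∣ f → 2 ≤ f.factorization 2 := fun h4 =>
    (Nat.prime_two.pow_dvd_iff_le_factorization hf0).1 (by simpa using h4)
  have hfodd : ∀ (p j : ℕ), p.Prime → p ≠ 2 → p ^ j ∣ l → j ≤ f.factorization p := by
    intro p j hp hp2 hpl
    obtain ⟨ζ, hζ⟩ := (hl _ (pow_pos hp.pos j)).2 hpl
    have h1 := hroots _ ζ (pow_pos hp.pos j) hζ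
    refine (hp.pow_dvd_iff_le_factorization hf0).1 (Nat.Coprime.dvd_of_dvd_mul_left ?_ h1)
    exact Nat.Coprime.pow_left _ ((Nat.coprime_primes hp Nat.prime_two).2 hp2)
  -- the upper bound
  have hvalid : HasChevalleyBassProperty K F := by
    refine hK.hasChevalleyBassProperty hf (Nat.pos_of_ne_zero hF0) fun p hp hω => ?_
    have hpl := (hl p hp.pos).1 hω
    by_cases h : 4 ∣ f ∨ p ≠ 2
    · rw [hFdvd p hp hpl h]
      refine ⟨le_rfl, ?_, ?_⟩
      · rcases eq_or_ne p 2 with rfl | hp2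
        · have := hf2 (h.resolve_right (by simp))
          omega
        · exact hfodd p 1 hp hp2 (by simpa using hpl)
      · rintro rfl
        exact hf2 (h.resolve_right (by simp))
    · push Not at h
      obtain ⟨h4, rfl⟩ := h
      rw [hF2 h4, Nat.factorization_eq_zero_of_not_dvd fun h => h4 (hpar h)]
      simp
  obtain ⟨Λ, hΛ⟩ := exists_isChevalleyBassNumber (Nat.pos_of_ne_zero hF0) hvalid
  have hΛ0 := hΛ.1.1
  obtain ⟨ω, hω⟩ := (hl l hl0).2 dvd_rfl
  have hlΛ : l ∣ Λ := hΛ.1.2.dvd_of_isPrimitiveRoot hf hK hΛ0 hl0 hω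
  have h4Λ : 4 ∣ Λ := hΛ.1.2.four_dvd hΛ0 (h2l.trans hlΛ) fun i hi =>
    ((hl 4 (by norm_num)).1 ⟨i, by
      have : Fact (Nat.Prime 2) := ⟨Nat.prime_two⟩
      have h1 : orderOf i = 2 ^ (1 + 1) := by
        refine orderOf_eq_prime_pow ?_ ?_
        · rw [pow_one, hi]; norm_num
        · rw [show 2 ^ (1 + 1) = 2 * 2 by norm_num, pow_mul, hi]; norm_num
      have h2 := IsPrimitiveRoot.orderOf i
      rwa [h1] at h2⟩).trans hlΛ
  have hlF : l ∣ F := by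
    rw [← Nat.factorization_prime_le_iff_dvd hl0.ne' hF0]
    intro p hp
    by_cases hpl : p ∣ l
    · have hps : p ^ l.factorization p ∣ l := Nat.ordProj_dvd l p
      rcases eq_or_ne p 2 with rfl | hp2
      · by_cases h4 : 4 ∣ f
        · rw [hFdvd 2 hp hpl (Or.inl h4)]
          exact (hp.pow_dvd_iff_le_factorization hf0).1 (hrootf h4 _ (by positivity) hps)
        · rw [hF2 h4]
          obtain ⟨ζ, hζ⟩ := (hl _ (by positivity)).2 hps
          have h1 := (hp.pow_dvd_iff_le_factorization (by omega)).1 (hroots _ ζ (by positivity) hζ)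
          rw [Nat.factorization_mul two_ne_zero hf0, Finsupp.add_apply, hp.factorization_self,
            Nat.factorization_eq_zero_of_not_dvd fun h => h4 (hpar h)] at h1
          omega
      · rw [hFdvd p hp hpl (Or.inr hp2)]
        exact hfodd p _ hp hp2 hps
    · rw [Nat.factorization_eq_zero_of_not_dvd hpl]
      exact Nat.zero_le _
  have hFlΛ : F ∣ l * Λ := by
    rw [← Nat.factorization_prime_le_iff_dvd hF0 (Nat.mul_pos hl0 hΛ0).ne']
    intro p hp
    rw [Nat.factorization_mul hl0.ne' hΛ0.ne', Finsupp.add_apply]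
    by_cases hpl : p ∣ l
    · by_cases h : 4 ∣ f ∨ p ≠ 2
      · rw [hFdvd p hp hpl h]
        have hl1 : 1 ≤ l.factorization p := hp.factorization_pos_of_dvd hl0.ne' hpl
        -- Exponent at most `1` is covered by `p ∣ l`. From exponent `2` on, the conductor can be
        -- tested at `f / p`, which is still divisible by `p`.
        by_cases he : f.factorization p ≤ 1
        · omega
        obtain ⟨e, he⟩ : ∃ e, f.factorization p = e + 2 :=
          ⟨f.factorization p - 2, by omega⟩
        obtain ⟨f₀, hf₀⟩ : ∃ f₀, f₀ = f / p ^ f.factorization p := ⟨_, rfl⟩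
        have hff₀ : p ^ (e + 1 + 1) * f₀ = f := by
          rw [hf₀, he.symm]; exact Nat.ordProj_mul_ordCompl_eq_self f p
        have hpf₀ : ¬ p ∣ f₀ := hf₀ ▸ Nat.not_dvd_ordCompl hp hf0
        have hf₀0 : 0 < f₀ := Nat.pos_of_ne_zero fun h => hpf₀ (h ▸ dvd_zero p)
        have hm0 : 0 < p ^ (e + 1) * f₀ := Nat.mul_pos (pow_pos hp.pos _) hf₀0
        have hmp : p ^ (e + 1) * f₀ * p = p ^ (e + 1 + 1) * f₀ := by ring
        -- By minimality of `f`, the field `L` is not contained in `k(ζ_{f/p})`.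
        have hcyc : cyclotomic K Ω (p ^ (e + 1 + 1) * f₀) ≤ cyclotomic K Ω (p ^ (e + 1) * f₀) := by
          rw [← hmp]
          refine cyclotomic_mul_le hp (Dvd.dvd.mul_right (dvd_pow_self p (by omega)) _) hm0
            (by rw [hmp, hff₀]; exact hLf) fun h => ?_
          have h1 := hmin _ hm0 h
          rw [← hff₀, ← hmp] at h1
          have h2 := Nat.mul_lt_mul_of_pos_left hp.one_lt hm0
          omega
        obtain ⟨ω', hω'⟩ := (hl p hp.pos).2 hpl
        have := hΛ.1.2.le_add_of_cyclotomic_le hΛ0 hp hf₀0 hpf₀ hcyc hω' (s := l.factorization p)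
          fun j ζ hζ => (hp.pow_dvd_iff_le_factorization hl0.ne').1
            ((hl _ (pow_pos hp.pos j)).1 ⟨ζ, hζ⟩)
        omega
      · push Not at h
        obtain ⟨h4, rfl⟩ := h
        rw [hF2 h4]
        have := (hp.pow_dvd_iff_le_factorization hΛ0.ne').1 (show 2 ^ 2 ∣ Λ from h4Λ)
        omega
    · rw [hFnot p hp hpl]
      exact Nat.zero_le _
  rw [← hF]
  refine ⟨Λ, hΛ, Nat.lcm_dvd h4Λ (Nat.lcm_dvd hlΛ ?_), hΛ.dvd (Nat.pos_of_ne_zero hF0) hvalid⟩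
  obtain ⟨d, rfl⟩ := hlF
  rw [Nat.mul_div_cancel_left d hl0]
  exact Nat.dvd_of_mul_dvd_mul_left hl0 hFlΛ

end

/-! ### The main theorem over `ℚ` -/

theorem IsPrimitiveRoot.dvd_two_mul_of_isCyclotomicExtension_rat {C : Type*} [Field C] [CharZero C]
    [inst : Algebra ℚ C] {f : ℕ} [NeZero f] [IsCyclotomicExtension {f} ℚ C] {ζ : C} {n : ℕ}
    (hζ : IsPrimitiveRoot ζ n) (hn : n ≠ 0) : n ∣ 2 * f := by
  obtain rfl : inst = DivisionRing.toRatAlgebra := Subsingleton.elim _ _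
  have := IsCyclotomicExtension.finiteDimensional {f} ℚ C
  have : NumberField C := ⟨⟩
  exact hζ.dvd_of_isCyclotomicExtension f hn

theorem IsPrimitiveRoot.dvd_two_mul_of_ringHom {K : Type*} [Field K] {ζ : K} {n f : ℕ} [NeZero f]
    (hζ : IsPrimitiveRoot ζ n) (hn : n ≠ 0) (g : K →+* CyclotomicField f ℚ) : n ∣ 2 * f :=
  have : NeZero (f : ℚ) := ⟨Nat.cast_ne_zero.2 (NeZero.ne f)⟩
  @IsPrimitiveRoot.dvd_two_mul_of_isCyclotomicExtension_rat (CyclotomicField f ℚ) _ _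
    (CyclotomicField.algebra f ℚ) f _ (CyclotomicField.isCyclotomicExtension f ℚ) _ n
    (hζ.map_of_injective g.injective) hn

theorem KroneckerWeber.exists_nonempty_ringHom_cyclotomicField_of_algebra (E : Type*) [Field E]
    [CharZero E] [inst : Algebra ℚ E] [FiniteDimensional ℚ E] [IsAbelianGalois ℚ E] :
    ∃ n : ℕ, 0 < n ∧ Nonempty (E →+* CyclotomicField n ℚ) := by
  obtain rfl : inst = DivisionRing.toRatAlgebra := Subsingleton.elim _ _
  have : NumberField E := ⟨⟩
  exact exists_nonempty_ringHom_cyclotomicField E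

theorem theorem1 (K : Type*) [Field K] [CharZero K]
    [FiniteDimensional ℚ (maxAbelianSubextension K)] :
    ∃ f Λ : ℕ, IsConductor (maxAbelianSubextension K) f ∧ IsChevalleyBassNumber K Λ ∧
      Nat.lcm 4 (Nat.lcm (numRootsOfUnity K)
        (fPrime (numRootsOfUnity K) f / numRootsOfUnity K)) ∣ Λ ∧
      Λ ∣ fPrime (numRootsOfUnity K) f := by
  classical
  let Ω := AlgebraicClosure K
  have : CharZero Ω := charZero_of_injective_algebraMap (algebraMap K Ω).injective
  let _ : Algebra ℚ (maxAbelianSubextension K) := (maxAbelianSubextension K).algebra'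
  have hab : IsAbelianGalois ℚ (maxAbelianSubextension K) :=
    isAbelianGalois_sSup _ fun E hE => hE
  have hL : ∀ E : IntermediateField ℚ K, IsAbelianGalois ℚ E → E ≤ maxAbelianSubextension K :=
    fun E hE => le_sSup hE
  have hiff : ∀ n : ℕ, 0 < n → (Nonempty (maxAbelianSubextension K →+* CyclotomicField n ℚ) ↔
      ∀ x ∈ maxAbelianSubextension K, algebraMap K Ω x ∈ cyclotomic ℚ Ω n) := by
    intro n hn
    have : NeZero n := ⟨hn.ne'⟩
    rw [← nonempty_algHom_cyclotomicField_iff]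
    exact ⟨fun ⟨g⟩ => ⟨g.toRatAlgHom⟩, fun ⟨g⟩ => ⟨g.toRingHom⟩⟩
  have hex : ∃ n, 0 < n ∧ Nonempty (maxAbelianSubextension K →+* CyclotomicField n ℚ) :=
    KroneckerWeber.exists_nonempty_ringHom_cyclotomicField_of_algebra _
  obtain ⟨f, hf⟩ : ∃ f, IsConductor (maxAbelianSubextension K) f :=
    ⟨Nat.find hex, Nat.find_spec hex, fun n hn => Nat.find_min' hex hn⟩
  obtain ⟨hf0, ⟨g⟩⟩ := hf.1
  have : NeZero f := ⟨hf0.ne'⟩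
  obtain ⟨Λ, hΛ⟩ := exists_isChevalleyBassNumber_and_dvd (Ω := Ω) hL
    (fun n hn => Polynomial.cyclotomic.irreducible_rat hn) hf0 ((hiff f hf0).1 ⟨g⟩)
    (fun n hn h => hf.2 ⟨hn, (hiff n hn).2 h⟩) fun n ζ hn hζ => by
      have : NeZero n := ⟨hn.ne'⟩
      -- Roots of unity in `K` generate abelian extensions of `ℚ`, so they already lie in `K_ab`,
      -- which embeds in the field of `f`-th roots of unity.
      have hζL : ζ ∈ maxAbelianSubextension K :=
        mem_of_algebraMap_mem_cyclotomic hL (n := n) (Ω := Ω) (mem_cyclotomic ℚ (by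
          rw [← map_pow, hζ.pow_eq_one, map_one]))
      have hζ' : IsPrimitiveRoot (⟨ζ, hζL⟩ : maxAbelianSubextension K) n :=
        IsPrimitiveRoot.of_map_of_injective (f := (maxAbelianSubextension K).val) hζ
          (RingHom.injective _)
      exact hζ'.dvd_two_mul_of_ringHom hn.ne' g
  exact ⟨f, Λ, hf, hΛ⟩
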